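/- Let $\omega=e^{i\pi/3}$. Consider a parabolic orbifold of signature $(2,2,2,2)$, $(3,3,3)$, $(2,4,4)$ or $(2,3,6)$, and let $G$ be its orbifold group, generated by the translations of the plane by the elements of a lattice $\Lambda$ and by one rotation $\rho$ about the origin: $\Lambda=\mathbb Z[i]$ and $\rho(z)=-z$ for $(2,2,2,2)$; $\Lambda=\mathbb Z[\omega]$ and $\rho(z)=\omega^2z$ for $(3,3,3)$; $\Lambda=\mathbb Z[i]$ and $\rho(z)=iz$ for $(2,4,4)$; $\Lambda=\mathbb Z[\omega]$ and $\rho(z)=\omega z$ for $(2,3,6)$. Use the coordinates on the plane given by the basis $(1,i)$, respectively $(1,\omega)$, of $\Lambda$, so that the plane is $\mathbb R^2$ and $\Lambda$ is $\mathbb Z^2$. The quotient $\mathcal O=\mathbb R^2/G$ is a topological sphere, with the orientation inherited from the plane; for $Q\subset\mathcal O$ let $\widetilde Q\subset\mathbb R^2$ be its full preimage. A marked Thurston map $(f,Q)$ on $\mathcal O$ is an orientation-preserving branched covering $f:\mathcal O\to\mathcal O$ of degree at least $2$ together with a finite set $Q\subset\mathcal O$ with $f(Q)\subset Q$ that contains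 the postcritical set $\bigcup_{n>0}f^{n}(\Omega_f)$, where $\Omega_f$ is the set of critical points of $f$. Two marked Thurston maps $(f,Q_f)$ and $(g,Q_g)$ are Thurston equivalent if there are orientation-preserving homeomorphisms $\phi_0,\phi_1:\mathcal O\to\mathcal O$ that coincide on $Q_f$, send $Q_f$ onto $Q_g$, are isotopic relative to $Q_f$, and satisfy $\phi_0\circ f=g\circ\phi_1$. For $i=1,2$ let $(l_i,Q_i)$ be a marked Thurston map on $\mathcal O$ such that $l_i$ is the quotient by $G$ of an affine map $L_i(z)=A_iz+b_i$ with $A_i\in M_2(\mathbb Z)$ and $b_i\in\mathbb R^2$, and suppose that no eigenvalue of $A_i$ is equal to $1$ or $-1$. If $(l_1,Q_1)$ and $(l_2,Q_2)$ are Thurston equivalent, then they are conjugate by the quotient of an affine map. More precisely, there are $g\in G$ and a real affine map $S:\mathbb R^2\to\mathbb R^2$ with linear part in $SL_2(\mathbb Z)$ such that $L_2=g\circ S\circ L_1\circ S^{-1}$ and $S(\widetilde Q_1)=\widetilde Q_2$, and $S$ descends to a homeomorphism $\sigma$ of $\mathcal O$ with $\sigma\circ l_1=l_2\circ\sigma$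 and $\sigma(Q_1)=Q_2$. -/

import Mathlib

/-- The real plane `ℝ²` (with its usual topology), in the coordinates given by a basis of the
translation lattice of the orbifold group, so that this lattice is `ℤ²`. -/
abbrev Plane : Type := Fin 2 → ℝ

/-- The signatures of the parabolic orbifolds whose underlying space is the compact quotient of the
plane by a discrete group of orientation-preserving Euclidean isometries, that quotient being a
topological sphere. -/
inductive ParabolicSignature : Type
  | s2222
  | s333
  | s244
  | s236

/-- The generating rotation about the origin of the orbifold group: `z ↦ -z`, `z ↦ w² z`, `z ↦ i z`,
`z ↦ w z` with `w = exp (iπ/3)`, written in the lattice basis `(1, i)` for the signatures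
`(2,2,2,2)` and `(2,4,4)`, and in the lattice basis `(1, w)` for `(3,3,3)` and `(2,3,6)`. -/
def ParabolicSignature.rot : ParabolicSignature → Matrix.SpecialLinearGroup (Fin 2) ℤ
  | .s2222 => ⟨!![-1, 0; 0, -1], by simp [Matrix.det_fin_two]⟩
  | .s333 => ⟨!![-1, -1; 1, 0], by simp [Matrix.det_fin_two]⟩
  | .s244 => ⟨!![0, -1; 1, 0], by simp [Matrix.det_fin_two]⟩
  | .s236 => ⟨!![0, -1; 1, 1], by simp [Matrix.det_fin_two]⟩

/-- The map `z ↦ A z + b` of the plane, for an integer matrix `A` and a real vector `b`. -/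
def intAffine (A : Matrix (Fin 2) (Fin 2) ℤ) (b : Plane) (z : Plane) : Plane :=
  Matrix.mulVec (A.map (fun n : ℤ => (n : ℝ))) z + b

theorem intAffine_comp (A B : Matrix (Fin 2) (Fin 2) ℤ) (a b z : Plane) :
    intAffine A a (intAffine B b z) = intAffine (A * B) (intAffine A a b) z := by
  have h : (A * B).map (fun n : ℤ => (n : ℝ))
      = A.map (fun n : ℤ => (n : ℝ)) * B.map (fun n : ℤ => (n : ℝ)) :=
    Matrix.map_mul (f := Int.castRingHom ℝ)
  simp only [intAffine, h, Matrix.mulVec_add, Matrix.mulVec_mulVec, add_assoc]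

theorem intAffine_intCast (A : Matrix (Fin 2) (Fin 2) ℤ) (u v : Fin 2 → ℤ) :
    intAffine A (fun i => (u i : ℝ)) (fun i => (v i : ℝ))
      = fun i => ((Matrix.mulVec A v + u) i : ℝ) := by
  funext i
  fin_cases i <;> simp [intAffine]

theorem intAffine_one (z : Plane) : intAffine 1 (fun _ => ((0 : ℤ) : ℝ)) z = z := by
  funext i
  fin_cases i <;> simp [intAffine]

/-- The orbifold group of a signature: all maps `z ↦ R z + v` with `v` in the lattice `ℤ²` and `R` a
power of the generating rotation. -/
def orbGroup (s : ParabolicSignature) : Subgroup (Plane ≃ᵃ[ℝ] Plane) where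
  carrier := {g | ∃ R ∈ Subgroup.zpowers s.rot, ∃ v : Fin 2 → ℤ,
    ∀ z, g z = intAffine (R : Matrix (Fin 2) (Fin 2) ℤ) (fun i => (v i : ℝ)) z}
  one_mem' := ⟨1, Subgroup.one_mem _, 0, fun z => by
    simpa using (intAffine_one z).symm⟩
  mul_mem' := by
    rintro g h ⟨R, hR, v, hg⟩ ⟨T, hT, w, hh⟩
    refine ⟨R * T, Subgroup.mul_mem _ hR hT,
      Matrix.mulVec (R : Matrix (Fin 2) (Fin 2) ℤ) w + v, fun z => ?_⟩
    rw [AffineEquiv.coe_mul, Function.comp_apply, hh, hg, intAffine_comp, intAffine_intCast]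
    rfl
  inv_mem' := by
    rintro g ⟨R, hR, v, hg⟩
    refine ⟨R⁻¹, Subgroup.inv_mem _ hR,
      -Matrix.mulVec ((R⁻¹ : Matrix.SpecialLinearGroup (Fin 2) ℤ) : Matrix (Fin 2) (Fin 2) ℤ) v,
      fun z => ?_⟩
    apply g.injective
    have h1 : g (g⁻¹ z) = z := g.apply_symm_apply z
    have h2 : (R : Matrix (Fin 2) (Fin 2) ℤ)
        * ((R⁻¹ : Matrix.SpecialLinearGroup (Fin 2) ℤ) : Matrix (Fin 2) (Fin 2) ℤ) = 1 := by
      rw [← Matrix.SpecialLinearGroup.coe_mul, mul_inv_cancel, Matrix.SpecialLinearGroup.coe_one]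
    rw [h1, hg, intAffine_comp, intAffine_intCast, Matrix.mulVec_neg, Matrix.mulVec_mulVec, h2]
    simpa using (intAffine_one z).symm

/-- Two points of the plane are equivalent if an element of the orbifold group moves one to the
other. -/
def orbSetoid (s : ParabolicSignature) : Setoid Plane where
  r x y := ∃ g ∈ orbGroup s, g x = y
  iseqv :=
    { refl := fun x => ⟨1, Subgroup.one_mem _, rfl⟩
      symm := by
        rintro x y ⟨g, hg, rfl⟩
        exact ⟨g⁻¹, Subgroup.inv_mem _ hg, g.symm_apply_apply x⟩
      trans := by
        rintro x y z ⟨g, hg, rfl⟩ ⟨h, hh, rfl⟩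
        exact ⟨h * g, Subgroup.mul_mem _ hh hg, rfl⟩ }

/-- The orbifold `ℝ² / G`, a topological sphere, with the quotient topology. -/
def Orb (s : ParabolicSignature) : Type := Quotient (orbSetoid s)

instance (s : ParabolicSignature) : TopologicalSpace (Orb s) :=
  inferInstanceAs (TopologicalSpace (Quotient (orbSetoid s)))

/-- The projection `ℝ² → ℝ² / G`. -/
def orbProj (s : ParabolicSignature) (z : Plane) : Orb s := Quotient.mk (orbSetoid s) z

/-- The points of the plane with a nontrivial stabilizer in the orbifold group; away from them the
projection to the orbifold is a local homeomorphism. -/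
def conePoints (s : ParabolicSignature) : Set Plane :=
  {z | ∃ g ∈ orbGroup s, g ≠ 1 ∧ g z = z}

/-- The unit vector with angle `t`. -/
noncomputable def unitVec (t : ℝ) : Plane := ![Real.cos t, Real.sin t]

/-- `h` has positive local index at `z`: for all small `r > 0`, the image under `h` of the circle
of radius `r` around `z`, run through once counterclockwise, avoids `h z` and winds around it a
positive number of times (`θ` is a continuous choice of the angle along the image curve). -/
def PositiveIndexAt (h : Plane → Plane) (z : Plane) : Prop :=
  ∀ᶠ r in nhdsWithin (0 : ℝ) (Set.Ioi 0),
    ∃ θ : ℝ → ℝ, Continuous θ ∧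
      (∀ t, ∃ ρ : ℝ, 0 < ρ ∧ h (z + r • unitVec t) - h z = ρ • unitVec (θ t)) ∧
      ∃ n : ℕ, 0 < n ∧ θ (2 * Real.pi) = θ 0 + 2 * Real.pi * n

/-- Preservation of the orientation that the orbifold inherits from the plane, for homeomorphisms
and, more generally, branched coverings: wherever the projection gives local coordinates at a point
and at its image, the map expressed in these coordinates has positive local index. -/
def OrientationPreserving {s : ParabolicSignature} (f : Orb s → Orb s) : Prop :=
  ∀ z w : Plane, z ∉ conePoints s → w ∉ conePoints s → f (orbProj s z) = orbProj s w →
    ∃ h : Plane → Plane, h z = w ∧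
      (∀ᶠ x in nhds z, ContinuousAt h x ∧ orbProj s (h x) = f (orbProj s x)) ∧
      PositiveIndexAt h z

/-- A (finite) branched covering of a compact surface by itself: a continuous map that in suitable
local charts at any point and at its image is `u ↦ u ^ k` with `k ≥ 1`. -/
def IsBranchedCovering {X : Type*} [TopologicalSpace X] (f : X → X) : Prop :=
  Continuous f ∧ ∀ x : X, ∃ (e e' : OpenPartialHomeomorph X ℂ) (k : ℕ), 1 ≤ k ∧
    x ∈ e.source ∧ e x = 0 ∧ e' (f x) = 0 ∧
    ∀ y ∈ e.source, f y ∈ e'.source ∧ e' (f y) = e y ^ k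

/-- The degree of a branched covering: the largest number of points in a fibre. -/
noncomputable def coveringDegree {X : Type*} (f : X → X) : ℕ∞ :=
  ⨆ y, (f ⁻¹' {y}).encard

/-- The critical points of a branched covering: the points where it is not locally injective. -/
def criticalSet {X : Type*} [TopologicalSpace X] (f : X → X) : Set X :=
  {x | ∀ U ∈ nhds x, ¬ Set.InjOn f U}

/-- The postcritical set, the union of the images `f^n (Ω_f)` for `n > 0`. -/
def postcriticalSet {X : Type*} [TopologicalSpace X] (f : X → X) : Set X :=
  ⋃ n : ℕ, ⋃ _ : 0 < n, f^[n] '' criticalSet f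

/-- `(f, Q)` is a marked Thurston map on the orbifold: `f` is an orientation-preserving branched
covering of degree at least `2`, and `Q` is a finite forward invariant set that contains the
postcritical set (which is therefore finite). -/
structure IsThurstonMap {s : ParabolicSignature} (f : Orb s → Orb s) (Q : Set (Orb s)) :
    Prop where
  branched : IsBranchedCovering f
  orientation : OrientationPreserving f
  two_le_degree : 2 ≤ coveringDegree f
  finite : Q.Finite
  postcritical_subset : postcriticalSet f ⊆ Q
  invariant : f '' Q ⊆ Q

/-- Two homeomorphisms are isotopic relative to `Q`: they are joined by a path of homeomorphisms
which is constant on `Q`. -/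
def IsotopicRel {X : Type*} [TopologicalSpace X] (φ₀ φ₁ : X ≃ₜ X) (Q : Set X) : Prop :=
  ∃ H : unitInterval × X → X, Continuous H ∧
    (∀ x, H (0, x) = φ₀ x) ∧ (∀ x, H (1, x) = φ₁ x) ∧
    (∀ t, IsHomeomorph fun x => H (t, x)) ∧
    ∀ t, ∀ q ∈ Q, H (t, q) = φ₀ q

/-- Thurston equivalence of marked Thurston maps. -/
def ThurstonEquivalent {s : ParabolicSignature} (f : Orb s → Orb s) (Qf : Set (Orb s))
    (g : Orb s → Orb s) (Qg : Set (Orb s)) : Prop :=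
  ∃ φ₀ φ₁ : Orb s ≃ₜ Orb s,
    OrientationPreserving φ₀ ∧ OrientationPreserving φ₁ ∧
    Set.EqOn φ₀ φ₁ Qf ∧ φ₀ '' Qf = Qg ∧ IsotopicRel φ₀ φ₁ Qf ∧
    ∀ x, φ₀ (f x) = g (φ₁ x)

/-- The self-map `l` of the orbifold is the quotient of the self-map `L` of the plane. -/
def IsQuotientOf {s : ParabolicSignature} (l : Orb s → Orb s) (L : Plane → Plane) : Prop :=
  ∀ z, l (orbProj s z) = orbProj s (L z)

/-- No eigenvalue of the integer matrix `A` is equal to `1` or `-1`. -/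
def NoEigenvaluePMOne (A : Matrix (Fin 2) (Fin 2) ℤ) : Prop :=
  ¬ Module.End.HasEigenvalue (Matrix.toLin' (A.map (fun n : ℤ => (n : ℝ)))) 1 ∧
  ¬ Module.End.HasEigenvalue (Matrix.toLin' (A.map (fun n : ℤ => (n : ℝ)))) (-1)

/-! Write `π` for the projection of the plane to the orbifold, `G` for the orbifold group, and let
`φ₀, φ₁` be a Thurston equivalence from `l₁` to `l₂`. The idea is to lift it to the plane and to see
that the lift agrees, at all points above marked points, with an affine map.

*Cone points.* The quotient of an affine map satisfies a transfer formula: the inverse orders of the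
points of a fibre add up to the degree times the inverse order of the image (`finsum_inv_order`). As
the degree is at least two, a finitely supported function that is multiplied by the degree under
summation over fibres vanishes (`eq_zero_of_finsum_preimage`). Hence all cone points are marked
(`IsThurstonMap.mem_of_orbOrder_ne_one`) and `φ₀` preserves the order of points
(`orbOrder_apply_of_equiv`).

*Lifting.* The isotopy from `φ₀` to `φ₁` therefore fixes the images of the cone points and preserves
orders. Locally it lifts to the plane: near a cone point of order `m` a lift is an `m`-th root, which
exists because the stabilizer acts by all `m`-th roots of unity (`exists_continuousOn_root`). Local
lifts differ by locally constant elements of `G`, as the countable set of cone points does not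
separate the plane, and the plane is simply connected, so they can be corrected to a global lift
(`exists_lift_of_local_lifts`). This yields lifts `F₀, F₁` of `φ₀, φ₁` that induce the same
automorphism of `G` and agree above the marked points (`exists_equivariant_lift`).

*Rigidity.* The automorphism acts on the translations by an integer matrix `M` of determinant `±1`.
The winding numbers of `F₀` along small and large circles agree, so that the determinant is `1`
(`det_nonneg_of_positiveIndexAt`). By uniqueness of lifts, `F₀ ∘ L₁ = k ∘ L₂ ∘ F₁` for some `k ∈ G`.
Let `A'` be the linear part of `k ∘ L₂`, so that `M A₁ = A' M`. Since `1` is not an eigenvalue, there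
is a `c` for which the affine map `S z = M z + c` satisfies `S ∘ L₁ = k ∘ L₂ ∘ S`. The difference
`F₀ - S` is periodic, hence takes finitely many values above the finite set of marked points; there
`F₀ = F₁`, so that `A'` maps this set of values into itself. But `A'` has no nonzero periodic vector
(`eq_zero_of_linAct_iterate_eq`), so that `F₀ = S` above the marked points. In particular this
holds at the lattice points, which are cone points, so that `S` and `F₀` induce the same automorphism
of `G`, and `S` descends to the required homeomorphism. -/

open Topology Filter

/-! ### The orbifold group in a complex coordinate -/

open Complex in
/-- The complex number `i` or `exp (iπ/3)` which, together with `1`, spans the lattice. -/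
noncomputable def ParabolicSignature.tau : ParabolicSignature → ℂ
  | .s2222 => I
  | .s333 => ⟨1 / 2, Real.sqrt 3 / 2⟩
  | .s244 => I
  | .s236 => ⟨1 / 2, Real.sqrt 3 / 2⟩

open Complex in
/-- The root of unity by which the generating rotation multiplies the complex coordinate. -/
noncomputable def ParabolicSignature.zeta : ParabolicSignature → ℂ
  | .s2222 => -1
  | .s333 => ⟨-1 / 2, Real.sqrt 3 / 2⟩
  | .s244 => I
  | .s236 => ⟨1 / 2, Real.sqrt 3 / 2⟩

theorem ParabolicSignature.tau_im_ne (s : ParabolicSignature) : s.tau.im ≠ 0 := by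
  cases s <;> simp [ParabolicSignature.tau]

/-- The complex coordinate of the plane, in which the orbifold group acts by Euclidean isometries:
the point with lattice coordinates `(x, y)` is sent to `x + y τ`. -/
noncomputable def coord (s : ParabolicSignature) : Plane ≃L[ℝ] ℂ :=
  LinearEquiv.toContinuousLinearEquiv
    { toFun := fun z => (z 0 : ℂ) + z 1 * s.tau
      map_add' := fun z w => by simp; ring
      map_smul' := fun a z => by simp; ring
      invFun := fun w => ![w.re - w.im / s.tau.im * s.tau.re, w.im / s.tau.im]
      left_inv := fun z => by
        have := s.tau_im_ne
        funext i
        fin_cases i <;> simp [this]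
      right_inv := fun w => by
        have := s.tau_im_ne
        apply Complex.ext <;> simp [this] }

theorem coord_apply (s : ParabolicSignature) (z : Plane) :
    coord s z = (z 0 : ℂ) + z 1 * s.tau := rfl

theorem ParabolicSignature.zeta_pow (s : ParabolicSignature) : s.zeta ^ 12 = 1 := by
  have h3 : (Real.sqrt 3) ^ 2 = 3 := Real.sq_sqrt (by norm_num)
  have e1 : (⟨-1 / 2, Real.sqrt 3 / 2⟩ : ℂ) ^ 3 = 1 := by
    apply Complex.ext <;> simp [pow_succ] <;>
      first | nlinarith [h3] | linear_combination (-(Real.sqrt 3) / 8) * h3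
  have e2 : (⟨1 / 2, Real.sqrt 3 / 2⟩ : ℂ) ^ 3 = -1 := by
    apply Complex.ext <;> simp [pow_succ] <;>
      first | nlinarith [h3] | linear_combination (-(Real.sqrt 3) / 8) * h3
  cases s
  · simp only [ParabolicSignature.zeta]; norm_num
  · simp only [ParabolicSignature.zeta]
    rw [show 12 = 3 * 4 from rfl, pow_mul, e1, one_pow]
  · simp only [ParabolicSignature.zeta]
    rw [show 12 = 4 * 3 from rfl, pow_mul, Complex.I_pow_four, one_pow]
  · simp only [ParabolicSignature.zeta]
    rw [show 12 = 3 * 4 from rfl, pow_mul, e2]; norm_num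

/-- An integer matrix acting linearly on the plane. -/
def linAct (R : Matrix (Fin 2) (Fin 2) ℤ) (z : Plane) : Plane :=
  Matrix.mulVec (R.map (fun n : ℤ => (n : ℝ))) z

theorem intAffine_eq (A : Matrix (Fin 2) (Fin 2) ℤ) (b z : Plane) :
    intAffine A b z = linAct A z + b := rfl

theorem linAct_apply_zero (A : Matrix (Fin 2) (Fin 2) ℤ) (z : Plane) :
    linAct A z 0 = A 0 0 * z 0 + A 0 1 * z 1 := by
  simp [linAct, Matrix.mulVec, dotProduct, Fin.sum_univ_two]

theorem linAct_apply_one (A : Matrix (Fin 2) (Fin 2) ℤ) (z : Plane) :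
    linAct A z 1 = A 1 0 * z 0 + A 1 1 * z 1 := by
  simp [linAct, Matrix.mulVec, dotProduct, Fin.sum_univ_two]

theorem linAct_mul (A B : Matrix (Fin 2) (Fin 2) ℤ) (z : Plane) :
    linAct (A * B) z = linAct A (linAct B z) := by
  have := intAffine_comp A B 0 0 z
  simp only [intAffine_eq] at this
  simpa [linAct] using this.symm

theorem linAct_add (A : Matrix (Fin 2) (Fin 2) ℤ) (z w : Plane) :
    linAct A (z + w) = linAct A z + linAct A w := Matrix.mulVec_add _ _ _

theorem linAct_sub (A : Matrix (Fin 2) (Fin 2) ℤ) (z w : Plane) :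
    linAct A (z - w) = linAct A z - linAct A w := Matrix.mulVec_sub _ _ _

theorem linAct_smul (A : Matrix (Fin 2) (Fin 2) ℤ) (a : ℝ) (z : Plane) :
    linAct A (a • z) = a • linAct A z := Matrix.mulVec_smul _ _ _

theorem linAct_zero (A : Matrix (Fin 2) (Fin 2) ℤ) : linAct A 0 = 0 := Matrix.mulVec_zero _

theorem linAct_one (z : Plane) : linAct 1 z = z := by
  funext i; fin_cases i <;> simp [linAct]

theorem continuous_linAct (A : Matrix (Fin 2) (Fin 2) ℤ) : Continuous (linAct A) :=
  Continuous.matrix_mulVec continuous_const continuous_id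

theorem coord_rot (s : ParabolicSignature) (z : Plane) :
    coord s (linAct s.rot z) = s.zeta * coord s z := by
  have h3 : (Real.sqrt 3) * (Real.sqrt 3) = 3 := Real.mul_self_sqrt (by norm_num)
  rw [coord_apply, coord_apply, linAct_apply_zero, linAct_apply_one]
  cases s <;> apply Complex.ext <;>
    simp [ParabolicSignature.rot, ParabolicSignature.tau, ParabolicSignature.zeta] <;>
    first | done | linear_combination (z 1 / 4) * h3 | ring

theorem exists_coord_linAct (s : ParabolicSignature) {R : Matrix.SpecialLinearGroup (Fin 2) ℤ}
    (hR : R ∈ Subgroup.zpowers s.rot) :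
    ∃ u : ℂ, u ^ 12 = 1 ∧ ∀ z, coord s (linAct R z) = u * coord s z := by
  have h0 : ∀ k : ℕ, ∃ u : ℂ, u ^ 12 = 1 ∧
      ∀ z, coord s (linAct ((s.rot ^ k : Matrix.SpecialLinearGroup (Fin 2) ℤ) :
        Matrix (Fin 2) (Fin 2) ℤ) z) = u * coord s z := by
    intro k
    refine ⟨s.zeta ^ k, by rw [← pow_mul, mul_comm, pow_mul, s.zeta_pow, one_pow], ?_⟩
    induction k with
    | zero => intro z; simp [linAct_one]
    | succ k ih =>
      intro z
      rw [pow_succ, Matrix.SpecialLinearGroup.coe_mul, linAct_mul, ih, coord_rot, pow_succ]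
      ring
  obtain ⟨k, rfl⟩ := hR
  obtain ⟨u, hu, h⟩ := h0 k.natAbs
  obtain hk | hk := Int.natAbs_eq k
  · refine ⟨u, hu, ?_⟩
    have : s.rot ^ k = s.rot ^ k.natAbs := by rw [← zpow_natCast, ← hk]
    simpa only [this] using h
  · refine ⟨u⁻¹, by rw [inv_pow, hu, inv_one], fun z => ?_⟩
    have h1 : s.rot ^ k.natAbs * s.rot ^ k = 1 := by
      rw [← zpow_natCast, ← zpow_add]
      nth_rewrite 2 [hk]
      rw [add_neg_cancel, zpow_zero]
    have h2 := h (linAct (s.rot ^ k : Matrix.SpecialLinearGroup (Fin 2) ℤ) z)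
    rw [← linAct_mul, ← Matrix.SpecialLinearGroup.coe_mul, h1, Matrix.SpecialLinearGroup.coe_one,
      linAct_one] at h2
    have hu0 : u ≠ 0 := by rintro rfl; norm_num at hu
    rw [h2, ← mul_assoc, inv_mul_cancel₀ hu0, one_mul]

/-- The integer vector `v` as a point of the plane. -/
def latticePt (v : Fin 2 → ℤ) : Plane := fun i => (v i : ℝ)

theorem latticePt_add (v w : Fin 2 → ℤ) : latticePt (v + w) = latticePt v + latticePt w := by
  funext i; simp [latticePt]

theorem latticePt_injective : Function.Injective latticePt := by
  intro v w h
  funext i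
  have h1 : (v i : ℝ) = w i := congrFun h i
  exact_mod_cast h1

theorem linAct_latticePt (A : Matrix (Fin 2) (Fin 2) ℤ) (v : Fin 2 → ℤ) :
    linAct A (latticePt v) = latticePt (A.mulVec v) := by
  funext i
  fin_cases i
  · rw [Fin.zero_eta, linAct_apply_zero]
    simp [latticePt, Matrix.mulVec, dotProduct, Fin.sum_univ_two]
  · rw [Fin.mk_one, linAct_apply_one]
    simp [latticePt, Matrix.mulVec, dotProduct, Fin.sum_univ_two]

/-- The factor `u` by which `g` multiplies differences in the complex coordinate, read off from the
images of `1` and `0`; meaningful only when `g` acts there as `z ↦ u z + v`, as the elements of the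
orbifold group do. -/
noncomputable def multiplier (s : ParabolicSignature) (g : Plane ≃ᵃ[ℝ] Plane) : ℂ :=
  coord s (g ![1, 0]) - coord s (g 0)

/-- In the complex coordinate, the elements of the orbifold group are the maps `z ↦ u z + v` for
certain twelfth roots of unity `u` and lattice vectors `v`. -/
theorem orbGroup_spec {s : ParabolicSignature} {g : Plane ≃ᵃ[ℝ] Plane} (hg : g ∈ orbGroup s) :
    ∃ v : Fin 2 → ℤ, multiplier s g ^ 12 = 1 ∧
      (∀ z, coord s (g z) = multiplier s g * coord s z + coord s (latticePt v)) := by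
  obtain ⟨R, hR, v, h⟩ := hg
  obtain ⟨u, hu, h1⟩ := exists_coord_linAct s hR
  have h2 : ∀ z, coord s (g z) = u * coord s z + coord s (latticePt v) := by
    intro z
    rw [h, intAffine_eq, map_add, h1]; rfl
  have h3 : multiplier s g = u := by
    rw [multiplier, h2, h2]
    simp [coord_apply]
  exact ⟨v, h3 ▸ hu, h3 ▸ h2⟩

theorem multiplier_pow {s : ParabolicSignature} {g : Plane ≃ᵃ[ℝ] Plane} (hg : g ∈ orbGroup s) :
    multiplier s g ^ 12 = 1 := (orbGroup_spec hg).choose_spec.1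

theorem multiplier_ne_zero {s : ParabolicSignature} {g : Plane ≃ᵃ[ℝ] Plane}
    (hg : g ∈ orbGroup s) : multiplier s g ≠ 0 := by
  intro h
  have := multiplier_pow hg
  rw [h] at this; norm_num at this

theorem norm_multiplier {s : ParabolicSignature} {g : Plane ≃ᵃ[ℝ] Plane} (hg : g ∈ orbGroup s) :
    ‖multiplier s g‖ = 1 :=
  Complex.norm_eq_one_of_pow_eq_one (multiplier_pow hg) (by norm_num)

theorem coord_sub_coord {s : ParabolicSignature} {g : Plane ≃ᵃ[ℝ] Plane} (hg : g ∈ orbGroup s)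
    (z w : Plane) :
    coord s (g z) - coord s (g w) = multiplier s g * (coord s z - coord s w) := by
  obtain ⟨v, -, h⟩ := orbGroup_spec hg
  rw [h, h]; ring

theorem norm_coord_sub {s : ParabolicSignature} {g : Plane ≃ᵃ[ℝ] Plane} (hg : g ∈ orbGroup s)
    (z w : Plane) : ‖coord s (g z) - coord s (g w)‖ = ‖coord s z - coord s w‖ := by
  rw [coord_sub_coord hg, norm_mul, norm_multiplier hg, one_mul]

theorem multiplier_mul {s : ParabolicSignature} {g h : Plane ≃ᵃ[ℝ] Plane} (hg : g ∈ orbGroup s) :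
    multiplier s (g * h) = multiplier s g * multiplier s h := by
  have h0 : multiplier s h = coord s (h ![1, 0]) - coord s (h 0) := rfl
  rw [h0, ← coord_sub_coord hg]; rfl

theorem multiplier_one (s : ParabolicSignature) : multiplier s 1 = 1 := by
  simp [multiplier, coord_apply]

theorem multiplier_npow {s : ParabolicSignature} {g : Plane ≃ᵃ[ℝ] Plane} (hg : g ∈ orbGroup s)
    (k : ℕ) : multiplier s (g ^ k) = multiplier s g ^ k := by
  induction k with
  | zero => simp [multiplier_one]
  | succ k ih => rw [pow_succ, pow_succ, multiplier_mul (Subgroup.pow_mem _ hg k), ih]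

/-- An element of the orbifold group is determined by its multiplier and one value. -/
theorem orbGroup_ext {s : ParabolicSignature} {g h : Plane ≃ᵃ[ℝ] Plane} (hg : g ∈ orbGroup s)
    (hh : h ∈ orbGroup s) (hm : multiplier s g = multiplier s h) {w : Plane} (hw : g w = h w) :
    g = h := by
  ext1 z
  apply (coord s).injective
  have h1 := coord_sub_coord hg z w
  have h2 := coord_sub_coord hh z w
  rw [hw, hm, ← h2] at h1
  exact sub_left_injective h1

/-- The translation by a lattice vector. -/
noncomputable def transl (v : Fin 2 → ℤ) : Plane ≃ᵃ[ℝ] Plane :=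
  AffineEquiv.constVAdd ℝ Plane (latticePt v)

theorem transl_apply (v : Fin 2 → ℤ) (z : Plane) : transl v z = z + latticePt v := by
  simp [transl, add_comm]

theorem transl_mem (s : ParabolicSignature) (v : Fin 2 → ℤ) : transl v ∈ orbGroup s := by
  refine ⟨1, Subgroup.one_mem _, v, fun z => ?_⟩
  rw [transl_apply, intAffine_eq, Matrix.SpecialLinearGroup.coe_one, linAct_one]; rfl

theorem transl_injective : Function.Injective transl := by
  intro v w h
  apply latticePt_injective
  have := congrArg (fun g : Plane ≃ᵃ[ℝ] Plane => g 0) h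
  simpa [transl_apply] using this

theorem transl_add (v w : Fin 2 → ℤ) : transl (v + w) = transl v * transl w := by
  ext1 z
  rw [AffineEquiv.mul_def, AffineEquiv.trans_apply, transl_apply, transl_apply, transl_apply,
    latticePt_add]
  abel

theorem exists_eq_transl {s : ParabolicSignature} {g : Plane ≃ᵃ[ℝ] Plane} (hg : g ∈ orbGroup s)
    (h : multiplier s g = 1) : ∃ v, g = transl v := by
  obtain ⟨v, -, hv⟩ := orbGroup_spec hg
  refine ⟨v, ?_⟩
  ext1 z
  apply (coord s).injective
  rw [hv, h, one_mul, ← map_add, transl_apply]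

theorem exists_eq_apply_zero {s : ParabolicSignature} {g : Plane ≃ᵃ[ℝ] Plane}
    (hg : g ∈ orbGroup s) : ∃ v, g 0 = latticePt v := by
  obtain ⟨v, -, hv⟩ := orbGroup_spec hg
  refine ⟨v, (coord s).injective ?_⟩
  rw [hv]; simp

theorem finite_twelfth_roots : {u : ℂ | u ^ 12 = 1}.Finite := by
  refine (Polynomial.nthRootsFinset 12 (1 : ℂ)).finite_toSet.subset fun u hu => ?_
  simpa [Polynomial.mem_nthRootsFinset] using hu

theorem finite_latticePt_ball (s : ParabolicSignature) (r : ℝ) :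
    {v : Fin 2 → ℤ | ‖coord s (latticePt v)‖ ≤ r}.Finite := by
  obtain ⟨K, hK0, hK⟩ := (coord s).symm.toContinuousLinearMap.bound
  have hb : ∀ v : Fin 2 → ℤ, ‖coord s (latticePt v)‖ ≤ r → ∀ i, |v i| ≤ ⌈K * r⌉ := by
    intro v hv i
    have h1 : ‖latticePt v‖ ≤ K * ‖coord s (latticePt v)‖ := by
      simpa using hK (coord s (latticePt v))
    have h2 : ‖latticePt v i‖ ≤ ‖latticePt v‖ := norm_le_pi_norm _ i
    have h3 : |(v i : ℝ)| ≤ K * r := by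
      calc |(v i : ℝ)| = ‖latticePt v i‖ := rfl
        _ ≤ K * ‖coord s (latticePt v)‖ := h2.trans h1
        _ ≤ K * r := by gcongr
    have h4 : ((|v i| : ℤ) : ℝ) ≤ (⌈K * r⌉ : ℝ) := by
      push_cast
      exact h3.trans (Int.le_ceil _)
    exact_mod_cast h4
  refine (Set.finite_Icc (fun _ => -⌈K * r⌉ : Fin 2 → ℤ) (fun _ => ⌈K * r⌉)).subset ?_
  intro v hv
  exact ⟨fun i => (abs_le.1 (hb v hv i)).1, fun i => (abs_le.1 (hb v hv i)).2⟩

/-- Only finitely many elements of the orbifold group move a point by at most `r`. -/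
theorem finite_orbGroup_near (s : ParabolicSignature) (w : Plane) (r : ℝ) :
    {g : Plane ≃ᵃ[ℝ] Plane | g ∈ orbGroup s ∧ ‖coord s (g w) - coord s w‖ ≤ r}.Finite := by
  have hfin := finite_twelfth_roots.prod
    ((finite_latticePt_ball s (r + 2 * ‖coord s w‖)).image latticePt)
  refine Set.Finite.of_finite_image (f := fun g => (multiplier s g, g 0)) (hfin.subset ?_) ?_
  · rintro _ ⟨g, ⟨hg, hr⟩, rfl⟩
    obtain ⟨v, hv⟩ := exists_eq_apply_zero hg
    refine ⟨multiplier_pow hg, v, ?_, hv.symm⟩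
    have h1 := norm_coord_sub hg 0 w
    rw [hv, (coord s).map_zero, zero_sub, norm_neg] at h1
    have h2 : coord s (latticePt v) = (coord s (latticePt v) - coord s (g w))
      + ((coord s (g w) - coord s w) + coord s w) := by ring
    have h3 := norm_add_le (coord s (latticePt v) - coord s (g w))
      ((coord s (g w) - coord s w) + coord s w)
    have h4 := norm_add_le (coord s (g w) - coord s w) (coord s w)
    rw [← h2] at h3
    change ‖_‖ ≤ _
    linarith
  · rintro g ⟨hg, -⟩ h ⟨hh, -⟩ he
    rw [Prod.mk.injEq] at he
    exact orbGroup_ext hg hh he.1 he.2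

/-- The orbifold group acts properly discontinuously: near a point `w`, only elements of the
stabilizer of `w` identify points. -/
theorem exists_discrete_radius (s : ParabolicSignature) (w : Plane) :
    ∃ δ > 0, ∀ g ∈ orbGroup s, ∀ z z' : Plane, ‖coord s z - coord s w‖ < δ →
      ‖coord s z' - coord s w‖ < δ → g z = z' → g w = w := by
  have hfin : {x | x ∈ (fun g : Plane ≃ᵃ[ℝ] Plane =>
      ‖coord s (g w) - coord s w‖) '' {g | g ∈ orbGroup s ∧ ‖coord s (g w) - coord s w‖ ≤ 1} ∧
      x ≠ 0}.Finite :=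
    ((finite_orbGroup_near s w 1).image (fun g => ‖coord s (g w) - coord s w‖)).subset
      fun x hx => hx.1
  have h0 : ∀ᶠ x in nhds (0 : ℝ), x ∉ {x | x ∈ (fun g : Plane ≃ᵃ[ℝ] Plane =>
      ‖coord s (g w) - coord s w‖) '' {g | g ∈ orbGroup s ∧ ‖coord s (g w) - coord s w‖ ≤ 1} ∧
      x ≠ 0} := hfin.isClosed.isOpen_compl.mem_nhds (by simp)
  obtain ⟨ε, hε, h1⟩ := Metric.eventually_nhds_iff.1 h0
  refine ⟨min ε 1 / 2, by positivity, fun g hg z z' hz hz' hgz => ?_⟩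
  have h2 : ‖coord s (g w) - coord s w‖ < min ε 1 := by
    have e1 : coord s (g w) - coord s w
      = (coord s z' - coord s w) - (coord s (g z) - coord s (g w)) := by rw [hgz]; ring
    have e2 := norm_sub_le (coord s z' - coord s w) (coord s (g z) - coord s (g w))
    rw [← e1, norm_coord_sub hg] at e2
    linarith
  by_contra hne
  refine h1 (y := ‖coord s (g w) - coord s w‖) ?_ ⟨⟨g, ⟨hg, ?_⟩, rfl⟩, ?_⟩
  · simpa using h2.trans_le (min_le_left _ _)
  · exact (h2.trans_le (min_le_right _ _)).le
  · rw [norm_ne_zero_iff, sub_ne_zero]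
    exact fun h => hne ((coord s).injective h)

/-- The stabilizer of a point in the orbifold group. -/
def stab (s : ParabolicSignature) (z : Plane) : Subgroup (Plane ≃ᵃ[ℝ] Plane) where
  carrier := {g | g ∈ orbGroup s ∧ g z = z}
  one_mem' := ⟨Subgroup.one_mem _, rfl⟩
  mul_mem' := by
    rintro g h ⟨hg, hgz⟩ ⟨hh, hhz⟩
    refine ⟨Subgroup.mul_mem _ hg hh, ?_⟩
    rw [AffineEquiv.coe_mul, Function.comp_apply, hhz, hgz]
  inv_mem' := by
    rintro g ⟨hg, hgz⟩
    refine ⟨Subgroup.inv_mem _ hg, ?_⟩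
    conv_lhs => rw [← hgz]
    exact g.symm_apply_apply z

theorem mem_stab {s : ParabolicSignature} {z : Plane} {g : Plane ≃ᵃ[ℝ] Plane} :
    g ∈ stab s z ↔ g ∈ orbGroup s ∧ g z = z := Iff.rfl

instance finite_stab (s : ParabolicSignature) (z : Plane) : Finite (stab s z) := by
  refine ((finite_orbGroup_near s z 0).subset ?_).to_subtype
  rintro g ⟨hg, hgz⟩
  exact ⟨hg, by simp [hgz]⟩

/-- The order of a point: the order of its stabilizer in the orbifold group. -/
noncomputable def order (s : ParabolicSignature) (z : Plane) : ℕ := Nat.card (stab s z)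

theorem order_pos (s : ParabolicSignature) (z : Plane) : 0 < order s z := Nat.card_pos

theorem notMem_conePoints_iff {s : ParabolicSignature} {z : Plane} :
    z ∉ conePoints s ↔ ∀ g ∈ orbGroup s, g z = z → g = 1 := by
  simp only [conePoints, Set.mem_ofPred_eq, not_exists, not_and]
  exact forall_congr' fun g => forall_congr' fun _ => ⟨fun h h1 => by_contra fun h2 => h h2 h1,
    fun h h1 h2 => h1 (h h2)⟩

theorem order_eq_one_iff {s : ParabolicSignature} {z : Plane} :
    order s z = 1 ↔ z ∉ conePoints s := by
  rw [order, Subgroup.card_eq_one, Subgroup.eq_bot_iff_forall, notMem_conePoints_iff]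
  exact ⟨fun h g h1 h2 => h g ⟨h1, h2⟩, fun h g hg => h g hg.1 hg.2⟩

theorem multiplier_pow_order {s : ParabolicSignature} {z : Plane} {g : Plane ≃ᵃ[ℝ] Plane}
    (hg : g ∈ stab s z) : multiplier s g ^ order s z = 1 := by
  rw [← multiplier_npow hg.1, order]
  have h2 : (⟨g, hg⟩ : stab s z) ^ Nat.card (stab s z) = 1 := pow_card_eq_one'
  have h3 : g ^ Nat.card (stab s z) = 1 := congrArg Subtype.val h2
  rw [h3, multiplier_one]

/-- The multipliers of the stabilizer of a point of order `m` are all the `m`-th roots of unity. -/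
theorem exists_stab_multiplier (s : ParabolicSignature) (z : Plane) {u : ℂ}
    (hu : u ^ order s z = 1) : ∃ g ∈ stab s z, multiplier s g = u := by
  have hinj : Set.InjOn (multiplier s) (stab s z : Set (Plane ≃ᵃ[ℝ] Plane)) := by
    intro g hg h hh he
    exact orbGroup_ext hg.1 hh.1 he (hg.2.trans hh.2.symm)
  have hsub : multiplier s '' (stab s z : Set (Plane ≃ᵃ[ℝ] Plane))
      ⊆ (Polynomial.nthRootsFinset (order s z) (1 : ℂ) : Set ℂ) := by
    rintro _ ⟨g, hg, rfl⟩
    rw [Finset.mem_coe, Polynomial.mem_nthRootsFinset (order_pos s z)]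
    exact multiplier_pow_order hg
  have hcard : (Polynomial.nthRootsFinset (order s z) (1 : ℂ) : Set ℂ).ncard
      ≤ (multiplier s '' (stab s z : Set (Plane ≃ᵃ[ℝ] Plane))).ncard := by
    rw [hinj.ncard_image, Set.ncard_coe_finset, ← Nat.card_coe_set_eq]
    refine (Multiset.toFinset_card_le _).trans ((Polynomial.card_nthRoots _ _).trans ?_)
    exact le_rfl
  have heq := Set.eq_of_subset_of_ncard_le hsub hcard (Finset.finite_toSet _)
  have : u ∈ (Polynomial.nthRootsFinset (order s z) (1 : ℂ) : Set ℂ) := by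
    rw [Finset.mem_coe, Polynomial.mem_nthRootsFinset (order_pos s z)]
    exact hu
  rw [← heq] at this
  exact this

theorem countable_orbGroup (s : ParabolicSignature) :
    (orbGroup s : Set (Plane ≃ᵃ[ℝ] Plane)).Countable := by
  have : (orbGroup s : Set (Plane ≃ᵃ[ℝ] Plane)) = ⋃ n : ℕ,
      {g | g ∈ orbGroup s ∧ ‖coord s (g 0) - coord s 0‖ ≤ n} := by
    ext g
    simp only [SetLike.mem_coe, Set.mem_iUnion, Set.mem_ofPred_eq, exists_and_left]
    exact ⟨fun h => ⟨h, exists_nat_ge _⟩, fun h => h.1⟩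
  rw [this]
  exact Set.countable_iUnion fun n => (finite_orbGroup_near s 0 n).countable

theorem fixed_unique {s : ParabolicSignature} {g : Plane ≃ᵃ[ℝ] Plane} (hg : g ∈ orbGroup s)
    {z w : Plane} (hz : g z = z) (hw : g w = w) (hzw : z ≠ w) : g = 1 := by
  have h := coord_sub_coord hg z w
  rw [hz, hw] at h
  have h0 : coord s z - coord s w ≠ 0 := sub_ne_zero.2 fun h => hzw ((coord s).injective h)
  refine orbGroup_ext hg (Subgroup.one_mem _) (w := z) ?_ hz
  rw [multiplier_one]
  exact (mul_right_cancel₀ h0 (by rw [one_mul, ← h])).symm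

theorem countable_conePoints (s : ParabolicSignature) : (conePoints s).Countable := by
  have : conePoints s = ⋃ g ∈ {g | g ∈ orbGroup s ∧ g ≠ 1}, {z | g z = z} := by
    ext z; simp [conePoints, and_assoc]
  rw [this]
  refine Set.Countable.biUnion ((countable_orbGroup s).mono fun g hg => hg.1) ?_
  rintro g ⟨hg, hg1⟩
  refine Set.Subsingleton.countable fun z hz w hw => ?_
  by_contra hzw
  exact hg1 (fixed_unique hg hz hw hzw)

theorem order_apply {s : ParabolicSignature} {g : Plane ≃ᵃ[ℝ] Plane} (hg : g ∈ orbGroup s)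
    (z : Plane) : order s (g z) = order s z := by
  refine Nat.card_congr
    { toFun := fun h => ⟨g⁻¹ * h * g, ?_, ?_⟩
      invFun := fun h => ⟨g * h * g⁻¹, ?_, ?_⟩
      left_inv := fun h => by ext1; simp [mul_assoc]
      right_inv := fun h => by ext1; simp [mul_assoc] }
  · exact Subgroup.mul_mem _ (Subgroup.mul_mem _ (Subgroup.inv_mem _ hg) h.2.1) hg
  · change g.symm (h.1 (g z)) = z
    rw [h.2.2]; exact g.symm_apply_apply z
  · exact Subgroup.mul_mem _ (Subgroup.mul_mem _ hg h.2.1) (Subgroup.inv_mem _ hg)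
  · change g (h.1 (g.symm (g z))) = g z
    rw [g.symm_apply_apply, h.2.2]

/-- The generating rotation as an affine map of the plane. -/
def rotEquiv (s : ParabolicSignature) : Plane ≃ᵃ[ℝ] Plane :=
  LinearEquiv.toAffineEquiv
    { toFun := linAct s.rot
      invFun := linAct (s.rot⁻¹ : Matrix.SpecialLinearGroup (Fin 2) ℤ)
      map_add' := linAct_add _
      map_smul' := linAct_smul _
      left_inv := fun z => by
        rw [← linAct_mul, ← Matrix.SpecialLinearGroup.coe_mul, inv_mul_cancel,
          Matrix.SpecialLinearGroup.coe_one, linAct_one]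
      right_inv := fun z => by
        rw [← linAct_mul, ← Matrix.SpecialLinearGroup.coe_mul, mul_inv_cancel,
          Matrix.SpecialLinearGroup.coe_one, linAct_one] }

theorem rotEquiv_apply (s : ParabolicSignature) (z : Plane) :
    rotEquiv s z = linAct s.rot z := rfl

theorem rotEquiv_mem (s : ParabolicSignature) : rotEquiv s ∈ orbGroup s := by
  refine ⟨s.rot, Subgroup.mem_zpowers _, 0, fun z => ?_⟩
  rw [rotEquiv_apply, intAffine_eq]
  funext i
  simp

theorem rotEquiv_ne_one (s : ParabolicSignature) : rotEquiv s ≠ 1 := by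
  intro h
  have h1 : linAct s.rot ![1, 0] = ![1, 0] := by rw [← rotEquiv_apply, h]; rfl
  have h2 := congrFun h1 0
  rw [linAct_apply_zero] at h2
  cases s <;> norm_num [ParabolicSignature.rot] at h2

/-- The lattice points are cone points, being the centres of conjugates of the generating
rotation. -/
theorem latticePt_mem_conePoints (s : ParabolicSignature) (v : Fin 2 → ℤ) :
    latticePt v ∈ conePoints s := by
  refine ⟨transl v * rotEquiv s * (transl v)⁻¹, Subgroup.mul_mem _ (Subgroup.mul_mem _
    (transl_mem s v) (rotEquiv_mem s)) (Subgroup.inv_mem _ (transl_mem s v)), ?_, ?_⟩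
  · intro h
    apply rotEquiv_ne_one s
    rw [mul_inv_eq_one] at h
    exact mul_left_cancel (h.trans (mul_one _).symm)
  · change transl v (rotEquiv s ((transl v).symm (latticePt v))) = latticePt v
    have h1 : transl v 0 = latticePt v := by rw [transl_apply, zero_add]
    have h2 : (transl v).symm (latticePt v) = 0 := by
      rw [← h1, AffineEquiv.symm_apply_apply]
    rw [h2, rotEquiv_apply, linAct_zero, h1]

/-! ### The projection to the orbifold and uniqueness of lifts -/

theorem continuous_affineEquiv (g : Plane ≃ᵃ[ℝ] Plane) : Continuous g :=
  AffineMap.continuous_of_finiteDimensional g.toAffineMap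

theorem orbProj_eq_iff {s : ParabolicSignature} {z w : Plane} :
    orbProj s z = orbProj s w ↔ ∃ g ∈ orbGroup s, g z = w := Quotient.eq (r := orbSetoid s)

theorem orbProj_apply {s : ParabolicSignature} {g : Plane ≃ᵃ[ℝ] Plane} (hg : g ∈ orbGroup s)
    (z : Plane) : orbProj s (g z) = orbProj s z :=
  (orbProj_eq_iff.2 ⟨g, hg, rfl⟩).symm

theorem continuous_orbProj (s : ParabolicSignature) : Continuous (orbProj s) :=
  continuous_quotient_mk'

theorem orbProj_surjective (s : ParabolicSignature) : Function.Surjective (orbProj s) :=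
  Quotient.exists_rep

theorem isOpenMap_orbProj (s : ParabolicSignature) : IsOpenMap (orbProj s) := by
  intro U hU
  have h1 : orbProj s ⁻¹' (orbProj s '' U) = ⋃ g ∈ orbGroup s, (g : Plane → Plane) ⁻¹' U := by
    ext z
    simp only [Set.mem_preimage, Set.mem_image, Set.mem_iUnion, exists_prop]
    constructor
    · rintro ⟨w, hw, h⟩
      obtain ⟨g, hg, rfl⟩ := orbProj_eq_iff.1 h.symm
      exact ⟨g, hg, hw⟩
    · rintro ⟨g, hg, hgz⟩
      exact ⟨g z, hgz, orbProj_apply hg z⟩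
  refine isOpen_coinduced.2 ?_
  change IsOpen (orbProj s ⁻¹' (orbProj s '' U))
  rw [h1]
  exact isOpen_biUnion fun g _ => hU.preimage (continuous_affineEquiv g)

theorem map_nhds_orbProj (s : ParabolicSignature) (z : Plane) :
    map (orbProj s) (𝓝 z) = 𝓝 (orbProj s z) :=
  (isOpenMap_orbProj s).map_nhds_eq (continuous_orbProj s).continuousAt

/-- The order of a point of the orbifold: the order of the points of the plane above it. -/
noncomputable def orbOrder (s : ParabolicSignature) (x : Orb s) : ℕ :=
  Quotient.lift (order s) (by rintro _ _ ⟨g, hg, rfl⟩; exact (order_apply hg _).symm) x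

theorem orbOrder_orbProj (s : ParabolicSignature) (z : Plane) :
    orbOrder s (orbProj s z) = order s z := rfl

theorem orbOrder_pos (s : ParabolicSignature) (x : Orb s) : 0 < orbOrder s x := by
  obtain ⟨z, rfl⟩ := orbProj_surjective s x
  exact order_pos s z

theorem eq_of_apply_eq {s : ParabolicSignature} {g h : Plane ≃ᵃ[ℝ] Plane} (hg : g ∈ orbGroup s)
    (hh : h ∈ orbGroup s) {w : Plane} (hw : w ∉ conePoints s) (he : g w = h w) : g = h := by
  have h1 := notMem_conePoints_iff.1 hw (h⁻¹ * g)
    (Subgroup.mul_mem _ (Subgroup.inv_mem _ hh) hg) (by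
      change h.symm (g w) = w
      rw [he, h.symm_apply_apply])
  rw [inv_mul_eq_one] at h1
  exact h1.symm

theorem eventually_norm_coord_lt (s : ParabolicSignature) (w : Plane) {δ : ℝ} (hδ : 0 < δ) :
    ∀ᶠ z in 𝓝 w, ‖coord s z - coord s w‖ < δ := by
  have : Tendsto (fun z => ‖coord s z - coord s w‖) (𝓝 w) (𝓝 0) := by
    have h : Continuous fun z => ‖coord s z - coord s w‖ := by fun_prop
    simpa using h.tendsto w
  exact this.eventually (gt_mem_nhds hδ)

/-- Near a point, an element of the orbifold group relating nearby points is in the stabilizer. -/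
theorem eventually_discrete (s : ParabolicSignature) (w : Plane) :
    ∃ U ∈ 𝓝 w, ∀ g ∈ orbGroup s, ∀ z ∈ U, g z ∈ U → g w = w := by
  obtain ⟨δ, hδ, h⟩ := exists_discrete_radius s w
  exact ⟨_, eventually_norm_coord_lt s w hδ, fun g hg z hz hgz => h g hg z _ hz hgz rfl⟩

section Uniqueness

variable {X : Type*} [TopologicalSpace X]

/-- Two lifts to the plane of the same map that avoid the cone points differ, over a connected set,
by an element of the orbifold group. -/
theorem exists_eqOn_of_isPreconnected {s : ParabolicSignature} {S : Set X} (hS : IsPreconnected S)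
    {F F' : X → Plane} (hF : ContinuousOn F S) (hF' : ContinuousOn F' S)
    (hp : ∀ y ∈ S, orbProj s (F y) = orbProj s (F' y)) (hc : ∀ y ∈ S, F y ∉ conePoints s) :
    ∃ g ∈ orbGroup s, ∀ y ∈ S, F' y = g (F y) := by
  have h0 : ∀ y : S, ∃ g ∈ orbGroup s, g (F y) = F' y := fun y => orbProj_eq_iff.1 (hp y y.2)
  choose κ hκ hκF using h0
  have hFc : Continuous fun y : S => F y := continuousOn_iff_continuous_domRestrict.1 hF
  have hFc' : Continuous fun y : S => F' y := continuousOn_iff_continuous_domRestrict.1 hF'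
  have hloc : IsLocallyConstant κ := by
    rw [IsLocallyConstant.iff_eventually_eq]
    intro x
    obtain ⟨U, hU, hd⟩ := eventually_discrete s (F x)
    have h1 : ∀ᶠ y : S in 𝓝 x, F y ∈ U := hFc.continuousAt hU
    have h2 : ∀ᶠ y : S in 𝓝 x, (κ x).symm (F' y) ∈ U := by
      have h3 : ContinuousAt (fun y : S => (κ x).symm (F' y)) x :=
        ((continuous_affineEquiv (κ x).symm).comp hFc').continuousAt
      apply h3
      change U ∈ 𝓝 ((κ x).symm (F' x))
      rw [← hκF x, AffineEquiv.symm_apply_apply]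
      exact hU
    filter_upwards [h1, h2] with y hy1 hy2
    have h4 := hd ((κ x)⁻¹ * κ y) (Subgroup.mul_mem _ (Subgroup.inv_mem _ (hκ x)) (hκ y)) (F y) hy1
      (by change (κ x).symm (κ y (F y)) ∈ U; rwa [hκF])
    have h5 := notMem_conePoints_iff.1 (hc x x.2) _
      (Subgroup.mul_mem _ (Subgroup.inv_mem _ (hκ x)) (hκ y)) h4
    rw [inv_mul_eq_one] at h5
    exact h5.symm
  rcases S.eq_empty_or_nonempty with rfl | ⟨x, hx⟩
  · exact ⟨1, Subgroup.one_mem _, by simp⟩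
  · have : PreconnectedSpace S := isPreconnected_iff_preconnectedSpace.1 hS
    refine ⟨κ ⟨x, hx⟩, hκ _, fun y hy => ?_⟩
    rw [← hκF ⟨y, hy⟩, hloc.apply_eq_of_preconnectedSpace ⟨y, hy⟩ ⟨x, hx⟩]

/-- A set that does not separate the space locally: every point has arbitrarily small neighbourhoods
in which the complement of the set is connected and dense. -/
def LocallyNonseparating (B : Set X) : Prop :=
  ∀ x, ∀ U ∈ 𝓝 x, ∃ V ∈ 𝓝 x, V ⊆ U ∧ IsPreconnected (V \ B) ∧ V ⊆ closure (V \ B)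

theorem LocallyNonseparating.exists_notMem {B : Set X} (hB : LocallyNonseparating B) {x : X}
    {p : X → Prop} (hp : ∀ᶠ y in 𝓝 x, p y) : ∃ y, p y ∧ y ∉ B := by
  obtain ⟨V, hV, hVU, -, hcl⟩ := hB x _ hp
  have h1 : (V \ B).Nonempty := closure_nonempty_iff.1 ⟨x, hcl (mem_of_mem_nhds hV)⟩
  obtain ⟨y, hy⟩ := h1
  exact ⟨y, hVU hy.1, hy.2⟩

/-- The local form of the uniqueness of lifts: two lifts of the same map differ near a point by an
element of the orbifold group. On the complement of `B`, which is connected, this holds because the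
action is free there, and it extends to `B` by density. -/
theorem exists_eventuallyEq_of_lifts {s : ParabolicSignature} {B : Set X}
    (hB : LocallyNonseparating B) {F F' : X → Plane} {x : X}
    (hF : ∀ᶠ y in 𝓝 x, ContinuousAt F y) (hF' : ∀ᶠ y in 𝓝 x, ContinuousAt F' y)
    (hp : ∀ᶠ y in 𝓝 x, orbProj s (F y) = orbProj s (F' y))
    (hc : ∀ᶠ y in 𝓝 x, F y ∈ conePoints s → y ∈ B) :
    ∃ g ∈ orbGroup s, ∀ᶠ y in 𝓝 x, F' y = g (F y) := by
  obtain ⟨V, hV, hVU, hpre, hcl⟩ := hB x _ (hF.and (hF'.and (hp.and hc)))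
  obtain ⟨g, hg, h⟩ := exists_eqOn_of_isPreconnected (s := s) hpre
    (fun y hy => (hVU hy.1).1.continuousWithinAt) (fun y hy => (hVU hy.1).2.1.continuousWithinAt)
    (fun y hy => (hVU hy.1).2.2.1) (fun y hy hcone => hy.2 ((hVU hy.1).2.2.2 hcone))
  refine ⟨g, hg, mem_of_superset hV fun y hy => ?_⟩
  have hne : (𝓝[V \ B] y).NeBot := mem_closure_iff_nhdsWithin_neBot.1 (hcl hy)
  have h1 : Tendsto F' (𝓝[V \ B] y) (𝓝 (F' y)) := (hVU hy).2.1.continuousWithinAt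
  have h2 : Tendsto (fun y => g (F y)) (𝓝[V \ B] y) (𝓝 (g (F y))) :=
    ((continuous_affineEquiv g).continuousAt.comp (hVU hy).1).continuousWithinAt
  refine tendsto_nhds_unique_of_eventuallyEq h1 h2 ?_
  filter_upwards [self_mem_nhdsWithin] with y' hy' using h y' hy'

/-- Lifts to the plane of the same map differ by an element of the orbifold group, if the preimage
of the cone points does not separate locally. -/
theorem exists_eq_of_lifts {s : ParabolicSignature} [PreconnectedSpace X] {B : Set X}
    (hB : LocallyNonseparating B) {F F' : X → Plane} (hF : Continuous F) (hF' : Continuous F')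
    (hp : ∀ y, orbProj s (F y) = orbProj s (F' y)) (hc : ∀ y, F y ∈ conePoints s → y ∈ B) :
    ∃ g ∈ orbGroup s, ∀ y, F' y = g (F y) := by
  have h0 : ∀ x, ∃ g ∈ orbGroup s, ∀ᶠ y in 𝓝 x, F' y = g (F y) := fun x =>
    exists_eventuallyEq_of_lifts hB (.of_forall fun y => hF.continuousAt)
      (.of_forall fun y => hF'.continuousAt) (.of_forall hp) (.of_forall hc)
  choose κ hκ hκF using h0
  have hloc : IsLocallyConstant κ := by
    rw [IsLocallyConstant.iff_eventually_eq]
    intro x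
    filter_upwards [eventually_eventually_nhds.2 (hκF x)] with y hy
    obtain ⟨y', ⟨h1, h2⟩, h3⟩ := hB.exists_notMem (hy.and (hκF y))
    exact eq_of_apply_eq (hκ y) (hκ x) (fun hcone => h3 (hc _ hcone)) (h2.symm.trans h1)
  rcases isEmpty_or_nonempty X with hX | ⟨⟨x⟩⟩
  · exact ⟨1, Subgroup.one_mem _, fun y => (hX.false y).elim⟩
  · refine ⟨κ x, hκ x, fun y => ?_⟩
    rw [hloc.apply_eq_of_preconnectedSpace x y]
    exact (hκF y).self_of_nhds

end Uniqueness

theorem one_lt_rank_plane : 1 < Module.rank ℝ Plane := by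
  simp

theorem isPreconnected_ball_diff_countable (z : Plane) {r : ℝ} (hr : 0 < r) {B : Set Plane}
    (hB : B.Countable) : IsPreconnected (Metric.ball z r \ B) := by
  let e : Plane → Plane := fun x => z + r • Homeomorph.unitBall x
  have he : Continuous e := by fun_prop
  have hinj : Function.Injective e := by
    intro x y hxy
    have h1 := smul_right_injective Plane hr.ne' (add_left_cancel hxy)
    exact Homeomorph.unitBall.injective (Subtype.ext h1)
  have himg : Metric.ball z r \ B = e '' (e ⁻¹' B)ᶜ := by
    ext y
    constructor
    · rintro ⟨hy, hyB⟩
      have h1 : r⁻¹ • (y - z) ∈ Metric.ball (0 : Plane) 1 := by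
        rw [mem_ball_zero_iff, norm_smul, norm_inv, Real.norm_of_nonneg hr.le,
          inv_mul_lt_one₀ hr, ← dist_eq_norm]
        exact hy
      have h2 : e (Homeomorph.unitBall.symm ⟨_, h1⟩) = y := by
        simp [e, smul_inv_smul₀ hr.ne']
      refine ⟨_, ?_, h2⟩
      simpa [h2] using hyB
    · rintro ⟨x, hx, rfl⟩
      refine ⟨?_, hx⟩
      have h1 := (Homeomorph.unitBall x).2
      rw [mem_ball_zero_iff] at h1
      rw [Metric.mem_ball, dist_eq_norm]
      simp only [e, add_sub_cancel_left, norm_smul, Real.norm_of_nonneg hr.le]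
      nlinarith
  rw [himg]
  refine IsPreconnected.image ?_ _ he.continuousOn
  exact ((hB.preimage hinj).isConnected_compl_of_one_lt_rank
    one_lt_rank_plane).isPreconnected

theorem ball_subset_closure_diff (z : Plane) {r : ℝ} {B : Set Plane}
    (hB : B.Countable) : Metric.ball z r ⊆ closure (Metric.ball z r \ B) :=
  (hB.dense_compl ℝ).open_subset_closure_inter Metric.isOpen_ball

theorem Set.Countable.locallyNonseparating {B : Set Plane} (hB : B.Countable) :
    LocallyNonseparating B := by
  intro x U hU
  obtain ⟨r, hr, h⟩ := Metric.mem_nhds_iff.1 hU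
  exact ⟨Metric.ball x r, Metric.ball_mem_nhds x hr, h, isPreconnected_ball_diff_countable x hr hB,
    ball_subset_closure_diff x hB⟩

/-- Countably many fibres of the projection do not separate the space of times and points. -/
theorem Set.Countable.locallyNonseparating_snd {B : Set Plane} (hB : B.Countable) :
    LocallyNonseparating (Prod.snd ⁻¹' B : Set (ℝ × Plane)) := by
  intro x U hU
  obtain ⟨r, hr, h⟩ := Metric.mem_nhds_iff.1 hU
  have h1 : Metric.ball x r \ (Prod.snd ⁻¹' B : Set (ℝ × Plane))
      = Metric.ball x.1 r ×ˢ (Metric.ball x.2 r \ B) := by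
    rw [← ball_prod_same]
    ext y
    simp [and_assoc]
  refine ⟨Metric.ball x r, Metric.ball_mem_nhds x hr, h, ?_, ?_⟩
  · rw [h1]
    exact (convex_ball x.1 r).isPreconnected.prod (isPreconnected_ball_diff_countable x.2 hr hB)
  · rw [h1, closure_prod_eq, ← ball_prod_same]
    exact Set.prod_mono subset_closure (ball_subset_closure_diff x.2 hB)

/-! ### Roots and local lifts -/

section Root

open Complex

/-- A continuous function on a connected set is constant if its exponential is. -/
theorem eq_of_exp_eq {X : Type*} [TopologicalSpace X] {S : Set X} (hS : IsPreconnected S)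
    {g : X → ℂ} (hg : ContinuousOn g S) (h : ∀ x ∈ S, ∀ y ∈ S, exp (g x) = exp (g y)) {x y : X}
    (hx : x ∈ S) (hy : y ∈ S) : g x = g y := by
  have h1 : (g x - g y) / (2 * Real.pi * I) = (g y - g y) / (2 * Real.pi * I) := by
    refine hS.constant_of_mapsTo (T := Set.range ((↑) : ℤ → ℂ))
      (f := fun x => (g x - g y) / (2 * Real.pi * I)) (hT := ?_) ?_ ?_ hx hy
    · have h2 := isClosedEmbedding_intCast.isEmbedding.toHomeomorph
      exact ⟨h2.symm.isEmbedding.discreteTopology⟩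
    · exact (hg.sub continuousOn_const).div_const _
    · intro x' hx'
      obtain ⟨n, hn⟩ := exp_eq_exp_iff_exists_int.1 (h x' hx' y hy)
      refine ⟨n, ?_⟩
      simp only
      rw [hn, add_sub_cancel_left, mul_div_cancel_right₀ _ two_pi_I_ne_zero]
  rw [div_left_inj' two_pi_I_ne_zero] at h1
  exact sub_left_injective h1

/-- A family of continuous functions on a disc that vanish only at the centre and are invariant
under the rotation by `2π / n` has a continuous family of `m`-th roots, if `m` divides `n`. -/
theorem exists_continuousOn_root {n m : ℕ} (hm : 0 < m) (hn : 0 < n) (hmn : m ∣ n) {t₀ ε r : ℝ}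
    {h : ℝ × ℂ → ℂ} (hc : ContinuousOn h (Metric.ball t₀ ε ×ˢ Metric.ball 0 r))
    (h0 : ∀ t ∈ Metric.ball t₀ ε, h (t, 0) = 0)
    (hne : ∀ t ∈ Metric.ball t₀ ε, ∀ ξ ∈ Metric.ball (0 : ℂ) r, ξ ≠ 0 → h (t, ξ) ≠ 0)
    (hrot : ∀ t ∈ Metric.ball t₀ ε, ∀ ξ ∈ Metric.ball (0 : ℂ) r,
      h (t, exp (2 * Real.pi / n * I) * ξ) = h (t, ξ)) :
    ∃ E : ℝ × ℂ → ℂ, ContinuousOn E (Metric.ball t₀ ε ×ˢ Metric.ball 0 r) ∧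
      ∀ y ∈ Metric.ball t₀ ε ×ˢ Metric.ball (0 : ℂ) r, E y ^ m = h y := by
  rcases lt_or_ge 0 ε with hε | hε
  swap
  · rw [Metric.ball_eq_empty.2 hε]; exact ⟨fun _ => 0, by simp, by simp⟩
  rcases lt_or_ge 0 r with hr | hr
  swap
  · rw [Metric.ball_eq_empty.2 hr]; exact ⟨fun _ => 0, by simp, by simp⟩
  -- polar coordinates `(radius, angle, parameter)`
  let U : Set (ℝ × ℝ × ℝ) := Set.Ioo 0 r ×ˢ (Set.univ ×ˢ Metric.ball t₀ ε)
  have hUo : IsOpen U := isOpen_Ioo.prod (isOpen_univ.prod Metric.isOpen_ball)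
  have hUc : Convex ℝ U := (convex_Ioo 0 r).prod (convex_univ.prod (convex_ball t₀ ε))
  have hUne : U.Nonempty := ⟨(r / 2, 0, t₀), ⟨by linarith, by linarith⟩, trivial,
    Metric.mem_ball_self hε⟩
  have hUs : IsSimplyConnected U := by
    have := hUc.contractibleSpace hUne
    exact (inferInstance : SimplyConnectedSpace U)
  let P : ℝ × ℝ × ℝ → ℝ × ℂ := fun x => (x.2.2, x.1 * exp (x.2.1 * I))
  have hPc : Continuous P := by fun_prop
  have hnorm : ∀ a b : ℝ, ‖(a : ℂ) * exp (b * I)‖ = |a| := by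
    intro a b
    rw [norm_mul, norm_exp_ofReal_mul_I, mul_one, norm_real, Real.norm_eq_abs]
  have hPU : ∀ x ∈ U, P x ∈ Metric.ball t₀ ε ×ˢ Metric.ball (0 : ℂ) r ∧ (P x).2 ≠ 0 := by
    rintro ⟨a, b, t⟩ ⟨⟨ha, har⟩, -, ht⟩
    refine ⟨⟨ht, ?_⟩, ?_⟩
    · rw [mem_ball_zero_iff, hnorm, abs_of_pos ha]; exact har
    · rw [← norm_ne_zero_iff, hnorm, abs_of_pos ha]; exact ha.ne'
  obtain ⟨ℓ, hℓc, hℓ⟩ := exists_continuousOn_eqOn_exp_comp hUs hUo (g := h ∘ P)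
    (hc.comp hPc.continuousOn fun x hx => (hPU x hx).1) (by
      rintro ⟨x, hx, hx0⟩
      exact hne _ (hPU x hx).1.1 _ (hPU x hx).1.2 (hPU x hx).2 hx0)
  have hℓ' : ∀ x ∈ U, exp (ℓ x) = h (P x) := fun x hx => hℓ hx
  have hshiftU : ∀ (c : ℝ) x, x ∈ U → (x.1, x.2.1 + c, x.2.2) ∈ U := fun c x hx =>
    ⟨hx.1, trivial, hx.2.2⟩
  -- the logarithm changes by a constant multiple of `2πi` under the rotation by `2π / n`
  obtain ⟨N, hN⟩ : ∃ N : ℤ, ∀ x ∈ U,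
      ℓ (x.1, x.2.1 + 2 * Real.pi / n, x.2.2) = ℓ x + N * (2 * Real.pi * I) := by
    have h1 : ∀ x ∈ U, exp (ℓ (x.1, x.2.1 + 2 * Real.pi / n, x.2.2)) = exp (ℓ x) := by
      intro x hx
      rw [hℓ' _ (hshiftU _ x hx), hℓ' x hx]
      have h2 : P (x.1, x.2.1 + 2 * Real.pi / n, x.2.2)
          = ((P x).1, exp (2 * Real.pi / n * I) * (P x).2) := by
        simp only [P, Prod.mk.injEq, true_and]
        push_cast
        rw [add_mul, exp_add]; ring
      rw [h2, hrot _ (hPU x hx).1.1 _ (hPU x hx).1.2]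
    have h3 : ContinuousOn (fun x : ℝ × ℝ × ℝ =>
        ℓ (x.1, x.2.1 + 2 * Real.pi / n, x.2.2) - ℓ x) U := by
      refine (hℓc.comp ?_ (fun x hx => hshiftU _ x hx)).sub hℓc
      fun_prop
    obtain ⟨x₀, hx₀⟩ := hUne
    obtain ⟨N, hN⟩ := exp_eq_exp_iff_exists_int.1 (h1 x₀ hx₀)
    refine ⟨N, fun x hx => ?_⟩
    have h4 := eq_of_exp_eq hUc.isPreconnected h3 (fun x hx y hy => by
      rw [exp_sub, exp_sub, h1 x hx, h1 y hy, div_self (exp_ne_zero _),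
        div_self (exp_ne_zero _)]) hx hx₀
    rw [hN, add_sub_cancel_left] at h4
    rw [← h4, add_sub_cancel]
  have hNj : ∀ (j : ℕ) x, x ∈ U →
      ℓ (x.1, x.2.1 + j * (2 * Real.pi / n), x.2.2) = ℓ x + j * (N * (2 * Real.pi * I)) := by
    intro j x hx
    induction j with
    | zero => simp
    | succ j ih =>
      have h1 := hN _ (hshiftU (j * (2 * Real.pi / n)) x hx)
      have h2 : x.2.1 + ((j + 1 : ℕ) : ℝ) * (2 * Real.pi / n)
        = x.2.1 + j * (2 * Real.pi / n) + 2 * Real.pi / n := by push_cast; ring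
      rw [h2]
      simp only at h1
      rw [h1, ih]
      push_cast; ring
  let E₀ : ℝ × ℝ × ℝ → ℂ := fun x => exp (ℓ x / m)
  have hE₀c : ContinuousOn E₀ U := (hℓc.div_const _).cexp
  have hm0 : (m : ℂ) ≠ 0 := by exact_mod_cast hm.ne'
  have hE₀ : ∀ x ∈ U, E₀ x ^ m = h (P x) := by
    intro x hx
    rw [← hℓ' x hx, ← exp_nat_mul, mul_div_cancel₀ _ hm0]
  have hper : ∀ x ∈ U, E₀ (x.1, x.2.1 + 2 * Real.pi, x.2.2) = E₀ x := by
    intro x hx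
    obtain ⟨k, rfl⟩ := hmn
    have h1 := hNj (m * k) x hx
    have hn0 : ((m * k : ℕ) : ℝ) ≠ 0 := by exact_mod_cast hn.ne'
    rw [mul_div_cancel₀ _ hn0] at h1
    simp only [E₀]
    rw [h1, exp_eq_exp_iff_exists_int]
    refine ⟨k * N, ?_⟩
    push_cast
    field_simp
  have hperZ : ∀ (j : ℤ) x, x ∈ U → E₀ (x.1, x.2.1 + j * (2 * Real.pi), x.2.2) = E₀ x := by
    intro j x hx
    induction j with
    | zero => simp
    | succ j ih =>
      have h1 := hper _ (hshiftU ((j : ℤ) * (2 * Real.pi)) x hx)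
      simp only at h1
      rw [← ih, ← h1]
      congr 3
      push_cast; ring
    | pred j ih =>
      have h1 := hper _ (hshiftU (((-(j : ℤ) - 1 : ℤ) : ℝ) * (2 * Real.pi)) x hx)
      simp only at h1
      rw [← ih, ← h1]
      congr 3
      push_cast; ring
  let E : ℝ × ℂ → ℂ := fun y => if y.2 = 0 then 0 else E₀ (‖y.2‖, arg y.2, y.1)
  have hEU : ∀ y ∈ Metric.ball t₀ ε ×ˢ Metric.ball (0 : ℂ) r, y.2 ≠ 0 → ∀ θ,
      (‖y.2‖, θ, y.1) ∈ U := fun y hy hy0 θ =>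
    ⟨⟨norm_pos_iff.2 hy0, mem_ball_zero_iff.1 hy.2⟩, trivial, hy.1⟩
  have hEpow : ∀ y ∈ Metric.ball t₀ ε ×ˢ Metric.ball (0 : ℂ) r, E y ^ m = h y := by
    intro y hy
    by_cases hy0 : y.2 = 0
    · have h1 : y = (y.1, 0) := Prod.ext rfl hy0
      simp only [E, hy0, if_true]
      rw [h1, h0 _ hy.1, zero_pow hm.ne']
    · simp only [E, hy0, if_false]
      rw [hE₀ _ (hEU y hy hy0 _)]
      simp only [P]
      rw [norm_mul_exp_arg_mul_I]
  refine ⟨E, ?_, hEpow⟩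
  have hopen : IsOpen (Metric.ball t₀ ε ×ˢ Metric.ball (0 : ℂ) r) :=
    Metric.isOpen_ball.prod Metric.isOpen_ball
  intro y hy
  refine ContinuousAt.continuousWithinAt ?_
  by_cases hy0 : y.2 = 0
  · -- at the centre the root is small because its power is
    have hEy : E y = 0 := by simp [E, hy0]
    have hhy : h y = 0 := by rw [← hEpow y hy, hEy, zero_pow hm.ne']
    rw [ContinuousAt, hEy, Metric.tendsto_nhds]
    intro η hη
    have h1 : Tendsto h (𝓝 y) (𝓝 0) := by
      have := hc.continuousAt (hopen.mem_nhds hy)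
      rwa [ContinuousAt, hhy] at this
    filter_upwards [Metric.tendsto_nhds.1 h1 (η ^ m) (pow_pos hη m), hopen.mem_nhds hy] with x hx hxU
    rw [dist_zero_right] at hx ⊢
    rw [← hEpow x hxU, norm_pow] at hx
    exact lt_of_pow_lt_pow_left₀ m hη.le hx
  · -- away from the centre, replace the angle by a locally continuous branch
    have h1 : ContinuousAt (fun x : ℝ × ℂ => E₀ (‖x.2‖, arg (x.2 / y.2) + arg y.2, x.1)) y := by
      have h2 : ContinuousAt E₀ (‖y.2‖, arg (y.2 / y.2) + arg y.2, y.1) :=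
        hE₀c.continuousAt (hUo.mem_nhds (hEU y hy hy0 _))
      refine ContinuousAt.comp (f := fun x : ℝ × ℂ => (‖x.2‖, arg (x.2 / y.2) + arg y.2, x.1)) h2 ?_
      have h3 : ContinuousAt (fun x : ℝ × ℂ => arg (x.2 / y.2)) y := by
        refine ContinuousAt.comp (g := arg) (f := fun x : ℝ × ℂ => x.2 / y.2) ?_ ?_
        · rw [div_self hy0]; exact continuousAt_arg (by simp)
        · fun_prop
      fun_prop
    refine h1.congr ?_
    have h4 : ∀ᶠ x : ℝ × ℂ in 𝓝 y, x.2 ≠ 0 := continuousAt_snd.eventually_ne hy0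
    filter_upwards [h4, hopen.mem_nhds hy] with x hx0 hxU
    simp only [E, hx0, if_false]
    have h5 : exp ((arg (x.2 / y.2) + arg y.2 : ℝ) * I) = exp ((arg x.2 : ℝ) * I) := by
      have e1 := norm_mul_exp_arg_mul_I (x.2 / y.2)
      have e2 := norm_mul_exp_arg_mul_I y.2
      have e3 := norm_mul_exp_arg_mul_I x.2
      have n1 : (‖y.2‖ : ℂ) ≠ 0 := by exact_mod_cast norm_ne_zero_iff.2 hy0
      have n2 : (‖x.2‖ : ℂ) ≠ 0 := by exact_mod_cast norm_ne_zero_iff.2 hx0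
      push_cast
      rw [add_mul, exp_add]
      apply mul_left_cancel₀ n2
      rw [e3]
      calc (‖x.2‖ : ℂ) * (exp (arg (x.2 / y.2) * I) * exp (arg y.2 * I))
          = ((‖x.2 / y.2‖ : ℝ) * exp (arg (x.2 / y.2) * I)) * ((‖y.2‖ : ℝ) * exp (arg y.2 * I)) := by
            rw [norm_div]; push_cast; field_simp
        _ = x.2 := by rw [e1, e2, div_mul_cancel₀ _ hy0]
    obtain ⟨j, hj⟩ := exp_eq_exp_iff_exists_int.1 h5
    have h6 : arg (x.2 / y.2) + arg y.2 = arg x.2 + j * (2 * Real.pi) := by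
      have : ((arg (x.2 / y.2) + arg y.2 : ℝ) : ℂ) = ((arg x.2 + j * (2 * Real.pi) : ℝ) : ℂ) := by
        apply mul_right_cancel₀ I_ne_zero
        rw [hj]; push_cast; ring
      exact_mod_cast this
    rw [h6]
    exact hperZ j _ (hEU x hxU hx0 _)

end Root

/-- Around a point `w₀` of order `m`, the function `(w - w₀) ^ m` of the complex coordinate is a
chart of the orbifold. -/
theorem exists_orbifold_chart (s : ParabolicSignature) (w₀ : Plane) :
    ∃ (V : Set (Orb s)) (q : Orb s → ℂ), V ∈ 𝓝 (orbProj s w₀) ∧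
      (∀ x ∈ V, ContinuousAt q x) ∧ q (orbProj s w₀) = 0 ∧
      ∀ x ∈ V, ∀ w, (coord s w - coord s w₀) ^ order s w₀ = q x → orbProj s w = x := by
  classical
  obtain ⟨δ, hδ, hd⟩ := exists_discrete_radius s w₀
  let W : Set Plane := {w | ‖coord s w - coord s w₀‖ < δ}
  have hW : IsOpen W := isOpen_lt (by fun_prop) continuous_const
  have hw₀ : w₀ ∈ W := by simpa [W] using hδ
  let q : Orb s → ℂ := fun x => if hx : ∃ w ∈ W, orbProj s w = x then
    (coord s hx.choose - coord s w₀) ^ order s w₀ else 0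
  have hq : ∀ w ∈ W, q (orbProj s w) = (coord s w - coord s w₀) ^ order s w₀ := by
    intro w hw
    have hx : ∃ w' ∈ W, orbProj s w' = orbProj s w := ⟨w, hw, rfl⟩
    simp only [q, dif_pos hx]
    obtain ⟨h1, h2⟩ := hx.choose_spec
    obtain ⟨g, hg, hgw⟩ := orbProj_eq_iff.1 h2
    have h3 : g w₀ = w₀ := hd g hg _ _ h1 hw hgw
    have h4 := coord_sub_coord hg hx.choose w₀
    rw [hgw, h3] at h4
    rw [h4, mul_pow, multiplier_pow_order ⟨hg, h3⟩, one_mul]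
  refine ⟨orbProj s '' W, q, (isOpenMap_orbProj s _ hW).mem_nhds ⟨w₀, hw₀, rfl⟩, ?_, ?_, ?_⟩
  · rintro _ ⟨w, hw, rfl⟩
    rw [ContinuousAt, ← map_nhds_orbProj, tendsto_map'_iff, hq w hw]
    have h1 : Continuous fun w => (coord s w - coord s w₀) ^ order s w₀ := by fun_prop
    refine (h1.tendsto w).congr' ?_
    filter_upwards [hW.mem_nhds hw] with w' hw' using (hq w' hw').symm
  · rw [hq w₀ hw₀, sub_self, zero_pow (order_pos s w₀).ne']
  · rintro _ ⟨w, hw, rfl⟩ w' h1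
    rw [hq w hw] at h1
    by_cases h2 : coord s w - coord s w₀ = 0
    · rw [h2, zero_pow (order_pos s w₀).ne', pow_eq_zero_iff (order_pos s w₀).ne'] at h1
      rw [(coord s).injective (sub_eq_zero.1 h1), (coord s).injective (sub_eq_zero.1 h2)]
    · have h3 : ((coord s w' - coord s w₀) / (coord s w - coord s w₀)) ^ order s w₀ = 1 := by
        rw [div_pow, h1, div_self (pow_ne_zero _ h2)]
      obtain ⟨g, hg, hgu⟩ := exists_stab_multiplier s w₀ h3
      have h4 := coord_sub_coord hg.1 w w₀
      rw [hg.2, hgu, div_mul_cancel₀ _ h2] at h4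
      have h5 : g w = w' := (coord s).injective (sub_left_injective h4)
      rw [← h5, orbProj_apply hg.1]

/-- A continuous map to the orbifold lifts to the plane locally, where its value is not a cone
point. -/
theorem exists_local_lift_of_notMem_conePoints {X : Type*} [TopologicalSpace X]
    {s : ParabolicSignature} {f : X → Orb s} (hf : Continuous f) {x₀ : X} {w₀ : Plane}
    (hw₀ : w₀ ∉ conePoints s) (hfx : f x₀ = orbProj s w₀) :
    ∃ F : X → Plane, ∀ᶠ x in 𝓝 x₀, ContinuousAt F x ∧ orbProj s (F x) = f x := by
  obtain ⟨V, q, hV, hqc, -, hq⟩ := exists_orbifold_chart s w₀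
  rw [order_eq_one_iff.2 hw₀] at hq
  refine ⟨fun x => (coord s).symm (coord s w₀ + q (f x)), ?_⟩
  have h1 : ∀ᶠ x in 𝓝 x₀, f x ∈ V := by
    rw [← hfx] at hV
    exact hf.continuousAt hV
  filter_upwards [h1] with x hx
  constructor
  · have h2 : ContinuousAt (fun x => q (f x)) x :=
      ContinuousAt.comp (g := q) (hqc _ hx) hf.continuousAt
    exact (coord s).symm.continuous.continuousAt.comp (continuousAt_const.add h2)
  · exact hq _ hx _ (by simp)

/-- A continuous family of maps of the orbifold that fixes the value `π w₀` at `π z₀`, takes it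
nowhere else, and for which the order of `w₀` divides that of `z₀`, lifts to the plane near `z₀`. -/
theorem exists_local_lift_of_order_dvd {s : ParabolicSignature} {H : ℝ × Orb s → Orb s}
    (hH : Continuous H) {t₀ : ℝ} {z₀ w₀ : Plane} (hw : ∀ t, H (t, orbProj s z₀) = orbProj s w₀)
    (hinj : ∀ t x, H (t, x) = orbProj s w₀ → x = orbProj s z₀) (hord : order s w₀ ∣ order s z₀) :
    ∃ F : ℝ × Plane → Plane, ∀ᶠ y in 𝓝 (t₀, z₀),
      ContinuousAt F y ∧ orbProj s (F y) = H (y.1, orbProj s y.2) := by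
  obtain ⟨V, q, hV, hqc, hq0, hq⟩ := exists_orbifold_chart s w₀
  obtain ⟨δ, hδ, hd⟩ := exists_discrete_radius s z₀
  let f : ℝ × ℂ → Orb s := fun y => H (y.1, orbProj s ((coord s).symm (coord s z₀ + y.2)))
  have hfc : Continuous f := by
    have h1 := (continuous_orbProj s).comp
      (g := orbProj s) (f := fun y : ℝ × ℂ => (coord s).symm (coord s z₀ + y.2)) (by fun_prop)
    exact hH.comp (continuous_fst.prodMk h1)
  have hf0 : ∀ t, f (t, 0) = orbProj s w₀ := fun t => by simp [f, hw]
  have h1 : f ⁻¹' V ∈ 𝓝 (t₀, (0 : ℂ)) := by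
    refine hfc.continuousAt ?_
    rw [hf0]; exact hV
  obtain ⟨ε, hε, h2⟩ := Metric.mem_nhds_iff.1 h1
  let r := min ε δ
  have hr : 0 < r := lt_min hε hδ
  have hV' : ∀ y ∈ Metric.ball t₀ ε ×ˢ Metric.ball (0 : ℂ) r, f y ∈ V := by
    intro y hy
    apply h2
    rw [← ball_prod_same]
    exact ⟨hy.1, Metric.ball_subset_ball (min_le_left _ _) hy.2⟩
  obtain ⟨E, hEc, hE⟩ := exists_continuousOn_root (order_pos s w₀) (order_pos s z₀) hord
    (t₀ := t₀) (ε := ε) (r := r) (h := fun y => q (f y))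
    (fun y hy => (ContinuousAt.comp (g := q) (hqc _ (hV' y hy))
      hfc.continuousAt).continuousWithinAt)
    (fun t _ => by rw [hf0, hq0])
    (by
      intro t ht ξ hξ hξ0 h3
      have h4 := hq _ (hV' (t, ξ) ⟨ht, hξ⟩) w₀ (by
        rw [h3, sub_self, zero_pow (order_pos s w₀).ne'])
      obtain ⟨g, hg, hgz⟩ := orbProj_eq_iff.1 (hinj _ _ h4.symm)
      have h5 : g z₀ = z₀ := hd g hg _ _ (by
        simpa using (mem_ball_zero_iff.1 hξ).trans_le (min_le_right _ _)) (by simpa using hδ) hgz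
      have h6 := g.injective (hgz.trans h5.symm)
      have h7 := congrArg (coord s) h6
      simp only [ContinuousLinearEquiv.apply_symm_apply, add_eq_left] at h7
      exact hξ0 h7)
    (by
      intro t ht ξ hξ
      have h3 : Complex.exp (2 * Real.pi / order s z₀ * Complex.I) ^ order s z₀ = 1 := by
        rw [← Complex.exp_nat_mul, Complex.exp_eq_one_iff]
        have : (order s z₀ : ℂ) ≠ 0 := by exact_mod_cast (order_pos s z₀).ne'
        refine ⟨1, ?_⟩
        field_simp
        simp
      obtain ⟨g, hg, hgu⟩ := exists_stab_multiplier s z₀ h3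
      have h4 : (coord s).symm (coord s z₀
            + Complex.exp (2 * Real.pi / order s z₀ * Complex.I) * ξ)
          = g ((coord s).symm (coord s z₀ + ξ)) := by
        have h5 := coord_sub_coord hg.1 ((coord s).symm (coord s z₀ + ξ)) z₀
        rw [hg.2, hgu, (coord s).apply_symm_apply, add_sub_cancel_left] at h5
        apply (coord s).injective
        rw [(coord s).apply_symm_apply, ← h5]; ring
      simp only [f]
      rw [h4, orbProj_apply hg.1])
  have hE' : ∀ y ∈ Metric.ball t₀ ε ×ˢ Metric.ball (0 : ℂ) r, ContinuousAt E y := fun y hy =>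
    hEc.continuousAt ((Metric.isOpen_ball.prod Metric.isOpen_ball).mem_nhds hy)
  let p : ℝ × Plane → ℝ × ℂ := fun y => (y.1, coord s y.2 - coord s z₀)
  have hp : Continuous p := by fun_prop
  have h3 : ∀ᶠ y in 𝓝 (t₀, z₀), p y ∈ Metric.ball t₀ ε ×ˢ Metric.ball (0 : ℂ) r := by
    refine hp.continuousAt ((Metric.isOpen_ball.prod Metric.isOpen_ball).mem_nhds ?_)
    exact ⟨Metric.mem_ball_self hε, by simpa [p] using hr⟩
  refine ⟨fun y => (coord s).symm (coord s w₀ + E (p y)), ?_⟩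
  filter_upwards [h3] with y hy
  constructor
  · have h4 : ContinuousAt (fun y => E (p y)) y :=
      ContinuousAt.comp (g := E) (hE' _ hy) hp.continuousAt
    exact (coord s).symm.continuous.continuousAt.comp (continuousAt_const.add h4)
  · have h4 := hq _ (hV' _ hy) ((coord s).symm (coord s w₀ + E (p y))) (by
      rw [(coord s).apply_symm_apply, add_sub_cancel_left, hE _ hy])
    rw [h4]
    simp [f, p]

/-! ### Global lifts -/

/-- A continuous map from a simply connected space to the orbifold that lifts to the plane locally
lifts globally. The local lifts differ by locally constant elements of the orbifold group, so that
they define a covering space with this group as fibre, and a section of it corrects them to a global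
lift. -/
theorem exists_lift_of_local_lifts {X : Type*} [TopologicalSpace X] [SimplyConnectedSpace X]
    [LocallyPathConnectedSpace X] {s : ParabolicSignature} {f : X → Orb s} {B : Set X}
    (hB : LocallyNonseparating B) (hc : ∀ x w, f x = orbProj s w → w ∈ conePoints s → x ∈ B)
    (hloc : ∀ x, ∃ F : X → Plane, ∀ᶠ y in 𝓝 x, ContinuousAt F y ∧ orbProj s (F y) = f y) :
    ∃ F : X → Plane, Continuous F ∧ ∀ x, orbProj s (F x) = f x := by
  classical
  choose F hF using hloc
  choose U hUF hUo hxU using fun x => eventually_nhds_iff.1 (hF x)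
  have hex : ∀ i j x, ∃ g : orbGroup s, x ∈ U i ∩ U j → ∀ᶠ y in 𝓝 x, F i y = g.1 (F j y) := by
    intro i j x
    by_cases hx : x ∈ U i ∩ U j
    · have hi : ∀ᶠ y in 𝓝 x, y ∈ U i := (hUo i).mem_nhds hx.1
      have hj : ∀ᶠ y in 𝓝 x, y ∈ U j := (hUo j).mem_nhds hx.2
      obtain ⟨g, hg, h⟩ := exists_eventuallyEq_of_lifts (s := s) (F := F j) (F' := F i) hB
        (hj.mono fun y hy => (hUF j y hy).1) (hi.mono fun y hy => (hUF i y hy).1)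
        (by filter_upwards [hi, hj] with y h1 h2
            rw [(hUF i y h1).2, (hUF j y h2).2])
        (by filter_upwards [hj] with y h2 using hc y _ (hUF j y h2).2.symm)
      exact ⟨⟨g, hg⟩, fun _ => h⟩
    · exact ⟨1, fun h => absurd h hx⟩
  choose c hcF using hex
  have huniq : ∀ (g h : orbGroup s) j x, x ∈ U j →
      (∀ᶠ y in 𝓝 x, g.1 (F j y) = h.1 (F j y)) → g = h := by
    intro g h j x hx he
    have hj : ∀ᶠ y in 𝓝 x, y ∈ U j := (hUo j).mem_nhds hx
    obtain ⟨y, ⟨h1, h2⟩, h3⟩ := hB.exists_notMem (he.and hj)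
    exact Subtype.ext (eq_of_apply_eq g.2 h.2
      (fun hcone => h3 (hc y _ (hUF j y h2).2.symm hcone)) h1)
  have hself : ∀ i x, x ∈ U i → c i i x = 1 := by
    intro i x hx
    refine huniq _ _ i x hx ?_
    filter_upwards [hcF i i x ⟨hx, hx⟩] with y hy using hy.symm
  have hcomp : ∀ i j k x, x ∈ U i → x ∈ U j → x ∈ U k → c i j x * c j k x = c i k x := by
    intro i j k x hi hj hk
    refine huniq _ _ k x hk ?_
    filter_upwards [hcF i j x ⟨hi, hj⟩, hcF j k x ⟨hj, hk⟩, hcF i k x ⟨hi, hk⟩] with y h1 h2 h3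
    change (c i j x).1 ((c j k x).1 (F k y)) = (c i k x).1 (F k y)
    rw [← h2, ← h1, h3]
  have hlc : ∀ i j x, x ∈ U i ∩ U j → ∀ᶠ y in 𝓝 x, c i j y = c i j x := by
    intro i j x hx
    filter_upwards [eventually_eventually_nhds.2 (hcF i j x hx),
      ((hUo i).inter (hUo j)).mem_nhds hx] with y hy hyU
    refine huniq _ _ j y hyU.2 ?_
    filter_upwards [hy, hcF i j y hyU] with y' h1 h2
    rw [← h1, ← h2]
  let _ : TopologicalSpace (orbGroup s) := ⊥
  have : DiscreteTopology (orbGroup s) := ⟨rfl⟩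
  let Z : FiberBundleCore X X (orbGroup s) :=
    { baseSet := U
      isOpen_baseSet := hUo
      indexAt := id
      mem_baseSet_at := hxU
      coordChange := fun i j x g => c j i x * g
      coordChange_self := fun i x hx g => by rw [hself i x hx, one_mul]
      continuousOn_coordChange := by
        rintro i j ⟨x, g⟩ ⟨hx, -⟩
        have h1 : ∀ᶠ p : X × orbGroup s in 𝓝 (x, g), c j i p.1 * p.2 = c j i x * p.2 := by
          filter_upwards [continuousAt_fst.eventually (hlc j i x ⟨hx.2, hx.1⟩)] with p hp
          rw [hp]
        have h2 : ContinuousAt (fun p : X × orbGroup s => c j i x * p.2) (x, g) :=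
          (continuous_of_discreteTopology (f := fun g => c j i x * g)).continuousAt.comp
            continuousAt_snd
        exact (h2.congr (h1.mono fun p hp => hp.symm)).continuousWithinAt
      coordChange_comp := by
        rintro i j k x ⟨⟨hi, hj⟩, hk⟩ g
        rw [← mul_assoc, hcomp k j i x hk hj hi] }
  have hcov : IsCoveringMap (Bundle.TotalSpace.proj : Z.TotalSpace → X) :=
    FiberBundle.isCoveringMap
  obtain ⟨x₀⟩ : Nonempty X := inferInstance
  obtain ⟨S, ⟨-, hS⟩, -⟩ := hcov.existsUnique_continuousMap_lifts (ContinuousMap.id X) x₀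
    (⟨x₀, (1 : orbGroup s)⟩ : Z.TotalSpace) rfl
  have hSx : ∀ x, (S x).1 = x := fun x => congrFun hS x
  let σ : X → orbGroup s := fun x => (S x).2
  let γ : X → X → orbGroup s := fun i x => c i x x * σ x
  have hγ : ∀ i x, x ∈ U i → ∀ᶠ y in 𝓝 x, γ i y = γ i x := by
    intro i x hx
    have h1 : ∀ y, (Z.localTriv i (S y)).2 = γ i y := by
      intro y
      have h2 : (Z.localTriv i (S y)).2 = c i (S y).1 (S y).1 * σ y := rfl
      rw [h2, hSx]
    have h3 : ContinuousAt (Z.localTriv i) (S x) := by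
      refine (Z.localTriv i).continuousOn.continuousAt ((Z.localTriv i).open_source.mem_nhds ?_)
      change (S x).1 ∈ U i
      rwa [hSx]
    have h4 : ContinuousAt (fun y => (Z.localTriv i (S y)).2) x :=
      (ContinuousAt.comp (g := Z.localTriv i) h3 S.continuous.continuousAt).snd
    simp only [h1] at h4
    rw [ContinuousAt, nhds_discrete (orbGroup s), tendsto_pure] at h4
    exact h4
  refine ⟨fun x => (σ x)⁻¹.1 (F x x), ?_, fun x => ?_⟩
  · rw [continuous_iff_continuousAt]
    intro x
    have h1 : ContinuousAt (fun y => (γ x x)⁻¹.1 (F x y)) x :=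
      (continuous_affineEquiv _).continuousAt.comp (hUF x x (hxU x)).1
    refine h1.congr ?_
    filter_upwards [hγ x x (hxU x), (hUo x).mem_nhds (hxU x)] with y hy hyU
    have h2 : F x y = (c x y y).1 (F y y) := (hcF x y y ⟨hyU, hxU y⟩).self_of_nhds
    rw [← hy, h2]
    change (γ x y)⁻¹.1 ((c x y y).1 (F y y)) = (σ y)⁻¹.1 (F y y)
    have h3 : (γ x y)⁻¹ * c x y y = (σ y)⁻¹ := by
      simp [γ]
    rw [← h3]
    rfl
  · rw [orbProj_apply (σ x)⁻¹.2, (hUF x x (hxU x)).2]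

/-- A family of injective maps of the orbifold that preserve the order of points and move no cone
point lifts to the plane. -/
theorem exists_lift_isotopy {s : ParabolicSignature} {H : ℝ × Orb s → Orb s} (hH : Continuous H)
    (hinj : ∀ t, Function.Injective fun x => H (t, x))
    (hord : ∀ t x, orbOrder s (H (t, x)) = orbOrder s x)
    (hfix : ∀ t t' z, z ∈ conePoints s → H (t, orbProj s z) = H (t', orbProj s z)) :
    ∃ F : ℝ × Plane → Plane, Continuous F ∧
      ∀ y, orbProj s (F y) = H (y.1, orbProj s y.2) := by
  have hf : Continuous fun y : ℝ × Plane => H (y.1, orbProj s y.2) :=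
    hH.comp (continuous_fst.prodMk ((continuous_orbProj s).comp continuous_snd))
  have horder : ∀ (y : ℝ × Plane) w, H (y.1, orbProj s y.2) = orbProj s w →
      order s w = order s y.2 := by
    intro y w h
    rw [← orbOrder_orbProj, ← h, hord, orbOrder_orbProj]
  have hcone : ∀ (y : ℝ × Plane) w, H (y.1, orbProj s y.2) = orbProj s w →
      (w ∈ conePoints s ↔ y.2 ∈ conePoints s) := by
    intro y w h
    rw [← not_iff_not, ← order_eq_one_iff, ← order_eq_one_iff, horder y w h]
  refine exists_lift_of_local_lifts (countable_conePoints s).locallyNonseparating_snd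
    (fun y w h => (hcone y w h).1) ?_
  rintro ⟨t₀, z₀⟩
  obtain ⟨w₀, hw₀⟩ := orbProj_surjective s (H (t₀, orbProj s z₀))
  by_cases hz : z₀ ∈ conePoints s
  · have hw : ∀ t, H (t, orbProj s z₀) = orbProj s w₀ := fun t =>
      (hfix t t₀ z₀ hz).trans hw₀.symm
    refine exists_local_lift_of_order_dvd hH hw (fun t x hx => ?_)
      (horder (t₀, z₀) w₀ hw₀.symm).dvd
    exact hinj t (hx.trans (hw t).symm)
  · exact exists_local_lift_of_notMem_conePoints hf (x₀ := (t₀, z₀)) (w₀ := w₀)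
      (fun h => hz ((hcone (t₀, z₀) w₀ hw₀.symm).1 h)) hw₀.symm

/-! ### Counting preimages: the transfer formula -/

/-- A surjection of the plane that turns the action of each element of the orbifold group into that
of some element induces an endomorphism of the group. -/
theorem exists_intertwined_hom {s : ParabolicSignature} {F : Plane → Plane}
    (hF : Function.Surjective F)
    (h : ∀ g ∈ orbGroup s, ∃ g' ∈ orbGroup s, ∀ z, F (g z) = g' (F z)) :
    ∃ α : orbGroup s →* orbGroup s, ∀ g z, F (g.1 z) = (α g).1 (F z) := by
  choose a ha haF using h
  have huniq : ∀ g h : orbGroup s, (∀ z, g.1 (F z) = h.1 (F z)) → g = h := by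
    intro g h hgh
    ext z
    obtain ⟨y, rfl⟩ := hF z
    rw [hgh]
  refine ⟨MonoidHom.mk' (fun g => ⟨a g.1 g.2, ha _ _⟩) fun g h => huniq _ _ fun z => ?_,
    fun g z => haF _ _ _⟩
  change a _ _ (F z) = a _ _ (a _ _ (F z))
  rw [← haF, ← haF, ← haF]
  rfl

theorem injective_of_intertwined {s : ParabolicSignature} {F : Plane → Plane}
    (hF : Function.Injective F) {α : orbGroup s →* orbGroup s}
    (hα : ∀ g z, F (g.1 z) = (α g).1 (F z)) : Function.Injective α := by
  intro g h hgh
  ext z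
  have : F (g.1 z) = F (h.1 z) := by rw [hα, hα, hgh]
  rw [hF this]

section Counting

variable {s : ParabolicSignature} {l : Orb s → Orb s} {L : Plane ≃ᵃ[ℝ] Plane}
  {α : orbGroup s →* orbGroup s}

/-- An affine map that descends to the orbifold induces an endomorphism of the orbifold group. -/
theorem exists_hom_of_isQuotientOf (hL : IsQuotientOf l L) :
    ∃ α : orbGroup s →* orbGroup s, ∀ g z, L (g.1 z) = (α g).1 (L z) := by
  refine exists_intertwined_hom L.surjective fun g hg => ?_
  obtain ⟨g', hg', h⟩ := exists_eq_of_lifts (s := s) (B := L ⁻¹' conePoints s)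
    ((countable_conePoints s).preimage L.injective).locallyNonseparating
    (continuous_affineEquiv L) ((continuous_affineEquiv L).comp (continuous_affineEquiv g))
    (fun y => by
      change _ = orbProj s (L (g y))
      rw [← hL, ← hL, orbProj_apply hg]) (fun y hy => hy)
  exact ⟨g', hg', h⟩

/-- The parametrization of the fibre of `l` over `π w` by the cosets of the image of `α`: the coset
of `g` is sent to `π (L⁻¹ (g⁻¹ w))`. -/
noncomputable def fibrePoint (hα : ∀ g z, L (g.1 z) = (α g).1 (L z)) (w : Plane) :
    orbGroup s ⧸ α.range → Orb s :=
  Quotient.lift (fun g => orbProj s (L.symm (g⁻¹.1 w))) (by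
    intro g h hgh
    obtain ⟨k, hk⟩ := QuotientGroup.leftRel_apply.1 hgh
    have h1 : h⁻¹.1 w = (α k⁻¹).1 (g⁻¹.1 w) := by
      have : h⁻¹ = α k⁻¹ * g⁻¹ := by rw [map_inv, hk]; group
      rw [this]; rfl
    have h2 : L.symm (h⁻¹.1 w) = k⁻¹.1 (L.symm (g⁻¹.1 w)) := by
      apply L.injective
      rw [hα, L.apply_symm_apply, L.apply_symm_apply, h1]
    change orbProj s (L.symm (g⁻¹.1 w)) = orbProj s (L.symm (h⁻¹.1 w))
    rw [h2, orbProj_apply k⁻¹.2])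

theorem fibrePoint_mk (hα : ∀ g z, L (g.1 z) = (α g).1 (L z)) (w : Plane) (g : orbGroup s) :
    fibrePoint hα w (g : orbGroup s ⧸ α.range) = orbProj s (L.symm (g⁻¹.1 w)) := rfl

theorem range_fibrePoint (hL : IsQuotientOf l L) (hα : ∀ g z, L (g.1 z) = (α g).1 (L z))
    (w : Plane) : Set.range (fibrePoint hα w) = l ⁻¹' {orbProj s w} := by
  ext x
  constructor
  · rintro ⟨q, rfl⟩
    obtain ⟨g, rfl⟩ := QuotientGroup.mk_surjective q
    rw [fibrePoint_mk, Set.mem_preimage, hL, L.apply_symm_apply, orbProj_apply g⁻¹.2]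
    rfl
  · intro hx
    obtain ⟨z, rfl⟩ := orbProj_surjective s x
    rw [Set.mem_preimage, hL] at hx
    obtain ⟨g, hg, h⟩ := orbProj_eq_iff.1 hx
    refine ⟨((⟨g, hg⟩ : orbGroup s) : orbGroup s ⧸ α.range), ?_⟩
    rw [fibrePoint_mk, ← h]
    change orbProj s (L.symm (g.symm (g (L z)))) = _
    rw [g.symm_apply_apply, L.symm_apply_apply]

/-- Orbit counting for the stabilizer of `w` acting on the cosets: the cosets that parametrize a
given point of the fibre form an orbit. -/
theorem ncard_fibrePoint_mul_order (hα : ∀ g z, L (g.1 z) = (α g).1 (L z)) (w : Plane)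
    (q : orbGroup s ⧸ α.range) :
    {q' | fibrePoint hα w q' = fibrePoint hα w q}.ncard * orbOrder s (fibrePoint hα w q)
      = order s w := by
  obtain ⟨g, rfl⟩ := QuotientGroup.mk_surjective q
  let K : Subgroup (orbGroup s) := (stab s w).subgroupOf (orbGroup s)
  have hK : Nat.card K = order s w :=
    Nat.card_congr (Subgroup.subgroupOfEquivOfLe
      (show stab s w ≤ orbGroup s from fun g hg => hg.1)).toEquiv
  have hKw : ∀ k : K, k.1.1 w = w := fun k => k.2.2
  have hKinv : ∀ k : K, k.1⁻¹.1 w = w := fun k => (k⁻¹).2.2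
  have hinj := injective_of_intertwined (F := L) L.injective hα
  have horb : {q' | fibrePoint hα w q' = fibrePoint hα w (g : orbGroup s ⧸ α.range)}
      = MulAction.orbit K (g : orbGroup s ⧸ α.range) := by
    ext q'
    obtain ⟨h, rfl⟩ := QuotientGroup.mk_surjective q'
    constructor
    · intro hq
      have hq' : orbProj s (L.symm (h⁻¹.1 w)) = orbProj s (L.symm (g⁻¹.1 w)) := hq
      obtain ⟨k, hk, hkz⟩ := orbProj_eq_iff.1 hq'
      have h1 : (α ⟨k, hk⟩).1 (h⁻¹.1 w) = g⁻¹.1 w := by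
        have := hα ⟨k, hk⟩ (L.symm (h⁻¹.1 w))
        rwa [L.apply_symm_apply, hkz, L.apply_symm_apply, eq_comm] at this
      let κ : orbGroup s := h * (α ⟨k, hk⟩)⁻¹ * g⁻¹
      have hκ : κ.1 w = w := by
        change h.1 ((α ⟨k, hk⟩).1.symm (g⁻¹.1 w)) = w
        rw [← h1, AffineEquiv.symm_apply_apply]
        exact h.1.apply_symm_apply w
      refine ⟨⟨κ, κ.2, hκ⟩, ?_⟩
      change ((κ * g : orbGroup s) : orbGroup s ⧸ α.range) = h
      rw [QuotientGroup.eq]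
      refine ⟨⟨k, hk⟩, ?_⟩
      simp only [κ]; group
    · rintro ⟨k, hk⟩
      rw [← hk]
      change orbProj s (L.symm ((k.1 * g)⁻¹.1 w)) = orbProj s (L.symm (g⁻¹.1 w))
      rw [mul_inv_rev]
      change orbProj s (L.symm (g⁻¹.1 (k.1⁻¹.1 w))) = _
      rw [hKinv]
  have hstab : Nat.card (MulAction.stabilizer K (g : orbGroup s ⧸ α.range))
      = orbOrder s (fibrePoint hα w (g : orbGroup s ⧸ α.range)) := by
    rw [fibrePoint_mk, orbOrder_orbProj, order]
    symm
    let z := L.symm (g⁻¹.1 w)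
    have hz : L z = g⁻¹.1 w := L.apply_symm_apply _
    have hgz : g.1 (L z) = w := by rw [hz]; exact g.1.apply_symm_apply w
    have hmem : ∀ j : stab s z, (g * α ⟨j.1, j.2.1⟩ * g⁻¹).1 w = w := by
      intro j
      change g.1 ((α ⟨j.1, j.2.1⟩).1 (g⁻¹.1 w)) = w
      rw [← hz, ← hα, j.2.2, hgz]
    have hmem' : ∀ j : stab s z, g * α ⟨j.1, j.2.1⟩ * g⁻¹ ∈ K := fun j =>
      ⟨(g * α ⟨j.1, j.2.1⟩ * g⁻¹).2, hmem j⟩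
    let κ : stab s z → K := fun j => ⟨g * α ⟨j.1, j.2.1⟩ * g⁻¹, hmem' j⟩
    have hκ : ∀ j, κ j ∈ MulAction.stabilizer K (g : orbGroup s ⧸ α.range) := by
      intro j
      change ((g * α ⟨j.1, j.2.1⟩ * g⁻¹ * g : orbGroup s) : orbGroup s ⧸ α.range) = g
      rw [QuotientGroup.eq]
      refine ⟨⟨j.1, j.2.1⟩⁻¹, ?_⟩
      rw [map_inv]; group
    refine Nat.card_congr (Equiv.ofBijective (fun j => ⟨κ j, hκ j⟩) ⟨?_, ?_⟩)
    · intro j j' hjj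
      have h1 : g * α ⟨j.1, j.2.1⟩ * g⁻¹ = g * α ⟨j'.1, j'.2.1⟩ * g⁻¹ :=
        congrArg (fun x : MulAction.stabilizer K (g : orbGroup s ⧸ α.range) => x.1.1) hjj
      have h2 := hinj (mul_left_cancel (mul_right_cancel h1))
      exact Subtype.ext (congrArg (fun x : orbGroup s => x.1) h2)
    · rintro ⟨k, hk⟩
      have hk' : ((k.1 * g : orbGroup s) : orbGroup s ⧸ α.range) = g := hk
      rw [eq_comm, QuotientGroup.eq] at hk'
      obtain ⟨j, hj⟩ := hk'
      have hjz : j.1 z = z := by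
        apply L.injective
        rw [hα, hj]
        change g⁻¹.1 (k.1.1 (g.1 (L z))) = L z
        rw [hgz, hKw, hz]
      refine ⟨⟨j.1, j.2, hjz⟩, ?_⟩
      apply Subtype.ext
      apply Subtype.ext
      change g * α j * g⁻¹ = k.1
      rw [hj]; group
  rw [horb, ← hstab, ← hK, ← MulAction.index_stabilizer, mul_comm]
  exact Subgroup.card_mul_index _

theorem finite_preimage [Finite (orbGroup s ⧸ α.range)] (hL : IsQuotientOf l L)
    (hα : ∀ g z, L (g.1 z) = (α g).1 (L z)) (p : Orb s) : (l ⁻¹' {p}).Finite := by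
  obtain ⟨w, rfl⟩ := orbProj_surjective s p
  rw [← range_fibrePoint hL hα]
  exact Set.finite_range _

/-- The transfer formula: the inverse orders of the points of a fibre add up to the degree times the
inverse order of the image point. -/
theorem finsum_inv_order [Finite (orbGroup s ⧸ α.range)] (hL : IsQuotientOf l L)
    (hα : ∀ g z, L (g.1 z) = (α g).1 (L z)) (p : Orb s) :
    ∑ᶠ x ∈ l ⁻¹' {p}, (orbOrder s x : ℝ)⁻¹ = α.range.index * (orbOrder s p : ℝ)⁻¹ := by
  classical
  obtain ⟨w, rfl⟩ := orbProj_surjective s p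
  have := Fintype.ofFinite (orbGroup s ⧸ α.range)
  have h0 : l ⁻¹' {orbProj s w} = ((Finset.univ.image (fibrePoint hα w) : Finset (Orb s)) :
      Set (Orb s)) := by
    rw [← range_fibrePoint hL hα]; simp
  rw [h0, finsum_mem_coe_finset, orbOrder_orbProj, Subgroup.index, Nat.card_eq_fintype_card,
    ← Finset.card_univ, Finset.card_eq_sum_card_image (fibrePoint hα w), Nat.cast_sum,
    Finset.sum_mul]
  refine Finset.sum_congr rfl fun x hx => ?_
  obtain ⟨q, -, rfl⟩ := Finset.mem_image.1 hx
  have h1 := ncard_fibrePoint_mul_order hα w q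
  have h2 : {q' | fibrePoint hα w q' = fibrePoint hα w q}.ncard
      = (Finset.univ.filter fun q' => fibrePoint hα w q' = fibrePoint hα w q).card := by
    rw [← Set.ncard_coe_finset]; simp
  rw [h2] at h1
  have h3 : (orbOrder s (fibrePoint hα w q) : ℝ) ≠ 0 := by
    exact_mod_cast (orbOrder_pos s _).ne'
  have h4 : (order s w : ℝ) ≠ 0 := by exact_mod_cast (order_pos s w).ne'
  have h5 : ((Finset.univ.filter fun q' => fibrePoint hα w q' = fibrePoint hα w q).card : ℝ)
      * orbOrder s (fibrePoint hα w q) = order s w := by exact_mod_cast h1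
  field_simp
  linarith

theorem two_le_index [Finite (orbGroup s ⧸ α.range)] (hL : IsQuotientOf l L)
    (hα : ∀ g z, L (g.1 z) = (α g).1 (L z)) (hd : 2 ≤ coveringDegree l) : 2 ≤ α.range.index := by
  have h1 : coveringDegree l ≤ (α.range.index : ℕ∞) := by
    refine iSup_le fun p => ?_
    obtain ⟨w, rfl⟩ := orbProj_surjective s p
    rw [← range_fibrePoint hL hα, ← Set.image_univ]
    refine (Set.encard_image_le _ _).trans ?_
    rw [Set.encard_univ, Subgroup.index]
    exact (ENat.card_eq_coe_natCard _).le
  exact_mod_cast hd.trans h1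

/-- A point at which the quotient of an affine map is locally injective has the same order as its
image. -/
theorem orbOrder_eq_of_notMem_criticalSet (hL : IsQuotientOf l L)
    (hα : ∀ g z, L (g.1 z) = (α g).1 (L z)) {x : Orb s} (hx : x ∉ criticalSet l) :
    orbOrder s x = orbOrder s (l x) := by
  obtain ⟨z, rfl⟩ := orbProj_surjective s x
  simp only [criticalSet, Set.mem_ofPred_eq, not_forall, not_not] at hx
  obtain ⟨U, hU, hinj⟩ := hx
  rw [hL, orbOrder_orbProj, orbOrder_orbProj]
  have hαinj := injective_of_intertwined (F := L) L.injective hα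
  refine Nat.card_congr (Equiv.ofBijective (fun j : stab s z => (⟨(α ⟨j.1, j.2.1⟩).1,
    (α ⟨j.1, j.2.1⟩).2, by rw [← hα, j.2.2]⟩ : stab s (L z))) ⟨?_, ?_⟩)
  · intro j j' hjj
    have h1 : α ⟨j.1, j.2.1⟩ = α ⟨j'.1, j'.2.1⟩ := Subtype.ext
      (congrArg (fun x : stab s (L z) => x.1) hjj)
    exact Subtype.ext (congrArg (fun x : orbGroup s => x.1) (hαinj h1))
  · rintro ⟨γ, hγ, hγz⟩
    let F' : Plane → Plane := fun y => L.symm (γ (L y))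
    have hF' : Continuous F' := (continuous_affineEquiv L.symm).comp
      ((continuous_affineEquiv γ).comp (continuous_affineEquiv L))
    have hF'z : F' z = z := by simp only [F']; rw [hγz, L.symm_apply_apply]
    have h1 : ∀ᶠ y in 𝓝 z, orbProj s y ∈ U := (continuous_orbProj s).continuousAt hU
    have h2 : ∀ᶠ y in 𝓝 z, orbProj s (F' y) ∈ U := by
      have : ContinuousAt (fun y => orbProj s (F' y)) z :=
        ((continuous_orbProj s).comp hF').continuousAt
      have hU' : U ∈ 𝓝 (orbProj s (F' z)) := by rw [hF'z]; exact hU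
      exact this hU'
    have h3 : ∀ᶠ y in 𝓝 z, orbProj s y = orbProj s (F' y) := by
      filter_upwards [h1, h2] with y hy1 hy2
      refine hinj hy1 hy2 ?_
      rw [hL, hL]
      simp only [F']
      rw [L.apply_symm_apply, orbProj_apply hγ]
    obtain ⟨g, hg, h⟩ := exists_eventuallyEq_of_lifts (s := s) (F := fun y => y) (F' := F')
      (countable_conePoints s).locallyNonseparating (.of_forall fun y => continuousAt_id)
      (.of_forall fun y => hF'.continuousAt) h3 (.of_forall fun y hy => hy)
    have hgz : g z = z := by rw [← h.self_of_nhds, hF'z]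
    refine ⟨⟨g, hg, hgz⟩, Subtype.ext ?_⟩
    obtain ⟨y, hy, hyB⟩ := ((countable_conePoints s).preimage
      L.injective).locallyNonseparating.exists_notMem h
    refine eq_of_apply_eq (α ⟨g, hg⟩).2 hγ hyB ?_
    have h4 := congrArg L hy
    simp only [F', L.apply_symm_apply] at h4
    rw [h4]
    exact (hα ⟨g, hg⟩ y).symm

end Counting

/-- A finitely supported function vanishes if its sum over the fibre above each point of its support
is `d ≥ 2` times its value there: summing absolute values gives `d ‖w‖₁ ≤ ‖w‖₁`. -/
theorem eq_zero_of_finsum_preimage {X : Type*} {f : X → X} {w : X → ℝ} {d : ℕ} (hd : 2 ≤ d)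
    (hw : (Function.support w).Finite)
    (h : ∀ p, w p ≠ 0 → ∑ᶠ x ∈ f ⁻¹' {p}, w x = d * w p) : w = 0 := by
  classical
  have h1 : ∀ p ∈ hw.toFinset, (d : ℝ) * |w p| ≤ ∑ x ∈ hw.toFinset with f x = p, |w x| := by
    intro p hp
    have h2 : ∑ᶠ x ∈ f ⁻¹' {p}, w x = ∑ x ∈ hw.toFinset with f x = p, w x := by
      rw [← finsum_mem_coe_finset]
      refine finsum_mem_inter_support_eq _ _ _ ?_
      ext x
      simp +contextual
    have h3 := h p (by simpa using hp)
    rw [h2] at h3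
    rw [← Nat.abs_cast d, ← abs_mul, ← h3]
    exact Finset.abs_sum_le_sum_abs _ _
  have h2 : (d : ℝ) * ∑ p ∈ hw.toFinset, |w p| ≤ ∑ x ∈ hw.toFinset, |w x| := by
    rw [Finset.mul_sum]
    refine (Finset.sum_le_sum h1).trans ?_
    exact Finset.sum_fiberwise_le_sum_of_sum_fiber_nonneg (fun p _ =>
      Finset.sum_nonneg fun x _ => abs_nonneg _)
  have h3 : 0 ≤ ∑ p ∈ hw.toFinset, |w p| := Finset.sum_nonneg fun x _ => abs_nonneg _
  have h4 : (2 : ℝ) ≤ d := by exact_mod_cast hd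
  have h5 : ∑ p ∈ hw.toFinset, |w p| = 0 := by nlinarith
  funext x
  by_contra hx
  have h6 := (Finset.sum_eq_zero_iff_of_nonneg (fun x _ => abs_nonneg (w x))).1 h5 x
    (by simpa using hx)
  exact hx (abs_eq_zero.1 h6)

/-! ### Degree, marked cone points and preservation of orders -/

theorem IsBranchedCovering.exists_isolated {X : Type*} [TopologicalSpace X] {f : X → X}
    (hf : IsBranchedCovering f) (x : X) : ∃ U ∈ 𝓝 x, ∀ y ∈ U, f y = f x → y = x := by
  obtain ⟨e, e', k, hk, hx, hex, hex', h⟩ := hf.2 x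
  refine ⟨e.source, e.open_source.mem_nhds hx, fun y hy hyx => ?_⟩
  refine e.injOn hy hx ?_
  have h1 := (h y hy).2
  rw [hyx, hex', eq_comm, pow_eq_zero_iff (by omega)] at h1
  rw [h1, hex]

/-- The linear part is injective: along a kernel direction, nearby points of the orbifold would have
the same image, but the fibres of a branched covering are discrete. -/
theorem eq_zero_of_linAct_eq_zero {s : ParabolicSignature} {l : Orb s → Orb s}
    {A : Matrix (Fin 2) (Fin 2) ℤ} {b : Plane} (hl : IsBranchedCovering l)
    (hL : IsQuotientOf l (intAffine A b)) {k : Plane} (hk : linAct A k = 0) : k = 0 := by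
  by_contra hk0
  obtain ⟨U, hU, h⟩ := hl.exists_isolated (orbProj s 0)
  obtain ⟨V, hV, hd⟩ := eventually_discrete s 0
  have hc : Continuous fun t : ℝ => t • k := by fun_prop
  have h1 : ∀ᶠ t : ℝ in 𝓝 0, t • k ∈ V := by
    refine hc.continuousAt ?_
    rwa [zero_smul]
  have h2 : ∀ᶠ t : ℝ in 𝓝 0, orbProj s (t • k) ∈ U := by
    refine ((continuous_orbProj s).comp hc).continuousAt ?_
    change U ∈ 𝓝 (orbProj s ((0 : ℝ) • k))
    rwa [zero_smul]
  have h3 : ∀ᶠ t : ℝ in 𝓝[≠] 0, t • k ∈ V ∧ orbProj s (t • k) ∈ U ∧ t ≠ 0 := by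
    filter_upwards [h1.filter_mono nhdsWithin_le_nhds, h2.filter_mono nhdsWithin_le_nhds,
      self_mem_nhdsWithin] with t a b c using ⟨a, b, c⟩
  obtain ⟨t, ht1, ht2, ht0⟩ := h3.exists
  have h4 : orbProj s (t • k) = orbProj s 0 := by
    refine h _ ht2 ?_
    rw [hL, hL, intAffine_eq, intAffine_eq, linAct_smul, hk, smul_zero, linAct_zero]
  obtain ⟨g, hg, hgk⟩ := orbProj_eq_iff.1 h4.symm
  have h5 := hd g hg 0 (mem_of_mem_nhds hV) (by rwa [hgk])
  rw [hgk] at h5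
  exact hk0 ((smul_eq_zero.1 h5).resolve_left ht0)

theorem det_ne_zero_of_isQuotientOf {s : ParabolicSignature} {l : Orb s → Orb s}
    {A : Matrix (Fin 2) (Fin 2) ℤ} {b : Plane} (hl : IsBranchedCovering l)
    (hL : IsQuotientOf l (intAffine A b)) : A.det ≠ 0 := by
  intro hdet
  obtain ⟨v, hv, hAv⟩ := Matrix.exists_mulVec_eq_zero_iff.2 hdet
  apply hv
  apply latticePt_injective
  have h0 : latticePt 0 = 0 := by funext i; simp [latticePt]
  rw [h0]
  refine eq_zero_of_linAct_eq_zero hl hL ?_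
  rw [linAct_latticePt, hAv, h0]

theorem linAct_bijective {A : Matrix (Fin 2) (Fin 2) ℤ} (hA : A.det ≠ 0) :
    Function.Bijective (linAct A) := by
  have h1 : IsUnit (A.map (fun n : ℤ => (n : ℝ))) := by
    rw [Matrix.isUnit_iff_isUnit_det, isUnit_iff_ne_zero]
    have h2 : (A.map (fun n : ℤ => (n : ℝ))).det = (A.det : ℝ) :=
      ((Int.castRingHom ℝ).map_det A).symm
    rw [h2]
    exact_mod_cast hA
  exact ⟨Matrix.mulVec_injective_iff_isUnit.2 h1, Matrix.mulVec_surjective_iff_isUnit.2 h1⟩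

/-- The affine map `z ↦ A z + b` as an equivalence, for an invertible `A`. -/
noncomputable def intAffineEquiv (A : Matrix (Fin 2) (Fin 2) ℤ) (b : Plane) (hA : A.det ≠ 0) :
    Plane ≃ᵃ[ℝ] Plane :=
  (LinearEquiv.ofBijective
    ({ toFun := linAct A
       map_add' := linAct_add A
       map_smul' := linAct_smul A } : Plane →ₗ[ℝ] Plane) (linAct_bijective hA)).toAffineEquiv.trans
    (AffineEquiv.constVAdd ℝ Plane b)

theorem intAffineEquiv_apply (A : Matrix (Fin 2) (Fin 2) ℤ) (b : Plane) (hA : A.det ≠ 0)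
    (z : Plane) : intAffineEquiv A b hA z = intAffine A b z := by
  rw [intAffine_eq, add_comm]; rfl

theorem isQuotientOf_intAffineEquiv {s : ParabolicSignature} {l : Orb s → Orb s}
    {A : Matrix (Fin 2) (Fin 2) ℤ} {b : Plane} (hA : A.det ≠ 0)
    (hL : IsQuotientOf l (intAffine A b)) : IsQuotientOf l (intAffineEquiv A b hA) := by
  intro z
  rw [hL, intAffineEquiv_apply]

/-- The lattice translations as elements of the orbifold group. -/
noncomputable def translG (s : ParabolicSignature) (v : Fin 2 → ℤ) : orbGroup s :=
  ⟨transl v, transl_mem s v⟩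

theorem translG_apply (s : ParabolicSignature) (v : Fin 2 → ℤ) (z : Plane) :
    (translG s v).1 z = z + latticePt v := transl_apply v z

theorem translG_add (s : ParabolicSignature) (v w : Fin 2 → ℤ) :
    translG s (v + w) = translG s v * translG s w := Subtype.ext (transl_add v w)

theorem translG_injective (s : ParabolicSignature) : Function.Injective (translG s) :=
  fun _ _ h => transl_injective (congrArg Subtype.val h)

/-- Elements of the orbifold group with the same multiplier differ by a translation. -/
theorem exists_eq_translG_mul {s : ParabolicSignature} {g h : orbGroup s}
    (hgh : multiplier s g.1 = multiplier s h.1) : ∃ v, g = translG s v * h := by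
  have h1 : multiplier s (g * h⁻¹).1 = 1 := by
    have h2 : multiplier s (g * h⁻¹ * h).1 = multiplier s (g * h⁻¹).1 * multiplier s h.1 :=
      multiplier_mul (g * h⁻¹).2
    rw [inv_mul_cancel_right, hgh] at h2
    exact (mul_right_cancel₀ (multiplier_ne_zero h.2) (by rw [one_mul, ← h2])).symm
  obtain ⟨v, hv⟩ := exists_eq_transl (g * h⁻¹).2 h1
  refine ⟨v, ?_⟩
  have h3 : g * h⁻¹ = translG s v := Subtype.ext hv
  rw [← h3, inv_mul_cancel_right]

section Degree

variable {s : ParabolicSignature} {A : Matrix (Fin 2) (Fin 2) ℤ} {b : Plane} {hA : A.det ≠ 0}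
  {α : orbGroup s →* orbGroup s}

theorem map_translG (hα : ∀ g z, intAffineEquiv A b hA (g.1 z) = (α g).1 (intAffineEquiv A b hA z))
    (v : Fin 2 → ℤ) : α (translG s v) = translG s (A.mulVec v) := by
  ext z
  obtain ⟨y, rfl⟩ := (intAffineEquiv A b hA).surjective z
  rw [← hα, translG_apply, translG_apply, intAffineEquiv_apply, intAffineEquiv_apply,
    intAffine_eq, intAffine_eq, linAct_add, linAct_latticePt, add_right_comm]

theorem translG_det_smul_mem_range
    (hα : ∀ g z, intAffineEquiv A b hA (g.1 z) = (α g).1 (intAffineEquiv A b hA z))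
    (v : Fin 2 → ℤ) : translG s (A.det • v) ∈ α.range := by
  refine ⟨translG s (A.adjugate.mulVec v), ?_⟩
  rw [map_translG hα, Matrix.mulVec_mulVec, Matrix.mul_adjugate, Matrix.smul_mulVec,
    Matrix.one_mulVec]

/-- The image of the induced endomorphism has finite index: a coset is determined by the multiplier
of an element and by its translation part modulo the determinant. -/
theorem finite_quotient_range
    (hα : ∀ g z, intAffineEquiv A b hA (g.1 z) = (α g).1 (intAffineEquiv A b hA z)) :
    Finite (orbGroup s ⧸ α.range) := by
  have : NeZero A.det.natAbs := ⟨Int.natAbs_ne_zero.2 hA⟩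
  have : Finite {u : ℂ // u ^ 12 = 1} := finite_twelfth_roots.to_subtype
  choose ν hν using fun g : orbGroup s => exists_eq_apply_zero g.2
  let δ : orbGroup s ⧸ α.range → {u : ℂ // u ^ 12 = 1} × (Fin 2 → ZMod A.det.natAbs) := fun q =>
    (⟨multiplier s (q.out⁻¹).1, multiplier_pow (q.out⁻¹).2⟩, fun i => (ν q.out⁻¹ i : ZMod _))
  refine Finite.of_injective δ fun q q' hqq => ?_
  rw [Prod.mk.injEq] at hqq
  obtain ⟨h1, h2⟩ := hqq
  obtain ⟨v, hv⟩ := exists_eq_translG_mul (congrArg Subtype.val h1)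
  have h3 : ν q.out⁻¹ = ν q'.out⁻¹ + v := by
    apply latticePt_injective
    rw [latticePt_add, ← hν, ← hν, hv]
    exact translG_apply s v _
  have h4 : ∃ k, v = A.det • k := by
    have h5 : ∀ i, A.det ∣ v i := by
      intro i
      have h6 := congrFun h2 i
      rw [eq_comm, ZMod.intCast_eq_intCast_iff_dvd_sub, h3] at h6
      simpa using h6
    choose k hk using h5
    exact ⟨k, funext fun i => by simpa using hk i⟩
  obtain ⟨k, rfl⟩ := h4
  rw [← q.out_eq', ← q'.out_eq']
  change ((q.out : orbGroup s) : orbGroup s ⧸ α.range) = (q'.out : orbGroup s)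
  rw [eq_comm, QuotientGroup.eq]
  have h7 : q'.out⁻¹ * q.out = (translG s (A.det • k))⁻¹ := by
    have h8 : q.out = q'.out * (translG s (A.det • k))⁻¹ := by
      apply inv_injective
      rw [hv]; group
    rw [h8]; group
  rw [h7]
  exact Subgroup.inv_mem _ (translG_det_smul_mem_range hα k)

/-- The induced endomorphism is surjective if the matrix is. Since the multipliers form a finite set,
two iterates `α^i g` and `α^j g` differ by a translation, which is in the image of `α^i`;
cancelling the injective `α^i` shows that `g` is in the image. -/
theorem surjective_of_mulVec_surjective
    (hα : ∀ g z, intAffineEquiv A b hA (g.1 z) = (α g).1 (intAffineEquiv A b hA z))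
    (h : ∀ v, ∃ w, A.mulVec w = v) : Function.Surjective α := by
  have hinj := injective_of_intertwined (F := intAffineEquiv A b hA)
    (intAffineEquiv A b hA).injective hα
  have h1 : ∀ v, ∃ w, α (translG s w) = translG s v := by
    intro v
    obtain ⟨w, hw⟩ := h v
    exact ⟨w, by rw [map_translG hα, hw]⟩
  have h2 : ∀ (i : ℕ) v, ∃ w, α^[i] (translG s w) = translG s v := by
    intro i
    induction i with
    | zero => exact fun v => ⟨v, rfl⟩
    | succ i ih =>
      intro v
      obtain ⟨w, hw⟩ := h1 v
      obtain ⟨w', hw'⟩ := ih w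
      exact ⟨w', by rw [Function.iterate_succ_apply', hw', hw]⟩
  have hmul : ∀ (i : ℕ) (g g' : orbGroup s), α^[i] (g * g') = α^[i] g * α^[i] g' := by
    intro i g g'
    induction i with
    | zero => rfl
    | succ i ih => rw [Function.iterate_succ_apply', ih, map_mul, Function.iterate_succ_apply',
        Function.iterate_succ_apply']
  have hfin : Finite {u : ℂ // u ^ 12 = 1} := finite_twelfth_roots.to_subtype
  have key : ∀ (g : orbGroup s) (i j : ℕ), i < j →
      multiplier s (α^[i] g).1 = multiplier s (α^[j] g).1 → g ∈ Set.range α := by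
    intro g i j hij hm
    obtain ⟨v, hv⟩ := exists_eq_translG_mul hm
    obtain ⟨w, hw⟩ := h2 i v
    obtain ⟨k, rfl⟩ := Nat.exists_eq_add_of_lt hij
    rw [← hw, add_assoc, Function.iterate_add_apply, ← hmul] at hv
    have h3 := (hinj.iterate i) hv
    rw [Function.iterate_succ_apply'] at h3
    obtain ⟨w', hw'⟩ := h1 w
    exact ⟨translG s w' * α^[k] g, by rw [map_mul, hw', ← h3]⟩
  intro g
  obtain ⟨i, j, hij, he⟩ := Finite.exists_ne_map_eq_of_infinite
    (fun i : ℕ => (⟨multiplier s (α^[i] g).1, multiplier_pow (α^[i] g).2⟩ : {u : ℂ // u ^ 12 = 1}))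
  have he' := congrArg Subtype.val he
  rcases lt_or_gt_of_ne hij with h3 | h3
  · exact key g i j h3 he'
  · exact key g j i h3 he'.symm

/-- An affine map whose quotient has degree at least two does not preserve area. -/
theorem not_isUnit_det {l : Orb s → Orb s} (hL : IsQuotientOf l (intAffineEquiv A b hA))
    (hα : ∀ g z, intAffineEquiv A b hA (g.1 z) = (α g).1 (intAffineEquiv A b hA z))
    (hd : 2 ≤ coveringDegree l) : ¬ IsUnit A.det := by
  intro hu
  have := finite_quotient_range hα
  have h1 := two_le_index hL hα hd
  have h2 : α.range = ⊤ := MonoidHom.range_eq_top.2 (surjective_of_mulVec_surjective hα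
    (Matrix.mulVec_surjective_iff_isUnit.2 ((Matrix.isUnit_iff_isUnit_det A).2 hu)))
  rw [h2, Subgroup.index_top] at h1
  omega

end Degree

/-- Every point of the plane has a lattice translate in the unit square. -/
theorem exists_sub_latticePt_mem (z : Plane) :
    ∃ v, z - latticePt v ∈ Set.Icc (0 : Plane) 1 := by
  refine ⟨fun i => ⌊z i⌋, fun i => ?_, fun i => ?_⟩
  · simp [latticePt]
  · have := (Int.lt_floor_add_one (z i)).le
    simp only [latticePt, Pi.sub_apply, Pi.one_apply]
    linarith

theorem finite_orbOrder_ne_one (s : ParabolicSignature) : {x | orbOrder s x ≠ 1}.Finite := by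
  obtain ⟨R, hR⟩ := (isCompact_Icc (a := (0 : Plane)) (b := 1)).exists_bound_of_continuousOn
    (f := coord s) (coord s).continuous.continuousOn
  have hfin : {z | ∃ g ∈ {g | g ∈ orbGroup s ∧ ‖coord s (g 0) - coord s 0‖ ≤ 2 * R},
      g ≠ 1 ∧ g z = z}.Finite := by
    have : {z | ∃ g ∈ {g | g ∈ orbGroup s ∧ ‖coord s (g 0) - coord s 0‖ ≤ 2 * R},
        g ≠ 1 ∧ g z = z} = ⋃ g ∈ {g | g ∈ orbGroup s ∧ ‖coord s (g 0) - coord s 0‖ ≤ 2 * R},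
          {z | g ≠ 1 ∧ g z = z} := by
      ext z
      simp only [Set.mem_ofPred_eq, Set.mem_iUnion, exists_prop]
    rw [this]
    refine (finite_orbGroup_near s 0 (2 * R)).biUnion fun g hg => Set.Subsingleton.finite ?_
    rintro z ⟨hg1, hz⟩ w ⟨-, hw⟩
    by_contra hzw
    exact hg1 (fixed_unique hg.1 hz hw hzw)
  refine (hfin.image (orbProj s)).subset ?_
  intro x hx
  obtain ⟨z, rfl⟩ := orbProj_surjective s x
  obtain ⟨v, hv⟩ := exists_sub_latticePt_mem z
  have h1 : orbProj s (z - latticePt v) = orbProj s z := by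
    rw [← orbProj_apply (transl_mem s v) (z - latticePt v), transl_apply, sub_add_cancel]
  rw [← h1] at hx ⊢
  refine ⟨_, ?_, rfl⟩
  rw [Set.mem_ofPred_eq, orbOrder_orbProj, Ne, order_eq_one_iff, not_not] at hx
  obtain ⟨g, hg, hg1, hgz⟩ := hx
  refine ⟨g, ⟨hg, ?_⟩, hg1, hgz⟩
  have h2 := norm_coord_sub hg 0 (z - latticePt v)
  have h3 := hR _ hv
  rw [hgz, (coord s).map_zero, zero_sub, norm_neg] at h2
  rw [(coord s).map_zero, sub_zero]
  have h4 := norm_add_le (coord s (g 0) - coord s (z - latticePt v)) (coord s (z - latticePt v))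
  rw [sub_add_cancel] at h4
  linarith

theorem exists_notMem_of_finite {s : ParabolicSignature} {Q : Set (Orb s)} (hQ : Q.Finite) :
    ∃ x, x ∉ Q := by
  have h1 : (orbProj s ⁻¹' Q).Countable := by
    have : orbProj s ⁻¹' Q = ⋃ x ∈ Q, orbProj s ⁻¹' {x} := by ext; simp
    rw [this]
    refine hQ.countable.biUnion fun x _ => ?_
    obtain ⟨z, rfl⟩ := orbProj_surjective s x
    refine ((countable_orbGroup s).image fun g => g z).mono ?_
    intro w hw
    obtain ⟨g, hg, h⟩ := orbProj_eq_iff.1 (show orbProj s z = orbProj s w from hw.symm)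
    exact ⟨g, hg, h⟩
  obtain ⟨z, hz⟩ := (h1.dense_compl ℝ).nonempty
  exact ⟨_, hz⟩

/-- The cone points are marked. The preimages of an unmarked cone point are unmarked and not critical,
so that they have its order, and by the transfer formula there are `d ≥ 2` of them: the finite set of
unmarked cone points would contain `d` times as many points as it has. -/
theorem IsThurstonMap.mem_of_orbOrder_ne_one {s : ParabolicSignature} {l : Orb s → Orb s}
    {L : Plane ≃ᵃ[ℝ] Plane} {α : orbGroup s →* orbGroup s} [Finite (orbGroup s ⧸ α.range)]
    {Q : Set (Orb s)} (hl : IsThurstonMap l Q) (hL : IsQuotientOf l L)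
    (hα : ∀ g z, L (g.1 z) = (α g).1 (L z)) {x : Orb s} (hx : orbOrder s x ≠ 1) : x ∈ Q := by
  classical
  by_contra hxQ
  let w : Orb s → ℝ := fun x => if orbOrder s x ≠ 1 ∧ x ∉ Q then 1 else 0
  have hw : w = 0 := by
    refine eq_zero_of_finsum_preimage (f := l) (two_le_index hL hα hl.two_le_degree)
      ((finite_orbOrder_ne_one s).subset fun x hx => ?_) fun p hp => ?_
    · by_contra h
      exact hx (if_neg fun h' => h h'.1)
    · have hpT : orbOrder s p ≠ 1 ∧ p ∉ Q := by
        by_contra h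
        exact hp (if_neg h)
      have h0 : (orbOrder s p : ℝ) ≠ 0 := by exact_mod_cast (orbOrder_pos s p).ne'
      have h1 : ∀ x ∈ l ⁻¹' {p}, w x = orbOrder s p * (orbOrder s x : ℝ)⁻¹ := by
        intro x hx
        have hlx : l x = p := hx
        have h2 : x ∉ criticalSet l := by
          intro hc
          refine hpT.2 (hl.postcritical_subset ?_)
          simp only [postcriticalSet, Set.mem_iUnion]
          exact ⟨1, one_pos, x, hc, hlx⟩
        have h3 := orbOrder_eq_of_notMem_criticalSet hL hα h2
        rw [hlx] at h3
        have h4 : x ∉ Q := fun h => hpT.2 (hl.invariant ⟨x, h, hlx⟩)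
        rw [h3, mul_inv_cancel₀ h0]
        exact if_pos ⟨h3 ▸ hpT.1, h4⟩
      rw [finsum_mem_congr rfl h1, ← mul_finsum_mem,
        finsum_inv_order hL hα, show w p = 1 from if_pos hpT]
      field_simp
  have h1 := congrFun hw x
  rw [show w x = 1 from if_pos ⟨hx, hxQ⟩] at h1
  exact one_ne_zero h1

/-- A Thurston equivalence between quotients of affine maps preserves the orders of points: the
inverse orders and their pullback by the equivalence satisfy the same transfer formula, and their
difference is supported on the finite set of marked points, so that it vanishes. -/
theorem orbOrder_apply_of_equiv {s : ParabolicSignature} {l₁ l₂ : Orb s → Orb s}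
    {L₁ L₂ : Plane ≃ᵃ[ℝ] Plane} {α₁ α₂ : orbGroup s →* orbGroup s}
    [Finite (orbGroup s ⧸ α₁.range)] [Finite (orbGroup s ⧸ α₂.range)] {Q₁ Q₂ : Set (Orb s)}
    (hl₁ : IsThurstonMap l₁ Q₁) (hl₂ : IsThurstonMap l₂ Q₂)
    (hL₁ : IsQuotientOf l₁ L₁) (hL₂ : IsQuotientOf l₂ L₂)
    (hα₁ : ∀ g z, L₁ (g.1 z) = (α₁ g).1 (L₁ z)) (hα₂ : ∀ g z, L₂ (g.1 z) = (α₂ g).1 (L₂ z))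
    {φ₀ φ₁ : Orb s ≃ₜ Orb s} (heq : Set.EqOn φ₀ φ₁ Q₁) (hQ : φ₀ '' Q₁ = Q₂)
    (hφ : ∀ x, φ₀ (l₁ x) = l₂ (φ₁ x)) (x : Orb s) : orbOrder s (φ₀ x) = orbOrder s x := by
  let u : Orb s → ℝ := fun x => (orbOrder s x : ℝ)⁻¹
  have hu1 : ∀ x, orbOrder s x = 1 → u x = 1 := fun x hx => by simp [u, hx]
  have h1 : ∀ x, x ∉ Q₁ → u x = 1 := fun x hx => hu1 x (by
    by_contra h; exact hx (hl₁.mem_of_orbOrder_ne_one hL₁ hα₁ h))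
  have h2 : ∀ x, x ∉ Q₂ → u x = 1 := fun x hx => hu1 x (by
    by_contra h; exact hx (hl₂.mem_of_orbOrder_ne_one hL₂ hα₂ h))
  have h3 : ∀ x, x ∉ Q₁ → φ₀ x ∉ Q₂ := by
    rintro x hx h
    rw [← hQ] at h
    obtain ⟨y, hy, hyx⟩ := h
    exact hx (φ₀.injective hyx ▸ hy)
  have h4 : ∀ x, x ∉ Q₁ → φ₁ x ∉ Q₂ := by
    rintro x hx h
    rw [← hQ] at h
    obtain ⟨y, hy, hyx⟩ := h
    rw [heq hy] at hyx
    exact hx (φ₁.injective hyx ▸ hy)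
  have h5 : ∀ x, u (φ₁ x) = u (φ₀ x) := by
    intro x
    by_cases hx : x ∈ Q₁
    · rw [heq hx]
    · rw [h2 _ (h3 x hx), h2 _ (h4 x hx)]
  have h6 : ∀ p, ∑ᶠ x ∈ l₁ ⁻¹' {p}, u (φ₀ x) = α₂.range.index * u (φ₀ p) := by
    intro p
    rw [← finsum_inv_order hL₂ hα₂]
    -- `φ₁` maps the fibre of `l₁` over `p` onto that of `l₂` over `φ₀ p`
    refine finsum_mem_eq_of_bijOn φ₁ ⟨?_, φ₁.injective.injOn, ?_⟩ fun x _ => (h5 x).symm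
    · intro x hx
      rw [Set.mem_preimage, ← hφ, show l₁ x = p from hx]; rfl
    · intro y hy
      refine ⟨φ₁.symm y, φ₀.injective ?_, φ₁.apply_symm_apply y⟩
      rw [hφ, φ₁.apply_symm_apply]
      exact hy
  have h7 : ∀ p, ∑ᶠ x ∈ l₁ ⁻¹' {p}, u x = α₁.range.index * u p := finsum_inv_order hL₁ hα₁
  -- the degrees agree: above an unmarked point, all orders are `1`
  have hd : (α₁.range.index : ℝ) = α₂.range.index := by
    obtain ⟨p, hp⟩ := exists_notMem_of_finite hl₁.finite
    have h8 := h6 p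
    have h9 := h7 p
    rw [h2 _ (h3 p hp), mul_one] at h8
    rw [h1 p hp, mul_one] at h9
    rw [← h8, ← h9]
    refine finsum_mem_congr rfl fun x hx => ?_
    have hxQ : x ∉ Q₁ := fun h => hp (hl₁.invariant ⟨x, h, hx⟩)
    rw [h1 x hxQ, h2 _ (h3 x hxQ)]
  have hw : (fun x => u x - u (φ₀ x)) = 0 := by
    refine eq_zero_of_finsum_preimage (f := l₁) (two_le_index hL₁ hα₁ hl₁.two_le_degree)
      (hl₁.finite.subset fun x hx => ?_) fun p _ => ?_
    · by_contra h
      exact hx (by simp only; rw [h1 x h, h2 _ (h3 x h), sub_self])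
    · rw [finsum_mem_sub_distrib _ _ (finite_preimage hL₁ hα₁ p), h6, h7, hd]
      ring
  have h8 : u x - u (φ₀ x) = 0 := congrFun hw x
  have h9 := inv_injective (sub_eq_zero.1 h8)
  exact_mod_cast h9.symm

/-! ### Orientation and winding numbers -/

section Winding

open Complex

theorem norm_unitVec_le (t : ℝ) : ‖unitVec t‖ ≤ 1 := by
  rw [pi_norm_le_iff_of_nonneg zero_le_one]
  intro i
  fin_cases i
  · exact Real.abs_cos_le_one t
  · exact Real.abs_sin_le_one t

theorem continuous_unitVec : Continuous unitVec := by
  refine continuous_pi fun i => ?_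
  fin_cases i
  · exact Real.continuous_cos
  · exact Real.continuous_sin

/-- In the standard complex coordinate `x + i y`, the unit vector with angle `t` is `exp (i t)`. -/
theorem coord_unitVec (t : ℝ) : coord .s2222 (unitVec t) = exp (t * I) := by
  rw [coord_apply, exp_mul_I]
  simp [unitVec, ParabolicSignature.tau]

theorem unitVec_add_two_pi (t : ℝ) : unitVec (t + 2 * Real.pi) = unitVec t := by
  simp [unitVec]

/-- A map that differs from an integer matrix by a periodic function stays at bounded distance from
it. -/
theorem exists_bound_sub_linAct {F : Plane → Plane} (hF : Continuous F)
    {M : Matrix (Fin 2) (Fin 2) ℤ}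
    (hFM : ∀ z v, F (z + latticePt v) = F z + latticePt (M.mulVec v)) :
    ∃ K, ∀ z, ‖coord .s2222 (F z - linAct M z)‖ ≤ K := by
  obtain ⟨K, hK⟩ := (isCompact_Icc (a := (0 : Plane)) (b := 1)).exists_bound_of_continuousOn
    (f := fun z => coord .s2222 (F z - linAct M z))
    ((coord .s2222).continuous.comp (hF.sub (continuous_linAct M))).continuousOn
  refine ⟨K, fun z => ?_⟩
  obtain ⟨v, hv⟩ := exists_sub_latticePt_mem z
  have h1 := hFM (z - latticePt v) v
  rw [sub_add_cancel, ← linAct_latticePt] at h1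
  have h2 : F z - linAct M z = F (z - latticePt v) - linAct M (z - latticePt v) := by
    rw [h1, linAct_sub]; abel
  rw [h2]
  exact hK _ hv

/-- A real-linear map of the complex plane is `ζ ↦ a ζ + b conj ζ`, and its determinant is
`‖a‖² - ‖b‖²`. -/
theorem exists_coord_linAct_eq (M : Matrix (Fin 2) (Fin 2) ℤ) : ∃ a b : ℂ,
    (∀ t, coord .s2222 (linAct M (unitVec t)) = a * exp (t * I) + b * exp (-(t * I))) ∧
    ‖a‖ ^ 2 - ‖b‖ ^ 2 = M.det := by
  refine ⟨⟨(M 0 0 + M 1 1) / 2, (M 1 0 - M 0 1) / 2⟩, ⟨(M 0 0 - M 1 1) / 2, (M 1 0 + M 0 1) / 2⟩,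
    fun t => ?_, ?_⟩
  · rw [coord_apply, linAct_apply_zero, linAct_apply_one, ← neg_mul, exp_mul_I, exp_mul_I,
      Complex.cos_neg, Complex.sin_neg, ← ofReal_cos, ← ofReal_sin]
    apply Complex.ext
    · simp [unitVec, ParabolicSignature.tau]; ring
    · simp [unitVec, ParabolicSignature.tau]; ring
  · rw [← normSq_eq_norm_sq, ← normSq_eq_norm_sq, normSq_apply, normSq_apply, Matrix.det_fin_two]
    push_cast
    ring

/-- An injective continuous map of the plane at bounded distance from an integer matrix `M`, with
positive local index at some point, has `det M ≥ 0`: the winding number of the images of the circles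
around the point does not depend on the radius, and large circles are wound as by `M`. -/
theorem det_nonneg_of_positiveIndexAt {F : Plane → Plane} (hF : Continuous F)
    (hinj : Function.Injective F) {M : Matrix (Fin 2) (Fin 2) ℤ}
    (hFM : ∀ z v, F (z + latticePt v) = F z + latticePt (M.mulVec v)) {z₀ : Plane}
    (hz₀ : PositiveIndexAt F z₀) : 0 ≤ M.det := by
  by_contra! hdet
  obtain ⟨K, hK⟩ := exists_bound_sub_linAct hF hFM
  let Ψ : ℝ × ℝ → ℂ := fun x => coord .s2222 (F (z₀ + x.1 • unitVec x.2) - F z₀)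
  have hΨc : Continuous Ψ := by
    have h1 : Continuous fun x : ℝ × ℝ => z₀ + x.1 • unitVec x.2 :=
      continuous_const.add (continuous_fst.smul (continuous_unitVec.comp continuous_snd))
    exact (coord .s2222).continuous.comp ((hF.comp h1).sub continuous_const)
  have hΨper : ∀ r t, Ψ (r, t + 2 * Real.pi) = Ψ (r, t) := fun r t => by
    simp only [Ψ]; rw [unitVec_add_two_pi]
  let U : Set (ℝ × ℝ) := Set.Ioi 0 ×ˢ Set.univ
  have hUc : Convex ℝ U := (convex_Ioi 0).prod convex_univ
  have hUs : IsSimplyConnected U := by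
    have := hUc.contractibleSpace ⟨(1, 0), Set.mem_Ioi.2 zero_lt_one, trivial⟩
    exact (inferInstance : SimplyConnectedSpace U)
  have hΨ0 : ∀ x ∈ U, Ψ x ≠ 0 := by
    rintro ⟨r, t⟩ ⟨hr, -⟩ h0
    have h1 : F (z₀ + r • unitVec t) = F z₀ :=
      sub_eq_zero.1 ((coord .s2222).injective (h0.trans (coord .s2222).map_zero.symm))
    have h2 : r • unitVec t = 0 := by simpa using hinj h1
    rcases smul_eq_zero.1 h2 with h3 | h3
    · exact (ne_of_gt hr) h3
    · have h4 := coord_unitVec t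
      rw [h3, map_zero] at h4
      exact exp_ne_zero _ h4.symm
  obtain ⟨ℓ, hℓc, hℓ⟩ := exists_continuousOn_eqOn_exp_comp hUs (isOpen_Ioi.prod isOpen_univ)
    (g := Ψ) hΨc.continuousOn (by
      rintro ⟨x, hx, hx0⟩
      exact hΨ0 x hx hx0)
  have hℓ' : ∀ x ∈ U, exp (ℓ x) = Ψ x := fun x hx => hℓ hx
  have hshift : ∀ x ∈ U, (x.1, x.2 + 2 * Real.pi) ∈ U := fun x hx => ⟨hx.1, trivial⟩
  -- the increment of the logarithm around a circle does not depend on the radius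
  have hinc : ∀ r r' : ℝ, 0 < r → 0 < r' →
      ℓ (r, 2 * Real.pi) - ℓ (r, 0) = ℓ (r', 2 * Real.pi) - ℓ (r', 0) := by
    intro r r' hr hr'
    have h1 : ContinuousOn (fun x : ℝ × ℝ => ℓ (x.1, x.2 + 2 * Real.pi) - ℓ x) U := by
      refine (hℓc.comp ?_ hshift).sub hℓc
      fun_prop
    have h2 : ∀ x ∈ U, exp (ℓ (x.1, x.2 + 2 * Real.pi) - ℓ x) = 1 := by
      intro x hx
      rw [exp_sub, hℓ' _ (hshift x hx), hℓ' x hx, hΨper, div_self (hΨ0 x hx)]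
    have h3 := eq_of_exp_eq hUc.isPreconnected h1 (fun x hx y hy => by rw [h2 x hx, h2 y hy])
      (x := (r, 0)) (y := (r', 0)) ⟨hr, trivial⟩ ⟨hr', trivial⟩
    simpa using h3
  have hslice : ∀ r : ℝ, 0 < r → Continuous fun t => ℓ (r, t) := by
    intro r hr
    rw [← continuousOn_univ]
    exact hℓc.comp (by fun_prop) fun t _ => ⟨hr, trivial⟩
  -- on small circles, the increment is given by the positive local index
  obtain ⟨r, ⟨θ, hθc, hθ, n, hn, hθn⟩, hr⟩ := (hz₀.and self_mem_nhdsWithin).exists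
  have hr0 : 0 < r := hr
  have hsmall : ℓ (r, 2 * Real.pi) - ℓ (r, 0) = n * (2 * Real.pi * I) := by
    have hU : ∀ t, (r, t) ∈ U := fun t => ⟨hr0, trivial⟩
    have h1 : Continuous fun t => ℓ (r, t) - (Real.log ‖Ψ (r, t)‖ : ℂ) - θ t * I := by
      have h2 : Continuous fun t => Real.log ‖Ψ (r, t)‖ :=
        Continuous.log (hΨc.comp (by fun_prop)).norm fun t => norm_ne_zero_iff.2 (hΨ0 _ (hU t))
      exact ((hslice r hr0).sub (continuous_ofReal.comp h2)).sub
        ((continuous_ofReal.comp hθc).mul continuous_const)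
    have h2 : ∀ t, exp (ℓ (r, t) - (Real.log ‖Ψ (r, t)‖ : ℂ) - θ t * I) = 1 := by
      intro t
      obtain ⟨ρ, hρ, h3⟩ := hθ t
      have h4 : Ψ (r, t) = ρ * exp (θ t * I) := by
        simp only [Ψ]
        rw [h3, map_smul, coord_unitVec, real_smul]
      have h5 : ‖Ψ (r, t)‖ = ρ := by
        rw [h4, norm_mul, norm_exp_ofReal_mul_I, mul_one, norm_real, Real.norm_of_nonneg hρ.le]
      have hρ0 : (ρ : ℂ) ≠ 0 := by exact_mod_cast hρ.ne'
      rw [exp_sub, exp_sub, hℓ' _ (hU t), ← ofReal_exp, Real.exp_log (h5 ▸ hρ), h5, h4,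
        mul_div_cancel_left₀ _ hρ0, div_self (exp_ne_zero _)]
    have h3 := eq_of_exp_eq isPreconnected_univ h1.continuousOn
      (fun x _ y _ => by rw [h2, h2]) (Set.mem_univ (2 * Real.pi)) (Set.mem_univ 0)
    have h4 : Ψ (r, 2 * Real.pi) = Ψ (r, 0) := by simpa using hΨper r 0
    rw [h4, hθn] at h3
    push_cast at h3
    linear_combination h3
  -- on large circles, a negative determinant makes the term `b exp (-it)` dominant
  obtain ⟨a, b, hab, hdetab⟩ := exists_coord_linAct_eq M
  have hablt : ‖a‖ < ‖b‖ := by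
    have h1 : (M.det : ℝ) < 0 := by exact_mod_cast hdet
    refine lt_of_pow_lt_pow_left₀ 2 (norm_nonneg b) ?_
    linarith
  have hK0 : 0 ≤ K := (norm_nonneg _).trans (hK 0)
  let R : ℝ := (2 * K + 1) / (‖b‖ - ‖a‖)
  have hR0 : 0 < R := div_pos (by linarith) (by linarith)
  have hR : R * ‖a‖ + 2 * K < R * ‖b‖ := by
    have : R * (‖b‖ - ‖a‖) = 2 * K + 1 := div_mul_cancel₀ _ (by linarith)
    linarith
  have hb0 : b ≠ 0 := norm_pos_iff.1 ((norm_nonneg a).trans_lt hablt)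
  have hR0' : (R : ℂ) ≠ 0 := by exact_mod_cast hR0.ne'
  have hlarge : ℓ (R, 2 * Real.pi) - ℓ (R, 0) = -(2 * Real.pi * I) := by
    have hU : ∀ t, (R, t) ∈ U := fun t => ⟨hR0, trivial⟩
    have h1 : ∀ t : ℝ, ‖Ψ (R, t) * exp (t * I) - R * b‖ < R * ‖b‖ := by
      intro t
      have h2 : Ψ (R, t) = R * (a * exp (t * I) + b * exp (-(t * I)))
          + (coord .s2222 (F (z₀ + R • unitVec t) - linAct M (z₀ + R • unitVec t))
            - coord .s2222 (F z₀ - linAct M z₀)) := by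
        rw [← hab, ← real_smul, ← map_smul, ← map_sub, ← map_add]
        simp only [Ψ]
        congr 1
        rw [linAct_add, linAct_smul]
        abel
      have h3 : Ψ (R, t) * exp (t * I) - R * b = R * a * (exp (t * I) * exp (t * I))
          + (coord .s2222 (F (z₀ + R • unitVec t) - linAct M (z₀ + R • unitVec t))
            - coord .s2222 (F z₀ - linAct M z₀)) * exp (t * I) := by
        have h4 : exp (-(t * I)) * exp (t * I) = 1 := by rw [← exp_add]; simp
        rw [h2]
        linear_combination (R * b) * h4
      rw [h3]
      refine (norm_add_le _ _).trans_lt ?_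
      simp only [norm_mul, norm_exp_ofReal_mul_I, mul_one]
      rw [norm_real, Real.norm_of_nonneg hR0.le]
      have h5 := norm_sub_le (coord .s2222 (F (z₀ + R • unitVec t)
        - linAct M (z₀ + R • unitVec t))) (coord .s2222 (F z₀ - linAct M z₀))
      have h6 := hK (z₀ + R • unitVec t)
      have h7 := hK z₀
      linarith
    have h2 : ∀ t : ℝ, Ψ (R, t) * exp (t * I) / (R * b) ∈ slitPlane := by
      intro t
      have h3 : Ψ (R, t) * exp (t * I) / (R * b)
          = 1 + (Ψ (R, t) * exp (t * I) - R * b) / (R * b) := by field_simp; ring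
      rw [h3]
      refine mem_slitPlane_of_norm_lt_one ?_
      rw [norm_div, norm_mul (R : ℂ) b, norm_real, Real.norm_of_nonneg hR0.le,
        div_lt_one (mul_pos hR0 (norm_pos_iff.2 hb0))]
      exact h1 t
    have h3 : Continuous fun t : ℝ =>
        ℓ (R, t) + t * I - log (Ψ (R, t) * exp (t * I) / (R * b)) := by
      have h4 : Continuous fun t : ℝ => log (Ψ (R, t) * exp (t * I) / (R * b)) :=
        Continuous.clog (by fun_prop) h2
      exact ((hslice R hR0).add (continuous_ofReal.mul continuous_const)).sub h4
    have h4 : ∀ t : ℝ, exp (ℓ (R, t) + t * I - log (Ψ (R, t) * exp (t * I) / (R * b)))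
        = R * b := by
      intro t
      rw [exp_sub, exp_add, exp_log (slitPlane_ne_zero (h2 t)), hℓ' _ (hU t)]
      have := hΨ0 _ (hU t)
      have := exp_ne_zero (t * I)
      field_simp
    have h5 := eq_of_exp_eq isPreconnected_univ h3.continuousOn
      (fun x _ y _ => by rw [h4, h4]) (Set.mem_univ (2 * Real.pi)) (Set.mem_univ 0)
    have h6 : Ψ (R, 2 * Real.pi) = Ψ (R, 0) := by simpa using hΨper R 0
    have h7 : exp (((2 * Real.pi : ℝ) : ℂ) * I) = exp (((0 : ℝ) : ℂ) * I) := by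
      push_cast; rw [exp_two_pi_mul_I]; simp
    rw [h6, h7] at h5
    push_cast at h5
    linear_combination h5
  have h1 := hinc r R hr0 hR0
  rw [hsmall, hlarge] at h1
  have h2 : ((n : ℂ) + 1) * (2 * Real.pi * I) = 0 := by linear_combination h1
  rcases mul_eq_zero.1 h2 with h3 | h3
  · exact (Nat.cast_add_one_ne_zero n) h3
  · exact two_pi_I_ne_zero h3

end Winding

theorem PositiveIndexAt.congr {h F : Plane → Plane} {z : Plane} (hz : PositiveIndexAt h z)
    (hF : ∀ᶠ y in 𝓝 z, h y = F y) : PositiveIndexAt F z := by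
  obtain ⟨ε, hε, hball⟩ := Metric.eventually_nhds_iff.1 hF
  have h1 : ∀ᶠ r in 𝓝[>] (0 : ℝ), r < ε := nhdsWithin_le_nhds (gt_mem_nhds hε)
  have hr : ∀ᶠ r in 𝓝[>] (0 : ℝ), ∀ t, h (z + r • unitVec t) = F (z + r • unitVec t) := by
    filter_upwards [h1, self_mem_nhdsWithin] with r h2 h3 t
    apply hball
    have h4 : (0 : ℝ) < r := h3
    rw [dist_eq_norm, add_sub_cancel_left, norm_smul, Real.norm_of_nonneg h4.le]
    have := norm_unitVec_le t
    nlinarith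
  filter_upwards [hz, hr] with r ⟨θ, hθ, h2, h3⟩ h4
  refine ⟨θ, hθ, fun t => ?_, h3⟩
  obtain ⟨ρ, hρ, h5⟩ := h2 t
  exact ⟨ρ, hρ, by rw [← h4 t, ← hF.self_of_nhds, h5]⟩

/-- The lift of an orientation-preserving map has positive local index somewhere. -/
theorem exists_positiveIndexAt_of_lift {s : ParabolicSignature} {φ : Orb s → Orb s}
    (hφ : OrientationPreserving φ) {F : Plane → Plane} (hF : Continuous F)
    (hp : ∀ z, orbProj s (F z) = φ (orbProj s z))
    (hc : ∀ z, F z ∈ conePoints s → z ∈ conePoints s) : ∃ z, PositiveIndexAt F z := by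
  obtain ⟨z, hz⟩ := ((countable_conePoints s).dense_compl ℝ).nonempty
  have hFz : F z ∉ conePoints s := fun h => hz (hc z h)
  obtain ⟨h, hhz, hh, hpos⟩ := hφ z (F z) hz hFz (hp z).symm
  obtain ⟨g, hg, hgF⟩ := exists_eventuallyEq_of_lifts (s := s) (F := F) (F' := h) (x := z)
    (countable_conePoints s).locallyNonseparating (.of_forall fun y => hF.continuousAt)
    (hh.mono fun y hy => hy.1) (hh.mono fun y hy => by rw [hp, hy.2]) (.of_forall fun y => hc y)
  have hg1 : g = 1 := notMem_conePoints_iff.1 hFz g hg (by rw [← hgF.self_of_nhds, hhz])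
  subst hg1
  exact ⟨z, hpos.congr hgF⟩

/-! ### Periodic vectors, translations and lifts of homeomorphisms -/

section PeriodicVectors

variable {A : Matrix (Fin 2) (Fin 2) ℤ}

theorem NoEigenvaluePMOne.eq_zero_of_linAct_eq (hA : NoEigenvaluePMOne A) {y : Plane}
    (h : linAct A y = y) : y = 0 := by
  by_contra hy
  exact hA.1 (Module.End.hasEigenvalue_of_hasEigenvector (x := y)
    ⟨Module.End.mem_eigenspace_iff.2 (by rw [one_smul]; exact h), hy⟩)

theorem NoEigenvaluePMOne.eq_zero_of_linAct_eq_neg (hA : NoEigenvaluePMOne A) {y : Plane}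
    (h : linAct A y = -y) : y = 0 := by
  by_contra hy
  exact hA.2 (Module.End.hasEigenvalue_of_hasEigenvector (x := y)
    ⟨Module.End.mem_eigenspace_iff.2 (by rw [neg_one_smul]; exact h), hy⟩)

theorem linAct_pow (n : ℕ) (z : Plane) : linAct (A ^ n) z = (linAct A)^[n] z := by
  induction n with
  | zero => rw [pow_zero, linAct_one]; rfl
  | succ n ih => rw [pow_succ', linAct_mul, ih, Function.iterate_succ_apply']

theorem eq_one_of_linAct_eq (h : ∀ z, linAct A z = z) : A = 1 := by
  have h1 : ∀ v, A.mulVec v = v := fun v => latticePt_injective (by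
    rw [← linAct_latticePt, h])
  apply Matrix.mulVec_injective
  funext v
  rw [h1, Matrix.one_mulVec]

/-- An integer matrix of determinant different from `±1` with no eigenvalue `±1` has no nonzero
periodic vector. The eigenvalue of a periodic eigenvector would be a real root of unity. A periodic
vector that is not an eigenvector would span the plane together with its image, so that a power of
the matrix would be the identity. -/
theorem eq_zero_of_linAct_iterate_eq (h1 : ∀ y, linAct A y = y → y = 0)
    (h2 : ∀ y, linAct A y = -y → y = 0) (hdet : ¬ IsUnit A.det) {n : ℕ} (hn : 0 < n) {k : Plane}
    (hk : (linAct A)^[n] k = k) : k = 0 := by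
  by_contra hk0
  let m := linAct A k
  have hm : (linAct A)^[n] m = m := by
    simp only [m]
    rw [← Function.iterate_succ_apply, Function.iterate_succ_apply', hk]
  by_cases hD : k 0 * m 1 - k 1 * m 0 = 0
  · obtain ⟨c, hc⟩ : ∃ c : ℝ, m = c • k := by
      by_cases hk00 : k 0 = 0
      · have hk1 : k 1 ≠ 0 := by
          intro h
          apply hk0
          funext i
          fin_cases i
          · exact hk00
          · exact h
        have hm0 : m 0 = 0 := by
          rw [hk00] at hD
          have : k 1 * m 0 = 0 := by linarith
          exact (mul_eq_zero.1 this).resolve_left hk1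
        refine ⟨m 1 / k 1, ?_⟩
        funext i
        fin_cases i
        · simp [hm0, hk00]
        · simp [hk1]
      · refine ⟨m 0 / k 0, ?_⟩
        funext i
        fin_cases i
        · simp [hk00]
        · simp only [Fin.mk_one, Pi.smul_apply, smul_eq_mul]
          field_simp
          linarith
    have hit : ∀ j : ℕ, (linAct A)^[j] k = c ^ j • k := by
      intro j
      induction j with
      | zero => simp
      | succ j ih =>
        rw [Function.iterate_succ_apply', ih, linAct_smul, show linAct A k = c • k from hc,
          smul_smul, pow_succ]
    have hcn : c ^ n = 1 := by
      have h3 := hit n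
      rw [hk] at h3
      have h4 : (c ^ n - 1) • k = 0 := by rw [sub_smul, one_smul, ← h3, sub_self]
      exact sub_eq_zero.1 ((smul_eq_zero.1 h4).resolve_right hk0)
    have habs : |c| = 1 := by
      have h3 : |c| ^ n = 1 := by rw [← abs_pow, hcn, abs_one]
      exact (pow_eq_one_iff_of_nonneg (abs_nonneg c) hn.ne').1 h3
    rcases eq_or_eq_neg_of_abs_eq habs with h | h
    · exact hk0 (h1 k (by rw [show linAct A k = c • k from hc, h, one_smul]))
    · exact hk0 (h2 k (by rw [show linAct A k = c • k from hc, h, neg_one_smul]))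
  · have h3 : A ^ n = 1 := by
      refine eq_one_of_linAct_eq fun y => ?_
      have hy : y = ((y 0 * m 1 - y 1 * m 0) / (k 0 * m 1 - k 1 * m 0)) • k
          + ((k 0 * y 1 - k 1 * y 0) / (k 0 * m 1 - k 1 * m 0)) • m := by
        funext i
        fin_cases i
        · simp only [Fin.zero_eta, Pi.add_apply, Pi.smul_apply, smul_eq_mul]
          rw [div_mul_eq_mul_div, div_mul_eq_mul_div, ← add_div, eq_div_iff hD]
          ring
        · simp only [Fin.mk_one, Pi.add_apply, Pi.smul_apply, smul_eq_mul]
          rw [div_mul_eq_mul_div, div_mul_eq_mul_div, ← add_div, eq_div_iff hD]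
          ring
      rw [hy, linAct_add, linAct_smul, linAct_smul, linAct_pow, linAct_pow, hk, hm]
    apply hdet
    have h4 : A.det ^ n = 1 := by rw [← Matrix.det_pow, h3, Matrix.det_one]
    exact IsUnit.of_pow_eq_one h4 hn.ne'

/-- Such a matrix, if it is injective, maps no finite set other than `{0}` and `∅` into itself. -/
theorem eq_zero_of_mapsTo_finite (h0 : A.det ≠ 0) (h1 : ∀ y, linAct A y = y → y = 0)
    (h2 : ∀ y, linAct A y = -y → y = 0) (hdet : ¬ IsUnit A.det) {E : Set Plane} (hE : E.Finite)
    (hmaps : Set.MapsTo (linAct A) E E) {x : Plane} (hx : x ∈ E) : x = 0 := by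
  have := hE.to_subtype
  obtain ⟨i, j, hij, he⟩ := Finite.exists_ne_map_eq_of_infinite
    (fun i : ℕ => (⟨(linAct A)^[i] x, hmaps.iterate i hx⟩ : E))
  have he' : (linAct A)^[i] x = (linAct A)^[j] x := congrArg Subtype.val he
  have key : ∀ i j : ℕ, i < j → (linAct A)^[i] x = (linAct A)^[j] x → x = 0 := by
    intro i j hij h
    obtain ⟨k, rfl⟩ := Nat.exists_eq_add_of_lt hij
    rw [add_assoc, Function.iterate_add_apply] at h
    exact eq_zero_of_linAct_iterate_eq h1 h2 hdet k.succ_pos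
      ((linAct_bijective h0).1.iterate i h).symm
  rcases lt_or_gt_of_ne hij with h | h
  · exact key i j h he'
  · exact key j i h he'.symm

end PeriodicVectors

/-- An injective endomorphism of the orbifold group acts on the translations by an integer matrix:
the translations are the elements of infinite order and the identity. -/
theorem exists_matrix_of_hom {s : ParabolicSignature} {α : orbGroup s →* orbGroup s}
    (hα : Function.Injective α) : ∃ M : Matrix (Fin 2) (Fin 2) ℤ,
      ∀ v, α (translG s v) = translG s (M.mulVec v) := by
  have h1 : ∀ v, ∃ w, α (translG s v) = translG s w := by
    intro v
    by_cases hu : multiplier s (α (translG s v)).1 = 1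
    · obtain ⟨w, hw⟩ := exists_eq_transl (α (translG s v)).2 hu
      exact ⟨w, Subtype.ext hw⟩
    · exfalso
      obtain ⟨w, -, hw⟩ := orbGroup_spec (α (translG s v)).2
      -- the fixed point of a rotation
      have hfix : (α (translG s v)).1 ((coord s).symm (coord s (latticePt w)
            / (1 - multiplier s (α (translG s v)).1)))
          = (coord s).symm (coord s (latticePt w)
            / (1 - multiplier s (α (translG s v)).1)) := by
        apply (coord s).injective
        rw [hw, (coord s).apply_symm_apply]
        have : 1 - multiplier s (α (translG s v)).1 ≠ 0 := sub_ne_zero.2 fun h => hu h.symm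
        field_simp
        ring
      have h12 : (α (translG s v)) ^ 12 = 1 := by
        refine Subtype.ext (orbGroup_ext (α (translG s v) ^ 12).2 (Subgroup.one_mem _) ?_
          (w := (coord s).symm (coord s (latticePt w)
            / (1 - multiplier s (α (translG s v)).1))) ?_)
        · exact (multiplier_npow (α (translG s v)).2 12).trans
            ((multiplier_pow (α (translG s v)).2).trans (multiplier_one s).symm)
        · exact (mem_stab.1 (Subgroup.pow_mem (stab s _) ⟨(α (translG s v)).2, hfix⟩ 12)).2
      have hnsmul : ∀ n : ℕ, translG s v ^ n = translG s (n • v) := by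
        intro n
        induction n with
        | zero =>
          rw [pow_zero, zero_smul]
          ext z i
          rw [translG_apply]
          simp [latticePt]
        | succ n ih => rw [pow_succ, ih, succ_nsmul, translG_add]
      have hv : translG s (12 • v) = translG s (0 • v) := by
        rw [← hnsmul, ← hnsmul]
        apply hα
        rw [map_pow, h12, pow_zero, map_one]
      have hv0 : v = 0 := by
        have h2 := translG_injective s hv
        rw [zero_smul] at h2
        funext i
        have h3 := congrFun h2 i
        simp only [Pi.smul_apply, Pi.zero_apply, nsmul_eq_mul] at h3
        simpa using h3
      apply hu
      have h2 : translG s v = 1 := by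
        rw [hv0, ← zero_smul ℕ v, ← hnsmul, pow_zero]
      rw [h2, map_one]
      exact multiplier_one s
  choose μ hμ using h1
  let m : (Fin 2 → ℤ) →+ (Fin 2 → ℤ) := AddMonoidHom.mk' μ fun v w => by
    apply translG_injective s
    rw [← hμ, translG_add, map_mul, hμ, hμ, translG_add]
  refine ⟨LinearMap.toMatrix' m.toIntLinearMap, fun v => ?_⟩
  rw [hμ, LinearMap.toMatrix'_mulVec]
  rfl

/-- A path in the plane that projects to a constant path is constant. -/
theorem eq_of_orbProj_const {s : ParabolicSignature} {γ : ℝ → Plane} (hγ : Continuous γ)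
    (h : ∀ t, orbProj s (γ t) = orbProj s (γ 0)) (t t' : ℝ) : γ t = γ t' := by
  have hloc : IsLocallyConstant γ := by
    rw [IsLocallyConstant.iff_eventually_eq]
    intro t
    obtain ⟨U, hU, hd⟩ := eventually_discrete s (γ t)
    have h1 : ∀ᶠ t' in 𝓝 t, γ t' ∈ U := hγ.continuousAt hU
    filter_upwards [h1] with t' ht'
    obtain ⟨g, hg, hgt⟩ := orbProj_eq_iff.1 ((h t).trans (h t').symm)
    rw [← hgt]
    exact hd g hg _ (mem_of_mem_nhds hU) (by rwa [hgt])
  exact hloc.apply_eq_of_preconnectedSpace t t'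

/-- A lift of an order-preserving homeomorphism is invertible, and its inverse is a lift of the
inverse homeomorphism. -/
theorem exists_inverse_lift {s : ParabolicSignature} {φ : Orb s ≃ₜ Orb s}
    (hφ : ∀ x, orbOrder s (φ x) = orbOrder s x) {F : Plane → Plane} (hF : Continuous F)
    (hp : ∀ z, orbProj s (F z) = φ (orbProj s z)) :
    ∃ F' : Plane → Plane, Continuous F' ∧ (∀ z, orbProj s (F' z) = φ.symm (orbProj s z)) ∧
      Function.LeftInverse F' F ∧ Function.RightInverse F' F := by
  have hφ' : ∀ x, orbOrder s (φ.symm x) = orbOrder s x := fun x => by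
    rw [← hφ, φ.apply_symm_apply]
  obtain ⟨F₁, hF₁, hp₁⟩ := exists_lift_isotopy (s := s) (H := fun y : ℝ × Orb s => φ.symm y.2)
    (φ.symm.continuous.comp continuous_snd) (fun _ => φ.symm.injective) (fun _ => hφ')
    (fun _ _ _ _ => rfl)
  obtain ⟨g, hg, h1⟩ := exists_eq_of_lifts (s := s) (B := conePoints s)
    (countable_conePoints s).locallyNonseparating (F := fun z => z) (F' := fun z => F₁ (0, F z))
    continuous_id (hF₁.comp (by fun_prop))
    (fun z => by simp only [hp₁, hp, φ.symm_apply_apply]) (fun z h => h)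
  refine ⟨fun z => g.symm (F₁ (0, z)), (continuous_affineEquiv _).comp (hF₁.comp (by fun_prop)),
    fun z => ?_, fun z => ?_, ?_⟩
  · rw [← orbProj_apply hg, g.apply_symm_apply, hp₁]
  · simp only
    rw [h1, g.symm_apply_apply]
  · have hF₂ : Continuous fun z => g.symm (F₁ (0, z)) :=
      (continuous_affineEquiv _).comp (hF₁.comp (by fun_prop))
    obtain ⟨k, hk, h2⟩ := exists_eq_of_lifts (s := s) (B := conePoints s)
      (countable_conePoints s).locallyNonseparating (F := fun z => z)
      (F' := fun z => F (g.symm (F₁ (0, z)))) continuous_id (hF.comp hF₂)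
      (fun z => by
        rw [hp, ← orbProj_apply hg (g.symm _), g.apply_symm_apply, hp₁, φ.apply_symm_apply])
      (fun z h => h)
    have hk1 : k = 1 := by
      obtain ⟨z, hz⟩ := ((countable_conePoints s).dense_compl ℝ).nonempty
      have hFz : F z ∉ conePoints s := by
        rw [← order_eq_one_iff, ← orbOrder_orbProj, hp, hφ, orbOrder_orbProj, order_eq_one_iff]
        exact hz
      refine notMem_conePoints_iff.1 hFz k hk ?_
      rw [← h2, h1, g.symm_apply_apply]
    intro z
    rw [h2, hk1]
    rfl

/-- An affine map of the plane is determined by its values on the lattice. -/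
theorem eq_of_eq_on_latticePt {f g : Plane →ᵃ[ℝ] Plane}
    (h : ∀ v, f (latticePt v) = g (latticePt v)) : f = g := by
  have key : ∀ (f : Plane →ᵃ[ℝ] Plane) (z : Plane), f z = f (latticePt 0)
      + (z 0 • (f (latticePt ![1, 0]) - f (latticePt 0))
        + z 1 • (f (latticePt ![0, 1]) - f (latticePt 0))) := by
    intro f z
    have h0 : latticePt 0 = 0 := by funext i; simp [latticePt]
    have hd : ∀ z, f z = f.linear z + f 0 := fun z => congrFun f.decomp z
    have hz : z = z 0 • latticePt ![1, 0] + z 1 • latticePt ![0, 1] := by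
      funext i; fin_cases i <;> simp [latticePt]
    rw [h0]
    conv_lhs => rw [hd, hz, map_add, map_smul, map_smul]
    rw [hd (latticePt ![1, 0]), hd (latticePt ![0, 1]), add_sub_cancel_right,
      add_sub_cancel_right]
    abel
  refine AffineMap.ext fun z => ?_
  rw [key f, key g, h, h, h]

/-- An affine equivalence that normalizes the orbifold group descends to a homeomorphism. -/
theorem exists_homeomorph_isQuotientOf {s : ParabolicSignature} {S : Plane ≃ᵃ[ℝ] Plane}
    (h1 : ∀ g ∈ orbGroup s, ∃ g' ∈ orbGroup s, ∀ z, S (g z) = g' (S z))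
    (h2 : ∀ g ∈ orbGroup s, ∃ g' ∈ orbGroup s, ∀ z, S.symm (g z) = g' (S.symm z)) :
    ∃ σ : Orb s ≃ₜ Orb s, IsQuotientOf σ S := by
  have key : ∀ S : Plane ≃ᵃ[ℝ] Plane,
      (∀ g ∈ orbGroup s, ∃ g' ∈ orbGroup s, ∀ z, S (g z) = g' (S z)) →
      ∃ f : Orb s → Orb s, Continuous f ∧ ∀ z, f (orbProj s z) = orbProj s (S z) := by
    intro S hS
    refine ⟨Quotient.lift (fun z => orbProj s (S z)) ?_, ?_, fun z => rfl⟩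
    · rintro z _ ⟨g, hg, rfl⟩
      obtain ⟨g', hg', h⟩ := hS g hg
      rw [h, orbProj_apply hg']
    · exact ((continuous_orbProj s).comp (continuous_affineEquiv S)).quotient_lift _
  obtain ⟨f, hf, hfS⟩ := key S h1
  obtain ⟨f', hf', hfS'⟩ := key S.symm h2
  refine ⟨⟨⟨f, f', fun x => ?_, fun x => ?_⟩, hf, hf'⟩, hfS⟩
  · obtain ⟨z, rfl⟩ := orbProj_surjective s x
    rw [hfS, hfS', S.symm_apply_apply]
  · obtain ⟨z, rfl⟩ := orbProj_surjective s x
    rw [hfS', hfS, S.apply_symm_apply]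

/-- Finitely many orbits meet the unit square in finitely many points. -/
theorem finite_preimage_inter_Icc {s : ParabolicSignature} {Q : Set (Orb s)} (hQ : Q.Finite) :
    (orbProj s ⁻¹' Q ∩ Set.Icc 0 1).Finite := by
  obtain ⟨R, hR⟩ := (isCompact_Icc (a := (0 : Plane)) (b := 1)).exists_bound_of_continuousOn
    (f := coord s) (coord s).continuous.continuousOn
  have h1 : orbProj s ⁻¹' Q ∩ Set.Icc 0 1
      = ⋃ x ∈ Q, (orbProj s ⁻¹' {x} ∩ Set.Icc 0 1) := by
    ext z
    simp only [Set.mem_inter_iff, Set.mem_preimage, Set.mem_iUnion, Set.mem_singleton_iff]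
    aesop
  rw [h1]
  refine hQ.biUnion fun x _ => ?_
  obtain ⟨w, rfl⟩ := orbProj_surjective s x
  refine ((finite_orbGroup_near s w (R + ‖coord s w‖)).image fun g => g w).subset ?_
  rintro z ⟨hz, hzI⟩
  obtain ⟨g, hg, rfl⟩ := orbProj_eq_iff.1 (show orbProj s w = orbProj s z from hz.symm)
  exact ⟨g, ⟨hg, (norm_sub_le _ _).trans (by gcongr; exact hR _ hzI)⟩, rfl⟩

/-! ### Lifting a Thurston equivalence, and rigidity -/

/-- A path of homeomorphisms that is constant on a set containing all cone points, and starts with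
an order-preserving one, lifts to the plane, equivariantly for a fixed automorphism of the orbifold
group. -/
theorem exists_equivariant_lift {s : ParabolicSignature} {φ₀ φ₁ : Orb s ≃ₜ Orb s}
    {Q : Set (Orb s)} (hQ : ∀ x, orbOrder s x ≠ 1 → x ∈ Q)
    (hord : ∀ x, orbOrder s (φ₀ x) = orbOrder s x) (hiso : IsotopicRel φ₀ φ₁ Q) :
    ∃ (F₀ F₁ : Plane → Plane), Continuous F₀ ∧ Continuous F₁ ∧
      (∀ z, orbProj s (F₀ z) = φ₀ (orbProj s z)) ∧ (∀ z, orbProj s (F₁ z) = φ₁ (orbProj s z)) ∧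
      (∀ z, orbProj s z ∈ Q → F₀ z = F₁ z) ∧
      (∀ z, F₁ z ∈ conePoints s → z ∈ conePoints s) ∧
      ∀ g ∈ orbGroup s, ∃ g' ∈ orbGroup s, ∀ z, F₀ (g z) = g' (F₀ z) ∧ F₁ (g z) = g' (F₁ z) := by
  obtain ⟨H, hH, hH0, hH1, hHhomeo, hHQ⟩ := hiso
  let H' : ℝ × Orb s → Orb s := fun y => H (Set.projIcc 0 1 zero_le_one y.1, y.2)
  have hH' : Continuous H' :=
    hH.comp ((continuous_projIcc.comp continuous_fst).prodMk continuous_snd)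
  have hinj : ∀ t, Function.Injective fun x => H' (t, x) := fun t =>
    (hHhomeo (Set.projIcc 0 1 zero_le_one t)).injective
  have hH'Q : ∀ t, ∀ x ∈ Q, H' (t, x) = φ₀ x := fun t x hx => hHQ _ x hx
  have hH'ord : ∀ t x, orbOrder s (H' (t, x)) = orbOrder s x := by
    intro t x
    by_cases hx : orbOrder s x = 1
    · -- the images of the cone points are the cone points, so no other point can reach them
      rw [hx]
      by_contra hne
      have h1 : orbOrder s (φ₀.symm (H' (t, x))) ≠ 1 := by
        rwa [← hord, φ₀.apply_symm_apply]
      have h2 := hH'Q t _ (hQ _ h1)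
      rw [φ₀.apply_symm_apply] at h2
      rw [hinj t h2] at h1
      exact h1 hx
    · rw [hH'Q t x (hQ x hx), hord]
  obtain ⟨F, hF, hp⟩ := exists_lift_isotopy hH' hinj hH'ord (fun t t' z hz => by
    have h1 : orbOrder s (orbProj s z) ≠ 1 := by
      rw [orbOrder_orbProj, Ne, order_eq_one_iff, not_not]; exact hz
    rw [hH'Q t _ (hQ _ h1), hH'Q t' _ (hQ _ h1)])
  have hcone : ∀ y, F y ∈ conePoints s → y.2 ∈ conePoints s := by
    intro y hy
    by_contra h
    refine absurd hy ?_
    rw [← order_eq_one_iff, ← orbOrder_orbProj, hp, hH'ord, orbOrder_orbProj, order_eq_one_iff]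
    exact h
  have hslice : ∀ t : ℝ, Continuous fun z => F (t, z) := fun t => hF.comp (by fun_prop)
  refine ⟨fun z => F (0, z), fun z => F (1, z), hslice 0, hslice 1, fun z => ?_, fun z => ?_,
    fun z hz => ?_, fun z hz => hcone (1, z) hz, fun g hg => ?_⟩
  · rw [hp, ← hH0]
    simp only [H', Set.projIcc_left]
    rfl
  · rw [hp, ← hH1]
    simp only [H', Set.projIcc_right]
    rfl
  · refine eq_of_orbProj_const (s := s) (γ := fun t => F (t, z)) (hF.comp (by fun_prop))
      (fun t => ?_) 0 1
    rw [hp, hp, hH'Q _ _ hz, hH'Q _ _ hz]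
  · obtain ⟨g', hg', h⟩ := exists_eq_of_lifts (s := s) (X := ℝ × Plane)
      (countable_conePoints s).locallyNonseparating_snd (F' := fun y => F (y.1, g y.2)) hF
      (hF.comp (continuous_fst.prodMk ((continuous_affineEquiv g).comp continuous_snd)))
      (fun y => by rw [hp, hp, orbProj_apply hg]) hcone
    exact ⟨g', hg', fun z => ⟨h (0, z), h (1, z)⟩⟩

theorem theoremt (s : ParabolicSignature)
    (A₁ A₂ : Matrix (Fin 2) (Fin 2) ℤ) (b₁ b₂ : Plane)
    (l₁ l₂ : Orb s → Orb s) (Q₁ Q₂ : Set (Orb s))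
    (hl₁ : IsThurstonMap l₁ Q₁) (hl₂ : IsThurstonMap l₂ Q₂)
    (hL₁ : IsQuotientOf l₁ (intAffine A₁ b₁)) (hL₂ : IsQuotientOf l₂ (intAffine A₂ b₂))
    (hA₁ : NoEigenvaluePMOne A₁) (hA₂ : NoEigenvaluePMOne A₂)
    (hequiv : ThurstonEquivalent l₁ Q₁ l₂ Q₂) :
    ∃ (M : Matrix.SpecialLinearGroup (Fin 2) ℤ) (c : Plane) (S : Plane ≃ᵃ[ℝ] Plane),
      (∀ z, S z = intAffine (M : Matrix (Fin 2) (Fin 2) ℤ) c z) ∧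
      (∃ g ∈ orbGroup s, ∀ z, intAffine A₂ b₂ z = g (S (intAffine A₁ b₁ (S.symm z)))) ∧
      S '' (orbProj s ⁻¹' Q₁) = orbProj s ⁻¹' Q₂ ∧
      ∃ σ : Orb s ≃ₜ Orb s, IsQuotientOf σ S ∧
        (∀ x, σ (l₁ x) = l₂ (σ x)) ∧ σ '' Q₁ = Q₂ := by
  obtain ⟨φ₀, φ₁, hφ₀, -, heq, hQQ, hiso, hconj⟩ := hequiv
  have hdet₁ := det_ne_zero_of_isQuotientOf hl₁.branched hL₁
  have hdet₂ := det_ne_zero_of_isQuotientOf hl₂.branched hL₂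
  have hE₁ := isQuotientOf_intAffineEquiv hdet₁ hL₁
  have hE₂ := isQuotientOf_intAffineEquiv hdet₂ hL₂
  obtain ⟨α₁, hα₁⟩ := exists_hom_of_isQuotientOf hE₁
  obtain ⟨α₂, hα₂⟩ := exists_hom_of_isQuotientOf hE₂
  have := finite_quotient_range hα₁
  have := finite_quotient_range hα₂
  have hunit := not_isUnit_det hE₁ hα₁ hl₁.two_le_degree
  have hord := orbOrder_apply_of_equiv hl₁ hl₂ hE₁ hE₂ hα₁ hα₂ heq hQQ hconj
  have hPQ : ∀ x, orbOrder s x ≠ 1 → x ∈ Q₁ := fun x hx => hl₁.mem_of_orbOrder_ne_one hE₁ hα₁ hx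
  -- the lifts of the isotopy and of the inverse, and the automorphism of the orbifold group
  obtain ⟨F₀, F₁, hF₀, hF₁, hp₀, hp₁, hF₀₁, hcone₁, hequi⟩ := exists_equivariant_lift hPQ hord hiso
  have hcone₀ : ∀ z, F₀ z ∈ conePoints s ↔ z ∈ conePoints s := by
    intro z
    rw [← not_iff_not, ← order_eq_one_iff, ← order_eq_one_iff, ← orbOrder_orbProj, hp₀, hord,
      orbOrder_orbProj]
  obtain ⟨F', hF', hp', hleft, hright⟩ := exists_inverse_lift hord hF₀ hp₀
  have hord' : ∀ x, orbOrder s (φ₀.symm x) = orbOrder s x := fun x => by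
    rw [← hord, φ₀.apply_symm_apply]
  obtain ⟨α, hα⟩ := exists_intertwined_hom hright.surjective
    (fun g hg => (hequi g hg).imp fun g' h => ⟨h.1, fun z => (h.2 z).1⟩)
  have hα' : ∀ g z, F₁ (g.1 z) = (α g).1 (F₁ z) := by
    intro g z
    obtain ⟨g', hg', h⟩ := hequi g.1 g.2
    have h1 : (α g).1 = g' := by
      ext1 y
      obtain ⟨x, rfl⟩ := hright.surjective y
      rw [← hα, (h x).1]
    rw [(h z).2, h1]
  obtain ⟨β, hβ⟩ := exists_intertwined_hom (s := s) hleft.surjective fun g hg => by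
    obtain ⟨g', hg', h⟩ := exists_eq_of_lifts (s := s) (B := conePoints s)
      (countable_conePoints s).locallyNonseparating (F' := fun z => F' (g z)) hF'
      (hF'.comp (continuous_affineEquiv g))
      (fun y => by rw [hp', hp', orbProj_apply hg])
      (fun y hy => by rw [← hcone₀, hright y] at hy; exact hy)
    exact ⟨g', hg', h⟩
  have hβα : ∀ g, β (α g) = g := by
    intro g
    ext1; ext1 z
    have h1 := hβ (α g) (F₀ z)
    rw [← hα, hleft, hleft] at h1
    exact h1.symm
  have hαβ : ∀ g, α (β g) = g := by
    intro g
    ext1; ext1 z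
    have h1 := hα (β g) (F' z)
    rw [← hβ, hright, hright] at h1
    exact h1.symm
  have hαinj : Function.Injective α := Function.LeftInverse.injective hβα
  obtain ⟨M, hM⟩ := exists_matrix_of_hom hαinj
  obtain ⟨N, hN⟩ := exists_matrix_of_hom (Function.LeftInverse.injective hαβ)
  have hF₀M : ∀ z v, F₀ (z + latticePt v) = F₀ z + latticePt (M.mulVec v) := by
    intro z v
    have := hα (translG s v) z
    rwa [hM, translG_apply, translG_apply] at this
  have hF₁M : ∀ z v, F₁ (z + latticePt v) = F₁ z + latticePt (M.mulVec v) := by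
    intro z v
    have := hα' (translG s v) z
    rwa [hM, translG_apply, translG_apply] at this
  have hNM : N * M = 1 := by
    apply Matrix.mulVec_injective
    funext v
    rw [← Matrix.mulVec_mulVec, Matrix.one_mulVec]
    apply translG_injective s
    rw [← hN, ← hM, hβα]
  -- `M` is invertible over the integers, and the orientation excludes the determinant `-1`
  have hMdet : M.det = 1 := by
    obtain ⟨z, hz⟩ := exists_positiveIndexAt_of_lift hφ₀ hF₀ hp₀ fun z => (hcone₀ z).1
    have h1 := det_nonneg_of_positiveIndexAt hF₀ hleft.injective hF₀M hz
    have h2 : N.det * M.det = 1 := by rw [← Matrix.det_mul, hNM, Matrix.det_one]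
    rcases Int.isUnit_iff.1 (IsUnit.of_mul_eq_one_right _ h2) with h3 | h3
    · exact h3
    · omega
  have hM0 : M.det ≠ 0 := by rw [hMdet]; exact one_ne_zero
  -- `F₀ ∘ L₁` and `L₂ ∘ F₁` lift the same map, hence differ by an element of the orbifold group
  obtain ⟨k, hk, hkF⟩ := exists_eq_of_lifts (s := s)
    (B := intAffineEquiv A₁ b₁ hdet₁ ⁻¹' conePoints s)
    ((countable_conePoints s).preimage (intAffineEquiv A₁ b₁ hdet₁).injective).locallyNonseparating
    (F := fun z => intAffineEquiv A₂ b₂ hdet₂ (F₁ z))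
    (F' := fun z => F₀ (intAffineEquiv A₁ b₁ hdet₁ z))
    ((continuous_affineEquiv _).comp hF₁) (hF₀.comp (continuous_affineEquiv _))
    (fun z => by rw [← hE₂, hp₁, hp₀, ← hE₁, hconj])
    (fun z hz => by
      rw [Set.mem_preimage, ← hcone₀]
      by_contra h
      refine absurd hz ?_
      rw [← order_eq_one_iff] at h ⊢
      rw [← orbOrder_orbProj] at h ⊢
      rw [← hE₂, hp₁, ← hconj, ← h, hp₀, ← hE₁])
  simp only [intAffineEquiv_apply, intAffine_eq] at hkF
  obtain ⟨Rk, -, vk, hkR⟩ := id hk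
  let A' : Matrix (Fin 2) (Fin 2) ℤ := Rk * A₂
  let b' : Plane := linAct Rk b₂ + latticePt vk
  have hkA : ∀ z, k (linAct A₂ z + b₂) = linAct A' z + b' := by
    intro z
    rw [hkR, intAffine_eq, linAct_add, linAct_mul, add_assoc]
    rfl
  have hMA : M * A₁ = A' * M := by
    apply Matrix.mulVec_injective
    funext v
    apply latticePt_injective
    have h1 := hkF (0 + latticePt v)
    have h2 := hkF 0
    rw [linAct_add, linAct_latticePt, add_right_comm, hF₀M, hF₁M, hkA, linAct_add,
      linAct_latticePt, h2, hkA, add_right_comm] at h1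
    rw [← Matrix.mulVec_mulVec, ← Matrix.mulVec_mulVec]
    exact add_left_cancel (add_right_cancel h1)
  have hMA' : ∀ z, linAct M (linAct A₁ z) = linAct A' (linAct M z) := fun z => by
    rw [← linAct_mul, hMA, linAct_mul]
  have hdetA' : A'.det = A₁.det := by
    have h1 := congrArg Matrix.det hMA
    rw [Matrix.det_mul, Matrix.det_mul, hMdet, one_mul, mul_one] at h1
    exact h1.symm
  have hA'1 : ∀ y, linAct A' y = y → y = 0 := by
    intro y hy
    obtain ⟨x, rfl⟩ := (linAct_bijective hM0).2 y
    rw [← hMA'] at hy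
    rw [hA₁.eq_zero_of_linAct_eq ((linAct_bijective hM0).1 hy), linAct_zero]
  have hA'2 : ∀ y, linAct A' y = -y → y = 0 := by
    intro y hy
    obtain ⟨x, rfl⟩ := (linAct_bijective hM0).2 y
    rw [← hMA', ← zero_sub, ← linAct_zero M, ← linAct_sub, zero_sub] at hy
    rw [hA₁.eq_zero_of_linAct_eq_neg ((linAct_bijective hM0).1 hy), linAct_zero]
  -- the translation part `c`: the affine map `M z + c` satisfies the same relation as the lift
  obtain ⟨c, hc⟩ : ∃ c, linAct A' c + (b' - linAct M b₁) = c := by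
    have h1 : ∀ y, linAct (1 - A') y = y - linAct A' y := by
      intro y
      funext i
      fin_cases i <;> simp [linAct, Matrix.mulVec, dotProduct, Fin.sum_univ_two] <;> ring
    have h2 : Function.Injective (linAct (1 - A')) := by
      intro x y hxy
      have h3 : linAct (1 - A') (x - y) = 0 := by rw [linAct_sub, hxy, sub_self]
      rw [h1] at h3
      exact sub_eq_zero.1 (hA'1 _ (sub_eq_zero.1 h3).symm)
    obtain ⟨c, hc⟩ := (Matrix.mulVec_surjective_iff_isUnit.2
      (Matrix.mulVec_injective_iff_isUnit.1 h2)) (b' - linAct M b₁)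
    refine ⟨c, ?_⟩
    have h3 : c - linAct A' c = b' - linAct M b₁ := by rw [← h1]; exact hc
    rw [← h3, add_sub_cancel]
  -- on the marked points the lift is affine
  have hmarked : ∀ z, orbProj s z ∈ Q₁ → F₀ z = linAct M z + c := by
    let D : Plane → Plane := fun z => F₀ z - linAct M z - c
    have hDper : ∀ z v, D (z + latticePt v) = D z := by
      intro z v
      simp only [D]
      rw [hF₀M, linAct_add, linAct_latticePt]
      abel
    have hfin : (D '' (orbProj s ⁻¹' Q₁)).Finite := by
      refine ((finite_preimage_inter_Icc hl₁.finite).image D).subset ?_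
      rintro _ ⟨z, hz, rfl⟩
      obtain ⟨v, hv⟩ := exists_sub_latticePt_mem z
      refine ⟨z - latticePt v, ⟨?_, hv⟩, ?_⟩
      · rw [Set.mem_preimage, ← orbProj_apply (transl_mem s v), transl_apply, sub_add_cancel]
        exact hz
      · rw [← hDper _ v, sub_add_cancel]
    have hmaps : Set.MapsTo (linAct A') (D '' (orbProj s ⁻¹' Q₁)) (D '' (orbProj s ⁻¹' Q₁)) := by
      rintro _ ⟨z, hz, rfl⟩
      refine ⟨linAct A₁ z + b₁, ?_, ?_⟩
      · rw [Set.mem_preimage, ← intAffine_eq, ← hL₁]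
        exact hl₁.invariant ⟨_, hz, rfl⟩
      · -- `F₀ = F₁` at the marked points turns the relation between the lifts into one for `F₀`
        simp only [D]
        rw [hkF, hkA, ← hF₀₁ z hz, linAct_add, hMA', linAct_sub, linAct_sub]
        nth_rewrite 1 [← hc]
        abel
    intro z hz
    have h1 := eq_zero_of_mapsTo_finite (hdetA' ▸ hdet₁) hA'1 hA'2 (hdetA' ▸ hunit) hfin hmaps
      ⟨z, hz, rfl⟩
    have h2 : F₀ z - linAct M z = c := sub_eq_zero.1 h1
    rw [← h2, add_sub_cancel]
  let S : Plane ≃ᵃ[ℝ] Plane := intAffineEquiv M c hM0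
  have hS : ∀ z, S z = linAct M z + c := fun z => by
    rw [← intAffine_eq]; exact intAffineEquiv_apply _ _ _ _
  have hSF : ∀ z, orbProj s z ∈ Q₁ → S z = F₀ z := fun z hz => by rw [hS, hmarked z hz]
  -- the affine map intertwines the two maps, up to the orbifold group
  have hkS : ∀ z, S (intAffine A₁ b₁ z) = k (intAffine A₂ b₂ (S z)) := by
    intro z
    rw [intAffine_eq, intAffine_eq, hkA, hS, hS, linAct_add, linAct_add, hMA']
    nth_rewrite 1 [← hc]
    abel
  have hlat : ∀ v, orbProj s (latticePt v) ∈ Q₁ := by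
    intro v
    apply hPQ
    rw [orbOrder_orbProj, Ne, order_eq_one_iff, not_not]
    exact latticePt_mem_conePoints s v
  -- the affine map and the lift induce the same automorphism of the orbifold group
  have hSα : ∀ g z, S (g.1 z) = (α g).1 (S z) := by
    intro g z
    have h1 : ((g.1.trans S : Plane ≃ᵃ[ℝ] Plane) : Plane →ᵃ[ℝ] Plane)
        = ((S.trans (α g).1 : Plane ≃ᵃ[ℝ] Plane) : Plane →ᵃ[ℝ] Plane) := by
      refine eq_of_eq_on_latticePt fun v => ?_
      change S (g.1 (latticePt v)) = (α g).1 (S (latticePt v))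
      rw [hSF _ (hlat v), hSF, hα]
      rw [orbProj_apply g.2]
      exact hlat v
    exact congrArg (fun f : Plane →ᵃ[ℝ] Plane => f z) h1
  have hSQ : S '' (orbProj s ⁻¹' Q₁) = orbProj s ⁻¹' Q₂ := by
    ext y
    constructor
    · rintro ⟨z, hz, rfl⟩
      rw [Set.mem_preimage, hSF z hz, hp₀, ← hQQ]
      exact ⟨_, hz, rfl⟩
    · intro hy
      rw [Set.mem_preimage, ← hQQ] at hy
      obtain ⟨x, hx, hxy⟩ := hy
      have h1 : orbProj s (F' y) ∈ Q₁ := by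
        rw [hp', ← hxy, φ₀.symm_apply_apply]; exact hx
      exact ⟨F' y, h1, by rw [hSF _ h1, hright]⟩
  obtain ⟨σ, hσ⟩ := exists_homeomorph_isQuotientOf (s := s) (S := S)
    (fun g hg => ⟨(α ⟨g, hg⟩).1, (α ⟨g, hg⟩).2, hSα ⟨g, hg⟩⟩)
    (fun g hg => ⟨(β ⟨g, hg⟩).1, (β ⟨g, hg⟩).2, fun z => by
      apply S.injective
      rw [hSα, S.apply_symm_apply, S.apply_symm_apply, hαβ]⟩)
  refine ⟨⟨M, hMdet⟩, c, S, fun z => hS z, ⟨k⁻¹, Subgroup.inv_mem _ hk, fun z => ?_⟩, hSQ, σ, hσ,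
    fun x => ?_, ?_⟩
  · rw [hkS, S.apply_symm_apply]
    exact (k.symm_apply_apply _).symm
  · obtain ⟨z, rfl⟩ := orbProj_surjective s x
    rw [hL₁, hσ, hσ, hL₂, hkS, orbProj_apply hk]
  · ext y
    constructor
    · rintro ⟨x, hx, rfl⟩
      obtain ⟨z, rfl⟩ := orbProj_surjective s x
      rw [hσ]
      exact hSQ.subset ⟨z, hx, rfl⟩
    · intro hy
      obtain ⟨w, rfl⟩ := orbProj_surjective s y
      obtain ⟨z, hz, rfl⟩ := hSQ.superset hy
      exact ⟨orbProj s z, hz, hσ z⟩
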